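/- **Definitions.** A ribbon graph is a finite connected graph with at least one edge (loops and multiple edges allowed), with a cyclic ordering of the half-edges at each vertex; its faces are its boundary components. A metric assigns a positive length to each edge, and is integer if all lengths are integers. The perimeter of a face is the sum of the lengths of the edges incident to it, an edge incident twice being counted twice. For a partition $\underline\kappa$, let $\mathcal{RG}^{\underline\kappa}_{g,n}$ be the set of isomorphism classes of ribbon graphs of genus $g$ with $n$ labeled faces and vertex degrees given by $\underline\kappa$, and $\mathcal{RG}^{\underline\kappa,*}_{g,n}$ the set of isomorphism classes of their duals, which have $n$ labeled vertices. Let $$F^{\underline\kappa}_{g,n}(b)=\sum_{G\in\mathcal{RG}^{\underline\kappa}_{g,n}}\frac{F_G(b)}{|\mathrm{Aut}(G)|},$$ where $F_G(b)$ is the number of integer metrics on $G$ with face perimeters $b=(b_1,\dots,b_n)$. Let $G$ be a non-bipartite ribbon graph with vertices labeled $1,\dots,n$. Let $\mathrm{vp}_G:\mathbb R^{E(G)}\to\mathbb R^n$ send a weight function $w$ to its vertex perimeters, $\mathrm{vp}_G(w)_v$ being the sum of the weights of the edges at $v$, loops counted twice. An edge $e$ is static, $e\in S(G)$, if some connected component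 of $G-e$ is bipartite. For such $e$, let $f_e(b)=\frac1k\big(\sum_{i\in I}b_i-\sum_{j\in J}b_j\big)$, where $I,J$ are the two parts of a bipartite component of $G-e$, $I$ being the part containing an end of $e$, and $k=1$ if $e$ is a bridge, $k=2$ otherwise; this is the weight of $e$ for every weight function with vertex perimeters $b$. Let $$P_G(b)=\{w\in\mathrm{vp}_G^{-1}(b): w(e)\ge 0\ \text{for all } e\in E(G)\setminus S(G)\},$$ let $\mathrm{int}\,P_G(b)$ be its interior relative to $\mathrm{vp}_G^{-1}(b)$, and let $\mathrm{Vol}\,P_G(b)$ be its volume for the quotient of the standard Euclidean volume forms of $\mathbb R^{E(G)}$ and $\mathbb R^n$. Let $V^*_G(b)=\mathrm{Vol}\,P_G(b)$ if $f_e(b)>0$ for all $e\in S(G)$, and $V^*_G(b)=0$ otherwise. For $\underline\kappa$ with all parts odd (then all graphs in $\mathcal{RG}^{\underline\kappa,*}_{g,n}$ are non-bipartite), let $$V^{\underline\kappa}_{g,n}(b)=\sum_{G\in\mathcal{RG}^{\underline\kappa,*}_{g,n}}\frac{V^*_G(b)}{|\mathrm{Aut}(G)|}.$$ The hyperplanes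 $\sum_{i\in I}b_i-\sum_{j\in J}b_j=0$, with $I,J\subset\{1,\dots,n\}$ disjoint and not both empty, subdivide $\mathbb R^n$ into relatively open polyhedral cones called cells: the non-empty sets on which each of these linear forms has a prescribed sign ($+$, $-$ or $0$). **Proposition.** Let $G$ be a non-bipartite ribbon graph with $n$ labeled vertices and let $C$ be a cell in $\mathbb R^n$ with closure $\overline C$. 1. For every coset $\Lambda$ of $2\mathbb Z^n$ in $\mathbb Z^n$, $|\mathrm{int}\,P_G(b)\cap\mathbb Z^{E(G)}|$ is given for $b\in C\cap\Lambda$ by a polynomial in $b$ of degree at most $|E(G)|-|V(G)|$. 2. $\mathrm{Vol}\,P_G(b)$ is given for $b\in\overline C$ by a polynomial in $b$, which is either identically zero on $\overline C$ or of degree $|E(G)|-|V(G)|$ (and no polynomial of smaller degree agrees with it on $\overline C$). **Corollary.** Let $g,n\ge 0$, let $\underline\kappa$ be a partition with $\ell(\underline\kappa)$ parts, all of them odd, and let $C$ be a cell in $\mathbb R^n$. 1. For every coset $\Lambda$ of $2\mathbb Z^n$ in $\mathbb Z^n$, $F^{\underline\kappa}_{g,n}(b)$ is given for $b\in C\cap\Lambda$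 by a polynomial in $b$ of degree at most $2g-2+\ell(\underline\kappa)$ (if this number is negative, $F^{\underline\kappa}_{g,n}=0$). 2. $V^{\underline\kappa}_{g,n}(b)$ is given by a polynomial in $b$ for $b\in C$. 3. Let $\Lambda$ be a coset of $2\mathbb Z^n$ in $\mathbb Z^n$ on which $b_1+\dots+b_n$ is even, with $C\cap\Lambda\ne\emptyset$. For every polynomial giving $F^{\underline\kappa}_{g,n}$ on $C\cap\Lambda$, its homogeneous part of degree $2g-2+\ell(\underline\kappa)$ equals $2V^{\underline\kappa}_{g,n}(b)$ for all $b\in C$. -/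

import Mathlib

/-- A ribbon graph (combinatorial map), given by its finite set `H` of half-edges:
`next` sends a half-edge to the following one in the (counterclockwise) cyclic order around its
vertex, and `opp` exchanges the two half-edges of every edge.
Vertices are the cycles of `next`, edges are the two-element orbits of `opp`. -/
structure RibbonGraph (H : Type*) where
  next : Equiv.Perm H
  opp : Equiv.Perm H
  opp_opp : ∀ h, opp (opp h) = h
  opp_ne : ∀ h, opp h ≠ h

namespace RibbonGraph

variable {H : Type*}

/-- The face permutation: arriving at the end of the half-edge `h`, turn left.
Its cycles are the faces (boundary components); `h` belongs to the face on its left. -/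
def faceNext (G : RibbonGraph H) : Equiv.Perm H := G.next⁻¹ * G.opp

/-- The vertices: cycles of `next`. -/
def Vertex (G : RibbonGraph H) : Type _ := Quotient (Equiv.Perm.SameCycle.setoid G.next)

/-- The edges: orbits of `opp`. -/
def Edge (G : RibbonGraph H) : Type _ := Quotient (Equiv.Perm.SameCycle.setoid G.opp)

/-- The faces: cycles of `faceNext`. -/
def Face (G : RibbonGraph H) : Type _ := Quotient (Equiv.Perm.SameCycle.setoid G.faceNext)

/-- The vertex a half-edge is issued from. -/
def vertexOf (G : RibbonGraph H) (h : H) : G.Vertex := Quotient.mk _ h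

/-- The edge containing a half-edge. -/
def edgeOf (G : RibbonGraph H) (h : H) : G.Edge := Quotient.mk _ h

noncomputable instance (G : RibbonGraph H) [Finite H] : Fintype G.Vertex :=
  have : Finite G.Vertex := Quotient.finite _
  Fintype.ofFinite _

noncomputable instance (G : RibbonGraph H) [Finite H] : Fintype G.Edge :=
  have : Finite G.Edge := Quotient.finite _
  Fintype.ofFinite _

noncomputable instance (G : RibbonGraph H) [Finite H] : Fintype G.Face :=
  have : Finite G.Face := Quotient.finite _
  Fintype.ofFinite _

/-- The graph is non-empty and connected. -/
def Connected (G : RibbonGraph H) : Prop :=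
  Nonempty H ∧ MulAction.IsPretransitive (Subgroup.closure {G.next, G.opp}) H

/-- `G` has genus `g`, by Euler's formula `|V| - |E| + |F| = 2 - 2g`
(used for connected ribbon graphs). -/
def HasGenus [Finite H] (G : RibbonGraph H) (g : ℕ) : Prop :=
  (Fintype.card G.Vertex : ℤ) - Fintype.card G.Edge + Fintype.card G.Face = 2 - 2 * g

/-- The multiset of degrees (valencies) of the vertices, a loop being counted twice. -/
noncomputable def vertexDegrees [Finite H] (G : RibbonGraph H) : Multiset ℕ :=
  (Finset.univ : Finset G.Vertex).val.map fun v => Nat.card {h : H // G.vertexOf h = v}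

end RibbonGraph

/-- A ribbon graph whose half-edges carry labels in `{1, …, n}`; it is used with
`FaceLabelled` or `VertexLabelled` below, where the labelling amounts to a bijection
between the faces, respectively the vertices, and `Fin n`. -/
structure LabelledRibbonGraph (n : ℕ) (H : Type*) extends RibbonGraph H where
  label : H → Fin n

namespace LabelledRibbonGraph

variable {n : ℕ} {H : Type*}

/-- The faces are labelled bijectively by `Fin n`; `label h` is the label of the face of `h`. -/
def FaceLabelled (G : LabelledRibbonGraph n H) : Prop :=
  Function.Surjective G.label ∧ ∀ h h', G.label h = G.label h' ↔ G.faceNext.SameCycle h h'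

/-- The vertices are labelled bijectively by `Fin n`; `label h` is the label of the vertex
from which `h` is issued. -/
def VertexLabelled (G : LabelledRibbonGraph n H) : Prop :=
  Function.Surjective G.label ∧ ∀ h h', G.label h = G.label h' ↔ G.next.SameCycle h h'

/-- The dual ribbon graph. The half-edge `h` of the dual is issued from the face on the left of
`h` and crosses the edge of `h`; around the dual vertex the half-edges follow the boundary of the
face. Face labels of `G` become vertex labels of the dual. -/
def dual (G : LabelledRibbonGraph n H) : LabelledRibbonGraph n H where
  next := G.faceNext
  opp := G.opp
  opp_opp := G.opp_opp
  opp_ne := G.opp_ne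
  label := G.label

/-- Isomorphisms of labelled ribbon graphs: bijections between half-edges preserving the
structure and the labels. -/
def Iso (G G' : LabelledRibbonGraph n H) : Type _ :=
  {e : Equiv.Perm H // (∀ h, e (G.next h) = G'.next (e h)) ∧ (∀ h, e (G.opp h) = G'.opp (e h)) ∧
    ∀ h, G'.label (e h) = G.label h}

/-- Being isomorphic. -/
def isoSetoid (n : ℕ) (H : Type*) : Setoid (LabelledRibbonGraph n H) where
  r G G' := Nonempty (Iso G G')
  iseqv := by
    refine ⟨fun G => ⟨⟨1, by simp⟩⟩, ?_, ?_⟩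
    · rintro G G' ⟨⟨e, h1, h2, h3⟩⟩
      refine ⟨⟨e.symm, fun h => ?_, fun h => ?_, fun h => ?_⟩⟩
      · rw [Equiv.symm_apply_eq, h1, Equiv.apply_symm_apply]
      · rw [Equiv.symm_apply_eq, h2, Equiv.apply_symm_apply]
      · rw [← h3, Equiv.apply_symm_apply]
    · rintro G G' G'' ⟨⟨e, h1, h2, h3⟩⟩ ⟨⟨f, k1, k2, k3⟩⟩
      refine ⟨⟨e.trans f, fun h => ?_, fun h => ?_, fun h => ?_⟩⟩ <;> simp [*]

/-- The order of the automorphism group (automorphisms preserve the labels). -/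
noncomputable def cardAut (G : LabelledRibbonGraph n H) : ℕ := Nat.card (Iso G G)

/-- Isomorphism classes of labelled ribbon graphs with half-edge set `{1, …, m}`. -/
abbrev IsoClass (n m : ℕ) : Type := Quotient (isoSetoid n (Fin m))

/-- Isomorphism classes of (connected) ribbon graphs of genus `g` with `n` labelled faces and
vertex degrees given by the partition `κ` of `m` (so there are `m` half-edges). -/
def classes (g n : ℕ) {m : ℕ} (κ : m.Partition) : Set (IsoClass n m) :=
  {c | ∃ G : LabelledRibbonGraph n (Fin m), Quotient.mk _ G = c ∧
    G.Connected ∧ G.FaceLabelled ∧ G.HasGenus g ∧ G.vertexDegrees = κ.parts}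

/-- Isomorphism classes of duals of the ribbon graphs in `classes g n κ`. -/
def dualClasses (g n : ℕ) {m : ℕ} (κ : m.Partition) : Set (IsoClass n m) :=
  {c | ∃ G : LabelledRibbonGraph n (Fin m), Quotient.mk _ G.dual = c ∧
    G.Connected ∧ G.FaceLabelled ∧ G.HasGenus g ∧ G.vertexDegrees = κ.parts}

section Weights

variable [Fintype H]

open Classical in
/-- For each label `i`, the sum of the weights of the edges of the half-edges labelled `i`. For a
vertex-labelled graph these are the vertex perimeters (loops are counted twice); for a
face-labelled graph these are the perimeters of the faces (an edge incident twice to a face is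
counted twice). -/
noncomputable def perimeters (G : LabelledRibbonGraph n H) :
    (G.Edge → ℝ) →ₗ[ℝ] (Fin n → ℝ) where
  toFun w := fun i => ∑ h with G.label h = i, w (G.edgeOf h)
  map_add' w w' := by ext i; simp [Finset.sum_add_distrib]
  map_smul' c w := by ext i; simp [Finset.mul_sum]

/-- The number of integer metrics on the face-labelled ribbon graph `G` with perimeters `b`. -/
noncomputable def metricCount (G : LabelledRibbonGraph n H) (b : Fin n → ℤ) : ℕ :=
  {l : G.Edge → ℤ | (∀ e, 0 < l e) ∧
    G.perimeters (fun e => (l e : ℝ)) = fun i => (b i : ℝ)}.ncard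

end Weights

/-! ### Bipartiteness and static edges of vertex-labelled ribbon graphs -/

/-- The underlying graph is bipartite. -/
def Bipartite (G : LabelledRibbonGraph n H) : Prop :=
  ∃ c : Fin n → Bool, ∀ h, c (G.label h) ≠ c (G.label (G.opp h))

/-- The vertices `u` and `v` lie in the same connected component of `G - e`. -/
def SameComponent (G : LabelledRibbonGraph n H) (e : G.Edge) : Fin n → Fin n → Prop :=
  Relation.ReflTransGen fun u v =>
    ∃ h, G.edgeOf h ≠ e ∧ G.label h = u ∧ G.label (G.opp h) = v

/-- `c` is a proper colouring, in two colours, of the connected component of `v` in `G - e`. -/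
def IsColouring (G : LabelledRibbonGraph n H) (e : G.Edge) (v : Fin n) (c : Fin n → Bool) :
    Prop :=
  ∀ h, G.edgeOf h ≠ e → G.SameComponent e v (G.label h) →
    c (G.label h) ≠ c (G.label (G.opp h))

/-- The edge `e` is static: some connected component of `G - e` is bipartite. -/
def IsStatic (G : LabelledRibbonGraph n H) (e : G.Edge) : Prop :=
  ∃ (v : Fin n) (c : Fin n → Bool), G.IsColouring e v c

/-- `1` for one colour and `-1` for the other. -/
def colourSign : Bool → ℝ
  | true => 1
  | false => -1

open Classical in
/-- The value `f_e(b)` of the weight of a static edge `e` as a linear function of the vertex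
perimeters `b`, namely `± (∑_{i ∈ I} b_i - ∑_{j ∈ J} b_j) / k`, where `I` and `J` are the parts of a
bipartite component of `G - e` and `k` is the number of ends of `e` in it (`1` if `e` is a bridge
and `2` otherwise). Dividing by the signed number of ends counts the part adjacent to `e` with the
sign `+`. -/
noncomputable def staticWeight [Fintype H] (G : LabelledRibbonGraph n H) {e : G.Edge}
    (he : G.IsStatic e) (b : Fin n → ℝ) : ℝ :=
  let v := he.choose
  let c := he.choose_spec.choose
  (∑ u with G.SameComponent e v u, colourSign (c u) * b u) /
    ∑ h with G.edgeOf h = e ∧ G.SameComponent e v (G.label h), colourSign (c (G.label h))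

/-! ### Polytopes of metrics -/

section Polytope

variable [Fintype H]

/-- The affine space of weight functions with vertex perimeters `b`. -/
def fibre (G : LabelledRibbonGraph n H) (b : Fin n → ℝ) : Set (G.Edge → ℝ) :=
  {w | G.perimeters w = b}

/-- The polytope `P_G(b)`. -/
def polytope (G : LabelledRibbonGraph n H) (b : Fin n → ℝ) : Set (G.Edge → ℝ) :=
  {w | w ∈ G.fibre b ∧ ∀ e, ¬ G.IsStatic e → 0 ≤ w e}

/-- The interior of `P_G(b)` relative to the affine space of weight functions with vertex
perimeters `b`. -/
def relInterior (G : LabelledRibbonGraph n H) (b : Fin n → ℝ) : Set (G.Edge → ℝ) :=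
  Subtype.val '' interior {w : G.fibre b | (w : G.Edge → ℝ) ∈ G.polytope b}

/-- The number of integer points in the relative interior of `P_G(b)`. -/
noncomputable def interiorCount (G : LabelledRibbonGraph n H) (b : Fin n → ℝ) : ℕ :=
  {l : G.Edge → ℤ | (fun e => (l e : ℝ)) ∈ G.relInterior b}.ncard

end Polytope

end LabelledRibbonGraph

/-! ### Quotient volume on the fibres of a linear map -/

section QuotientVolume

open MeasureTheory

variable {E V : Type*} [Fintype E] [Fintype V]

/-- The prism over `S` spanned by the image of the unit cube under `s`. -/
def prism (s : (V → ℝ) →ₗ[ℝ] (E → ℝ)) (S : Set (E → ℝ)) : Set (E → ℝ) :=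
  {x | ∃ w ∈ S, ∃ t ∈ Set.Icc (0 : V → ℝ) 1, x = w + s t}

open Classical in
/-- The volume of a subset `S` of a fibre of a surjective linear map `A : ℝ^E → ℝ^V`, for the
quotient of the Euclidean volume forms of `ℝ^E` and `ℝ^V`: if `s` is a linear right inverse of `A`,
then `S + s([0,1]^V)` has volume `Vol(S) * vol([0,1]^V) = Vol(S)`. By `quotientVolume_eq` this does
not depend on the choice of `s`. -/
noncomputable def quotientVolume (A : (E → ℝ) →ₗ[ℝ] (V → ℝ)) (S : Set (E → ℝ)) : ENNReal :=
  if h : ∃ s : (V → ℝ) →ₗ[ℝ] (E → ℝ), A ∘ₗ s = LinearMap.id then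
    volume (prism h.choose S)
  else 0

theorem volume_prism_eq {A : (E → ℝ) →ₗ[ℝ] (V → ℝ)} {s s' : (V → ℝ) →ₗ[ℝ] (E → ℝ)}
    (hs : A ∘ₗ s = LinearMap.id) (hs' : A ∘ₗ s' = LinearMap.id) {b : V → ℝ} {S : Set (E → ℝ)}
    (hS : ∀ w ∈ S, A w = b) : volume (prism s' S) = volume (prism s S) := by
  classical
  have hA : ∀ t, A (s t) = t := fun t => LinearMap.congr_fun hs t
  have hA' : ∀ t, A (s' t) = t := fun t => LinearMap.congr_fun hs' t
  set L : (E → ℝ) →ₗ[ℝ] (E → ℝ) := LinearMap.id + (s' - s) ∘ₗ A with hL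
  have hdet : LinearMap.det L = 1 := by
    rw [← LinearMap.det_toMatrix', hL, map_add, LinearMap.toMatrix'_comp, LinearMap.toMatrix'_id,
      Matrix.det_one_add_mul_comm, ← LinearMap.toMatrix'_comp, LinearMap.comp_sub, hs, hs']
    simp
  have himg : prism s' S = (fun x => -((s' - s) b) + x) '' (L '' prism s S) := by
    ext x
    simp only [prism, Set.mem_ofPred_eq, Set.mem_image]
    constructor
    · rintro ⟨w, hw, t, ht, rfl⟩
      refine ⟨_, ⟨_, ⟨w, hw, t, ht, rfl⟩, rfl⟩, ?_⟩
      simp [hL, hA, hS w hw]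
      abel
    · rintro ⟨_, ⟨_, ⟨w, hw, t, ht, rfl⟩, rfl⟩, rfl⟩
      refine ⟨w, hw, t, ht, ?_⟩
      simp [hL, hA, hS w hw]
      abel
  rw [himg, Set.image_add_left, measure_preimage_add, Measure.addHaar_image_linearMap, hdet]
  simp

theorem quotientVolume_eq {A : (E → ℝ) →ₗ[ℝ] (V → ℝ)} {s : (V → ℝ) →ₗ[ℝ] (E → ℝ)}
    (hs : A ∘ₗ s = LinearMap.id) {b : V → ℝ} {S : Set (E → ℝ)} (hS : ∀ w ∈ S, A w = b) :
    quotientVolume A S = volume (prism s S) := by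
  have h : ∃ s : (V → ℝ) →ₗ[ℝ] (E → ℝ), A ∘ₗ s = LinearMap.id := ⟨s, hs⟩
  rw [quotientVolume, dif_pos h]
  exact volume_prism_eq hs h.choose_spec hS

end QuotientVolume

namespace LabelledRibbonGraph

variable {n : ℕ} {H : Type*} [Fintype H]

/-- `Vol P_G(b)`. -/
noncomputable def polytopeVolume (G : LabelledRibbonGraph n H) (b : Fin n → ℝ) : ℝ :=
  (quotientVolume G.perimeters (G.polytope b)).toReal

open Classical in
/-- `V*_G(b)`: the volume of `P_G(b)` if all static edges have positive weight, else `0`. -/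
noncomputable def dualVolume (G : LabelledRibbonGraph n H) (b : Fin n → ℝ) : ℝ :=
  (if ∀ (e : G.Edge) (he : G.IsStatic e), 0 < G.staticWeight he b then 1 else 0) *
    G.polytopeVolume b

end LabelledRibbonGraph

open LabelledRibbonGraph in
/-- The counting function `F^κ_{g,n}(b)`: the number of integer metrics with perimeters `b`,
summed over isomorphism classes with weights `1 / |Aut|`. -/
noncomputable def metricCountingFunction (g n : ℕ) {m : ℕ} (κ : m.Partition) (b : Fin n → ℤ) :
    ℝ :=
  ∑ᶠ c ∈ classes g n κ, (c.out.metricCount b : ℝ) / c.out.cardAut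

open LabelledRibbonGraph in
/-- The volume function `V^κ_{g,n}(b)`. -/
noncomputable def volumeFunction (g n : ℕ) {m : ℕ} (κ : m.Partition) (b : Fin n → ℝ) : ℝ :=
  ∑ᶠ c ∈ dualClasses g n κ, c.out.dualVolume b / c.out.cardAut

/-! ### Walls and cells -/

/-- The linear form `∑_{i ∈ I} b_i - ∑_{j ∈ J} b_j`. -/
def wallForm {n : ℕ} (I J : Finset (Fin n)) (b : Fin n → ℝ) : ℝ := ∑ i ∈ I, b i - ∑ j ∈ J, b j

/-- `C` is a cell of the subdivision of `ℝ^n` by the hyperplanes `∑_I b_i - ∑_J b_j = 0`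
with `I`, `J` disjoint: the set of all points at which all these forms have prescribed signs
(`+`, `-` or `0`), if non-empty. -/
def IsCell {n : ℕ} (C : Set (Fin n → ℝ)) : Prop :=
  ∃ b₀ : Fin n → ℝ, C = {b | ∀ I J : Finset (Fin n), Disjoint I J →
    SignType.sign (wallForm I J b) = SignType.sign (wallForm I J b₀)}

/-- The points of `C ∩ ℤ^n` in the coset `r + 2ℤ^n`. -/
def cosetPoints {n : ℕ} (C : Set (Fin n → ℝ)) (r : Fin n → ℤ) : Set (Fin n → ℤ) :=
  {b | (fun i => (b i : ℝ)) ∈ C ∧ ∀ i, b i ≡ r i [ZMOD 2]}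

/-! A weight function with vertex perimeters b writes b as a real combination of the incidence
vectors e_u + e_v of the edges. The weight of a static edge is a multiple of a wall form in b, and
the relative interior of the polytope is cut out by strict positivity of all the other weights. On a
cell the signs of the static weights are constant: static edges of weight zero are dropped, and the
vectors of those of negative weight are reversed. Interior lattice points then become the positive
integral solutions of ∑ w_e a_e = b, for a family of vectors a_e in an open half-space.

This partition function is built by adding one vector at a time (`partitionCount_mem_span`). It is a
combination of pieces, each supported on the open cone of a linearly independent subfamily and
polynomial there on cosets of the lattice it generates. A new vector independent of a cone enlarges
the cone without raising the degree (`isPiece_rayConv_of_indep`). A dependent one sums the piece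
along a segment; an antidifference turns the sum into contributions of the two ends and raises the
degree by one (`rayConv_mem_span_of_dep`). Starting from a basis of n edges, the degree is at most
|E| - n.

Incidence vectors are unimodular up to a factor 2: coordinates in an independent subfamily are
multiples of wall forms, whose values on edges are 0, ±1 or ±2. Hence a cell never crosses the open
cone of a piece, and two points of a cell congruent mod 2 and lying in such a cone differ by an
element of its lattice. Each piece is thus a single polynomial on C ∩ Λ (`IsCell.exists_isPolyFun`).

For volumes, counting interior points for t • b and letting t grow gives twice the volume
(`tendsto_interiorCount`): the edges of a non-bipartite connected graph generate the index 2 lattice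
of vectors with even sum. The degree |E| - n part of the counting polynomial is therefore twice the
volume at integral points; homogeneity, continuity and density extend this to the closed cell.

The corollary sums over isomorphism classes. Odd vertex degrees make the duals non-bipartite,
Euler's formula gives |E| - n = 2g - 2 + ℓ(κ), and positivity of the static weights holds everywhere
or nowhere on a cell. -/

/-- `f` is the evaluation of a polynomial of total degree at most `d`. -/
def IsPolyFun {n : ℕ} (d : ℕ) (f : (Fin n → ℝ) → ℝ) : Prop :=
  ∃ p : MvPolynomial (Fin n) ℝ, p.totalDegree ≤ d ∧ ∀ x, f x = p.eval x

/-! ### Polynomial functions of bounded degree and their antidifferences -/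

namespace IsPolyFun

variable {n : ℕ} {d e : ℕ} {f g : (Fin n → ℝ) → ℝ}

theorem mono (hf : IsPolyFun d f) (h : d ≤ e) : IsPolyFun e f := by
  obtain ⟨p, hp, hpf⟩ := hf
  exact ⟨p, hp.trans h, hpf⟩

theorem const (c : ℝ) : IsPolyFun (n := n) d fun _ => c :=
  ⟨MvPolynomial.C c, by simp, by simp⟩

theorem coord (i : Fin n) : IsPolyFun 1 fun x : Fin n → ℝ => x i :=
  ⟨MvPolynomial.X i, by simp, by simp⟩

theorem add (hf : IsPolyFun d f) (hg : IsPolyFun d g) : IsPolyFun d fun x => f x + g x := by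
  obtain ⟨p, hp, hpf⟩ := hf
  obtain ⟨q, hq, hqg⟩ := hg
  exact ⟨p + q, (MvPolynomial.totalDegree_add _ _).trans (max_le hp hq), by simp [hpf, hqg]⟩

theorem mul (hf : IsPolyFun d f) (hg : IsPolyFun e g) :
    IsPolyFun (d + e) fun x => f x * g x := by
  obtain ⟨p, hp, hpf⟩ := hf
  obtain ⟨q, hq, hqg⟩ := hg
  exact ⟨p * q, (MvPolynomial.totalDegree_mul _ _).trans (add_le_add hp hq), by simp [hpf, hqg]⟩

theorem const_mul (c : ℝ) (hf : IsPolyFun d f) : IsPolyFun d fun x => c * f x := by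
  simpa using (const (d := 0) c).mul hf

theorem neg (hf : IsPolyFun d f) : IsPolyFun d fun x => -f x := by
  simpa using hf.const_mul (-1)

theorem sub (hf : IsPolyFun d f) (hg : IsPolyFun d g) : IsPolyFun d fun x => f x - g x := by
  simpa [sub_eq_add_neg] using hf.add hg.neg

theorem sum {ι : Type*} (s : Finset ι) {F : ι → (Fin n → ℝ) → ℝ}
    (hF : ∀ i ∈ s, IsPolyFun d (F i)) : IsPolyFun d fun x => ∑ i ∈ s, F i x := by
  classical
  induction s using Finset.induction_on with
  | empty => simpa using const (n := n) (d := d) 0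
  | insert i s hi ih =>
    simp only [Finset.sum_insert hi]
    exact (hF i (by simp)).add (ih fun j hj => hF j (by simp [hj]))

theorem pow (hf : IsPolyFun d f) (k : ℕ) : IsPolyFun (k * d) fun x => f x ^ k := by
  induction k with
  | zero => simpa using const (n := n) (d := 0) 1
  | succ k ih => simpa [pow_succ, Nat.succ_mul] using ih.mul hf

theorem prod {ι : Type*} (s : Finset ι) {F : ι → (Fin n → ℝ) → ℝ} {D : ι → ℕ}
    (hF : ∀ i ∈ s, IsPolyFun (D i) (F i)) :
    IsPolyFun (∑ i ∈ s, D i) fun x => ∏ i ∈ s, F i x := by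
  classical
  induction s using Finset.induction_on with
  | empty => simpa using const (n := n) (d := 0) 1
  | insert i s hi ih =>
    simp only [Finset.sum_insert hi, Finset.prod_insert hi]
    exact (hF i (by simp)).mul (ih fun j hj => hF j (by simp [hj]))

theorem linear (l : (Fin n → ℝ) →ₗ[ℝ] ℝ) : IsPolyFun 1 l := by
  have h : (l : (Fin n → ℝ) → ℝ) = fun x => ∑ i, l (Pi.single i 1) * x i := by
    ext x
    conv_lhs => rw [LinearMap.pi_apply_eq_sum_univ l x]
    refine Finset.sum_congr rfl fun i _ => ?_
    rw [smul_eq_mul, mul_comm]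
    congr 2
    ext j
    simp [Pi.single_apply, eq_comm]
  rw [h]
  exact sum _ fun i _ => (coord i).const_mul _

/-- An induction principle that keeps the degree bound: an additive property need only be checked on
monomials of degree at most `d`. -/
theorem of_monomials {P : ((Fin n → ℝ) → ℝ) → Prop}
    (hadd : ∀ f g, P f → P g → P fun x => f x + g x) (hzero : P fun _ => 0)
    (hmon : ∀ (c : ℝ) (s : Fin n → ℕ), ∑ i, s i ≤ d → P fun x => c * ∏ i, x i ^ s i)
    (hf : IsPolyFun d f) : P f := by
  classical
  obtain ⟨p, hp, hpf⟩ := hf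
  have key : ∀ S ⊆ p.support, P fun x => ∑ s ∈ S, p.coeff s * ∏ i, x i ^ s i := by
    intro S
    induction S using Finset.induction_on with
    | empty => intro _; simpa using hzero
    | insert s S hs ih =>
      intro hS
      simp only [Finset.sum_insert hs]
      refine hadd _ _ (hmon _ _ ?_) (ih fun t ht => hS (by simp [ht]))
      have := (MvPolynomial.le_totalDegree (hS (Finset.mem_insert_self s S))).trans hp
      rwa [Finsupp.sum_fintype _ _ (by simp)] at this
  have := key p.support subset_rfl
  convert this using 2 with x
  rw [hpf, MvPolynomial.eval_eq']

theorem comp {m : ℕ} {G : (Fin m → ℝ) → (Fin n → ℝ)} (hf : IsPolyFun d f)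
    (hG : ∀ i, IsPolyFun 1 fun x => G x i) : IsPolyFun d fun x => f (G x) := by
  refine of_monomials (P := fun f => IsPolyFun d fun x => f (G x))
    (fun f g hf hg => hf.add hg) (const 0) (fun c s hs => ?_) hf
  refine ((prod Finset.univ (D := s) fun i _ => ?_).mono hs).const_mul c
  simpa using (hG i).pow (s i)

/-- The Bernoulli polynomial B of index k + 1 satisfies B(1 + y) - B(y) = (k + 1) y^k, so Q(x) = B(1
+ x) / (k + 1) works. -/
theorem _root_.Polynomial.exists_antidifference_pow (k : ℕ) :
    ∃ Q : Polynomial ℝ, Q.natDegree ≤ k + 1 ∧ ∀ x, Q.eval x - Q.eval (x - 1) = x ^ k := by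
  have h := congrArg (Polynomial.map (algebraMap ℚ ℝ)) (Polynomial.bernoulli_comp_one_add_X (k + 1))
  rw [Polynomial.map_comp] at h
  obtain ⟨B, hB⟩ : ∃ B, B = (Polynomial.bernoulli (k + 1)).map (algebraMap ℚ ℝ) := ⟨_, rfl⟩
  simp only [Polynomial.map_add, ← hB] at h
  have hev : ∀ y : ℝ, B.eval (1 + y) = B.eval y + (k + 1) * y ^ k := fun y => by
    have := congrArg (Polynomial.eval y) h
    simp only [Polynomial.eval_comp, Polynomial.map_one, Polynomial.map_X, Polynomial.eval_add,
      Polynomial.eval_one, Polynomial.eval_X] at this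
    simpa using this
  have hdeg : B.natDegree ≤ k + 1 := by
    rw [hB]
    refine (Polynomial.natDegree_map_le).trans ?_
    refine Polynomial.natDegree_le_iff_coeff_eq_zero.mpr fun N hN => ?_
    rw [Polynomial.coeff_bernoulli, if_neg (by omega)]
  refine ⟨Polynomial.C ((k + 1 : ℝ)⁻¹) * B.comp (1 + Polynomial.X), ?_, fun x => ?_⟩
  · refine (Polynomial.natDegree_C_mul_le _ _).trans (Polynomial.natDegree_comp_le.trans ?_)
    have : (1 + Polynomial.X : Polynomial ℝ).natDegree ≤ 1 := by
      compute_degree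
    nlinarith
  · have h1 := hev x
    have hk : (k + 1 : ℝ) ≠ 0 := by positivity
    simp only [Polynomial.eval_mul, Polynomial.eval_C, Polynomial.eval_comp, Polynomial.eval_add,
      Polynomial.eval_one, Polynomial.eval_X, add_sub_cancel, h1]
    field_simp
    ring

theorem polynomial_coord (Q : Polynomial ℝ) (hQ : Q.natDegree ≤ d) (i : Fin n) :
    IsPolyFun d fun x : Fin n → ℝ => Q.eval (x i) := by
  simp only [Polynomial.eval_eq_sum_range]
  refine sum _ fun k hk => IsPolyFun.const_mul _ ?_
  exact (by simpa using (coord i).pow k : IsPolyFun k _).mono (by simp at hk; omega)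

theorem exists_antidifference_single (hf : IsPolyFun d f) (i : Fin n) :
    ∃ Φ : (Fin n → ℝ) → ℝ, IsPolyFun (d + 1) Φ ∧ ∀ x, Φ x - Φ (x - Pi.single i 1) = f x := by
  refine of_monomials (P := fun f => ∃ Φ : (Fin n → ℝ) → ℝ, IsPolyFun (d + 1) Φ ∧
    ∀ x, Φ x - Φ (x - Pi.single i 1) = f x) ?_ ⟨fun _ => 0, const 0, by simp⟩ ?_ hf
  · rintro f g ⟨Φ, hΦ, hf⟩ ⟨Ψ, hΨ, hg⟩
    exact ⟨_, hΦ.add hΨ, fun x => by simp only [← hf, ← hg]; ring⟩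
  · intro c s hs
    obtain ⟨Q, hQ, hQx⟩ := Polynomial.exists_antidifference_pow (s i)
    refine ⟨fun x => c * (Q.eval (x i) * ∏ j ∈ Finset.univ.erase i, x j ^ s j),
      IsPolyFun.const_mul c (IsPolyFun.mono ((polynomial_coord Q hQ i).mul
        (prod _ (D := s) fun j _ => by simpa using (coord j).pow (s j))) ?_), fun x => ?_⟩
    · have := Finset.add_sum_erase Finset.univ s (Finset.mem_univ i)
      omega
    · beta_reduce
      rw [← Finset.mul_prod_erase Finset.univ (fun j => x j ^ s j) (Finset.mem_univ i),
        ← hQx (x i)]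
      have : ∏ j ∈ Finset.univ.erase i, (x - Pi.single i 1 : Fin n → ℝ) j ^ s j =
          ∏ j ∈ Finset.univ.erase i, x j ^ s j :=
        Finset.prod_congr rfl fun j hj => by simp [Finset.ne_of_mem_erase hj]
      rw [this]
      simp
      ring

/-- A polynomial has a polynomial antidifference in the direction of any non-zero vector. -/
theorem exists_antidifference (hf : IsPolyFun d f) {v : Fin n → ℝ} (hv : v ≠ 0) :
    ∃ Φ : (Fin n → ℝ) → ℝ, IsPolyFun (d + 1) Φ ∧ ∀ x, Φ x - Φ (x - v) = f x := by
  obtain ⟨i, hi⟩ := Function.ne_iff.mp hv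
  simp only [Pi.zero_apply] at hi
  -- `G` is the linear change of coordinates fixing the other basis vectors and sending the `i`-th
  -- one to `v`, and `G'` is its inverse. They reduce the direction `v` to a coordinate direction.
  let G : (Fin n → ℝ) → (Fin n → ℝ) := fun y => y - Pi.single i (y i) + y i • v
  let G' : (Fin n → ℝ) → (Fin n → ℝ) := fun x =>
    x - (x i / v i) • v + Pi.single i (x i / v i)
  have hGG' : ∀ x, G (G' x) = x := fun x => by
    ext j
    by_cases hj : j = i
    · subst hj; simp [G, G']; field_simp; ring
    · simp [G, G', hj]; field_simp; ring
  have hG : ∀ j, IsPolyFun 1 fun x => G x j := fun j => by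
    have h1 : IsPolyFun 1 fun x : Fin n → ℝ => x i * v j := by
      simpa [mul_comm] using (coord i).const_mul (v j)
    by_cases hj : j = i
    · subst hj; simpa [G] using h1
    · simpa [G, hj] using (coord j).add h1
  have hG' : ∀ j, IsPolyFun 1 fun x => G' x j := fun j => by
    have h1 : IsPolyFun 1 fun x : Fin n → ℝ => x i / v i := by
      simpa [mul_comm, div_eq_mul_inv] using (coord i).const_mul (v i)⁻¹
    have h2 : IsPolyFun 1 fun x : Fin n → ℝ => x i / v i * v j := by
      simpa [mul_comm] using h1.const_mul (v j)
    by_cases hj : j = i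
    · subst hj; simpa [G'] using ((coord j).sub h2).add h1
    · simpa [G', hj] using (coord j).sub h2
  obtain ⟨Ψ, hΨ, hΨx⟩ := (hf.comp hG).exists_antidifference_single i
  refine ⟨fun x => Ψ (G' x), hΨ.comp hG', fun x => ?_⟩
  have : G' (x - v) = G' x - Pi.single i 1 := by
    ext j
    by_cases hj : j = i
    · subst hj; simp [G']; field_simp; ring
    · simp [G', hj]; field_simp; ring
  simp only [this, hΨx, hGG']

end IsPolyFun

/-- The inclusion of `ℤ^n` in `ℝ^n`. -/
def castVec {n : ℕ} : (Fin n → ℤ) →+ (Fin n → ℝ) := (Int.castAddHom ℝ).compLeft (Fin n)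

@[simp]
theorem castVec_apply {n : ℕ} (b : Fin n → ℤ) (i : Fin n) : castVec b i = (b i : ℝ) := rfl

theorem castVec_zsmul {n : ℕ} (k : ℤ) (b : Fin n → ℤ) : castVec (k • b) = (k : ℝ) • castVec b := by
  ext i; simp

/-! ### Vector partition functions, cones and lattices -/

namespace VectorPartition

variable {E : Type*} {n : ℕ}

/-- `w` vanishes outside of `B`. -/
def SuppOn {R : Type*} [Zero R] (B : Finset E) (w : E → R) : Prop := ∀ e ∉ B, w e = 0

theorem SuppOn.mono {R : Type*} [Zero R] {B B' : Finset E} {w : E → R} (h : SuppOn B w)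
    (hB : B ⊆ B') : SuppOn B' w := fun e he => h e fun h' => he (hB h')

theorem nonneg_of_suppOn {R : Type*} [Zero R] [Preorder R] {T : Finset E} {w : E → R}
    (hw : SuppOn T w) (hpos : ∀ e ∈ T, 0 < w e) (e : E) : 0 ≤ w e := by
  by_cases he : e ∈ T
  · exact (hpos e he).le
  · exact (hw e he).ge

variable [Fintype E]

/-- The linear combination of the vectors `a e` with coefficients `w e`. -/
noncomputable def comb (a : E → Fin n → ℤ) : (E → ℝ) →ₗ[ℝ] (Fin n → ℝ) :=
  Fintype.linearCombination ℝ fun e => castVec (a e)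

theorem comb_apply (a : E → Fin n → ℤ) (w : E → ℝ) : comb a w = ∑ e, w e • castVec (a e) := rfl

theorem comb_intCast (a : E → Fin n → ℤ) (m : E → ℤ) :
    comb a (fun e => (m e : ℝ)) = castVec (∑ e, m e • a e) := by
  simp only [comb_apply, map_sum, castVec_zsmul]

theorem comb_single [DecidableEq E] (a : E → Fin n → ℤ) (c : E) (x : ℝ) :
    comb a (Pi.single c x) = x • castVec (a c) := by
  simp [comb_apply, Pi.single_apply]

/-- The vectors `a e`, for `e` in `B`, are linearly independent. -/
def Indep (a : E → Fin n → ℤ) (B : Finset E) : Prop :=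
  ∀ w : E → ℝ, SuppOn B w → comb a w = 0 → w = 0

theorem Indep.mono {a : E → Fin n → ℤ} {B B' : Finset E} (h : Indep a B') (hB : B ⊆ B') :
    Indep a B := fun w hw => h w (hw.mono hB)

/-- The relatively open cone generated by the vectors `a e`, for `e` in `B`. -/
def openCone (a : E → Fin n → ℤ) (B : Finset E) : Set (Fin n → ℝ) :=
  {b | ∃ w : E → ℝ, SuppOn B w ∧ (∀ e ∈ B, 0 < w e) ∧ comb a w = b}

/-- The lattice generated by the vectors `a e`, for `e` in `B`. -/
def lattice (a : E → Fin n → ℤ) (B : Finset E) : AddSubgroup (Fin n → ℤ) where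
  carrier := {b | ∃ m : E → ℤ, SuppOn B m ∧ ∑ e, m e • a e = b}
  zero_mem' := ⟨0, fun _ _ => rfl, by simp⟩
  add_mem' := by
    rintro _ _ ⟨m, hm, rfl⟩ ⟨m', hm', rfl⟩
    exact ⟨m + m', fun e he => by simp [hm e he, hm' e he],
      by simp [add_smul, Finset.sum_add_distrib]⟩
  neg_mem' := by
    rintro _ ⟨m, hm, rfl⟩
    exact ⟨-m, fun e he => by simp [hm e he], by simp [neg_smul]⟩

theorem mem_lattice {a : E → Fin n → ℤ} {B : Finset E} {b : Fin n → ℤ} :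
    b ∈ lattice a B ↔ ∃ m : E → ℤ, SuppOn B m ∧ ∑ e, m e • a e = b := Iff.rfl

theorem lattice_mono {a : E → Fin n → ℤ} {B B' : Finset E} (hB : B ⊆ B') :
    lattice a B ≤ lattice a B' := by
  rintro _ ⟨m, hm, rfl⟩
  exact ⟨m, hm.mono hB, rfl⟩

/-- Integral points in the span of a linearly independent subfamily have half-integral
coordinates. -/
def TwoSaturated (a : E → Fin n → ℤ) : Prop :=
  ∀ (B : Finset E) (x : Fin n → ℤ) (w : E → ℝ), Indep a B → SuppOn B w → comb a w = castVec x →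
    (2 : ℤ) • x ∈ lattice a B

/-- The number of ways of writing `b` as a combination of the vectors `a e`, for `e` in `T`, with
positive integral coefficients. -/
noncomputable def partitionCount (a : E → Fin n → ℤ) (T : Finset E) (b : Fin n → ℤ) : ℕ :=
  {w : E → ℤ | SuppOn T w ∧ (∀ e ∈ T, 0 < w e) ∧ ∑ e, w e • a e = b}.ncard

/-- `f` is supported on the relatively open cone of a linearly independent subfamily `B`, and
polynomial of degree at most `d` there on every coset of the lattice generated by `B`. -/
def IsPiece (a : E → Fin n → ℤ) (T : Finset E) (d : ℕ) (f : (Fin n → ℤ) → ℝ) : Prop :=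
  ∃ B ⊆ T, Indep a B ∧ (∀ b, castVec b ∉ openCone a B → f b = 0) ∧
    ∀ b₀, ∃ p : (Fin n → ℝ) → ℝ, IsPolyFun d p ∧
      ∀ b, b - b₀ ∈ lattice a B → castVec b ∈ openCone a B → f b = p (castVec b)

/-- `comb a` is injective on vectors supported on `B`; a linear left inverse extends the coordinate
at `e` from the span of `B` to the whole space. -/
theorem Indep.exists_coord {a : E → Fin n → ℤ} {B : Finset E} (h : Indep a B) (e : E) :
    ∃ l : (Fin n → ℝ) →ₗ[ℝ] ℝ, ∀ w, SuppOn B w → l (comb a w) = w e := by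
  let W : Submodule ℝ (E → ℝ) :=
    { carrier := {w | SuppOn B w}
      add_mem' := fun {x y} hx hy e he => by simp [hx e he, hy e he]
      zero_mem' := fun e _ => rfl
      smul_mem' := fun c x hx e he => by simp [hx e he] }
  have hinj : LinearMap.ker ((comb a).comp W.subtype) = ⊥ := by
    rw [LinearMap.ker_eq_bot']
    rintro ⟨w, hw⟩ h0
    exact Subtype.ext (h w hw h0)
  obtain ⟨g, hg⟩ := LinearMap.exists_leftInverse_of_injective _ hinj
  refine ⟨(LinearMap.proj e).comp (W.subtype.comp g), fun w hw => ?_⟩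
  have := LinearMap.congr_fun hg ⟨w, hw⟩
  simp only [LinearMap.comp_apply, Submodule.subtype_apply, LinearMap.id_apply] at this
  simp [this]

section Positive

variable {a : E → Fin n → ℤ} {l : (Fin n → ℝ) →ₗ[ℝ] ℝ}

theorem map_comb (w : E → ℝ) : l (comb a w) = ∑ e, w e * l (castVec (a e)) := by
  simp [comb_apply, map_sum]

theorem mul_le_of_nonneg (hl : ∀ e, 0 < l (castVec (a e))) {w : E → ℝ} (hw : ∀ e, 0 ≤ w e)
    (e : E) : w e * l (castVec (a e)) ≤ l (comb a w) := by
  rw [map_comb]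
  exact Finset.single_le_sum (f := fun e => w e * l (castVec (a e)))
    (fun i _ => mul_nonneg (hw i) (hl i).le) (Finset.mem_univ e)

theorem nonneg_of_mem_openCone (hl : ∀ e, 0 < l (castVec (a e))) {B : Finset E} {b : Fin n → ℝ}
    (hb : b ∈ openCone a B) : 0 ≤ l b := by
  obtain ⟨w, hw, hpos, rfl⟩ := hb
  rw [map_comb]
  refine Finset.sum_nonneg fun e _ => mul_nonneg ?_ (hl e).le
  by_cases he : e ∈ B
  · exact (hpos e he).le
  · exact (hw e he).ge

/-- Since `l` is positive on every vector, each coefficient is at most l(b) / l(a e). -/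
theorem finite_partitions (hl : ∀ e, 0 < l (castVec (a e))) (T : Finset E) (b : Fin n → ℤ) :
    {w : E → ℤ | SuppOn T w ∧ (∀ e ∈ T, 0 < w e) ∧ ∑ e, w e • a e = b}.Finite := by
  classical
  refine (Set.finite_Icc (0 : E → ℤ)
    (fun e => ⌊l (castVec b) / l (castVec (a e))⌋)).subset ?_
  rintro w ⟨hw, hpos, rfl⟩
  have h0 := nonneg_of_suppOn hw hpos
  refine ⟨h0, fun e => Int.le_floor.mpr ?_⟩
  rw [le_div_iff₀ (hl e), ← comb_intCast]
  exact mul_le_of_nonneg (w := fun e => (w e : ℝ)) hl (fun e => by exact_mod_cast h0 e) e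

/-- The sum of `f` over the points `b - k • a c`, for `k` positive. -/
noncomputable def rayConv (a : E → Fin n → ℤ) (l : (Fin n → ℝ) →ₗ[ℝ] ℝ) (c : E)
    (f : (Fin n → ℤ) → ℝ) (b : Fin n → ℤ) : ℝ :=
  ∑ k ∈ Finset.Icc (1 : ℤ) ⌊l (castVec b) / l (castVec (a c))⌋, f (b - k • a c)

/-- Solutions are sorted by the coefficient k of `c`; erasing it leaves a solution over `T` for b -
k • a c. Positivity of `l` confines k to the range of summation in `rayConv`. -/
theorem partitionCount_insert [DecidableEq E] (hl : ∀ e, 0 < l (castVec (a e))) {T : Finset E}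
    {c : E} (hc : c ∉ T) (b : Fin n → ℤ) : (partitionCount a (insert c T) b : ℝ) =
      rayConv a l c (fun b => (partitionCount a T b : ℝ)) b := by
  unfold rayConv
  have hfin := finite_partitions hl (insert c T) b
  rw [partitionCount, Set.ncard_eq_toFinset_card _ hfin,
    Finset.card_eq_sum_card_fiberwise (f := fun w : E → ℤ => w c)
      (t := Finset.Icc (1 : ℤ) ⌊l (castVec b) / l (castVec (a c))⌋)]
  · push_cast
    refine Finset.sum_congr rfl fun k hk => ?_
    rw [partitionCount, ← Set.ncard_coe_finset]
    congr 1
    refine Set.ncard_congr (fun w _ => Function.update w c 0) ?_ ?_ ?_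
    · intro w hw
      simp only [Finset.coe_filter, Set.Finite.mem_toFinset, Set.mem_ofPred_eq] at hw
      obtain ⟨⟨hw, hpos, hsum⟩, hk⟩ := hw
      refine ⟨fun e he => ?_, fun e he => ?_, ?_⟩
      · by_cases hec : e = c
        · simp [hec]
        · simpa [hec] using hw e (by simp [hec, he])
      · have hec : e ≠ c := fun h => hc (h ▸ he)
        simpa [hec] using hpos e (by simp [he])
      · rw [← hsum, ← hk, ← Finset.add_sum_erase _ _ (Finset.mem_univ c),
          ← Finset.add_sum_erase (a := c) _ (fun e => w e • a e) (Finset.mem_univ c)]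
        simp only [Function.update_self, zero_smul, zero_add, add_sub_cancel_left]
        refine Finset.sum_congr rfl fun e he => ?_
        simp [Finset.ne_of_mem_erase he]
    · intro w w' hw hw' h
      simp only [Finset.coe_filter, Set.mem_ofPred_eq] at hw hw'
      ext e
      by_cases hec : e = c
      · rw [hec, hw.2, hw'.2]
      · simpa [hec] using congrFun h e
    · rintro w ⟨hw, hpos, hsum⟩
      refine ⟨Function.update w c k, ?_, ?_⟩
      · simp only [Finset.coe_filter, Set.Finite.mem_toFinset, Set.mem_ofPred_eq,
          Function.update_self, and_true]
        refine ⟨fun e he => ?_, fun e he => ?_, ?_⟩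
        · simp only [Finset.mem_insert, not_or] at he
          simpa [he.1] using hw e he.2
        · by_cases hec : e = c
          · subst hec
            simp only [Finset.mem_Icc] at hk
            simp; omega
          · simpa [hec] using hpos e (by simpa [hec] using he)
        · rw [← Finset.add_sum_erase _ _ (Finset.mem_univ c)] at hsum ⊢
          rw [hw c hc] at hsum
          simp only [zero_smul, zero_add] at hsum
          rw [Function.update_self, ← eq_sub_iff_add_eq', ← hsum]
          refine Finset.sum_congr rfl fun e he => ?_
          simp [Finset.ne_of_mem_erase he]
      · ext e
        by_cases hec : e = c
        · subst hec; simp [hw e hc]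
        · simp [hec]
  · intro w hw
    simp only [Set.Finite.coe_toFinset, Set.mem_ofPred_eq] at hw
    obtain ⟨hw, hpos, rfl⟩ := hw
    have h0 := nonneg_of_suppOn hw hpos
    have h1 : 0 < w c := hpos c (by simp)
    simp only [Finset.coe_Icc, Set.mem_Icc]
    refine ⟨by omega, Int.le_floor.mpr ?_⟩
    rw [le_div_iff₀ (hl c), ← comb_intCast]
    exact mul_le_of_nonneg (w := fun e => (w e : ℝ)) hl (fun e => by exact_mod_cast h0 e) c

/-- As `l` is non-negative on open cones, the cutoff in `rayConv` omits no point at which a function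
supported on such a cone could be non-zero. -/
theorem le_floor_of_mem_openCone (hl : ∀ e, 0 < l (castVec (a e))) {B : Finset E}
    {b : Fin n → ℤ} {c : E} {k : ℤ} (h : castVec (b - k • a c) ∈ openCone a B) :
    k ≤ ⌊l (castVec b) / l (castVec (a c))⌋ := by
  have := nonneg_of_mem_openCone hl h
  rw [map_sub, castVec_zsmul, map_sub, map_smul, smul_eq_mul, sub_nonneg] at this
  exact Int.le_floor.mpr ((le_div_iff₀ (hl c)).mpr this)

/-- By independence the coefficient of `c` in `b` is a linear function τ(b), so only the term k =
τ(b) can survive. On a coset of the larger lattice τ is either always integral, giving the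
polynomial p(b - τ(b) a_c) of unchanged degree, or never integral, giving zero. -/
theorem isPiece_rayConv_of_indep [DecidableEq E] (hl : ∀ e, 0 < l (castVec (a e))) {T B : Finset E}
    {d : ℕ} {c : E} (hc : c ∉ T) (hB : B ⊆ T) (hind : Indep a (insert c B)) {f : (Fin n → ℤ) → ℝ}
    (hf0 : ∀ b, castVec b ∉ openCone a B → f b = 0)
    (hfp : ∀ b₀, ∃ p : (Fin n → ℝ) → ℝ, IsPolyFun d p ∧
      ∀ b, b - b₀ ∈ lattice a B → castVec b ∈ openCone a B → f b = p (castVec b)) :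
    IsPiece a (insert c T) d (rayConv a l c f) := by
  have hcB : c ∉ B := fun h => hc (hB h)
  have hcone : ∀ (b : Fin n → ℤ) (k : ℤ), 0 < k → castVec (b - k • a c) ∈ openCone a B →
      ∃ w, SuppOn (insert c B) w ∧ (∀ e ∈ insert c B, 0 < w e) ∧ comb a w = castVec b ∧
        w c = k := by
    rintro b k hk ⟨w, hw, hpos, hwb⟩
    refine ⟨w + Pi.single c (k : ℝ), fun e he => ?_, fun e he => ?_, ?_, ?_⟩
    · simp only [Finset.mem_insert, not_or] at he
      simp [he.1, hw e he.2]
    · by_cases hec : e = c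
      · subst hec; simpa [hw e hcB] using hk
      · simpa [hec] using hpos e (by simpa [hec] using he)
    · rw [map_add, hwb, comb_single, map_sub, castVec_zsmul, sub_add_cancel]
    · simp [hw c hcB]
  obtain ⟨τ, hτ⟩ := hind.exists_coord c
  refine ⟨insert c B, Finset.insert_subset_insert c hB, hind, fun b hb => ?_, fun b₀ => ?_⟩
  · refine Finset.sum_eq_zero fun k hk => hf0 _ fun h => hb ?_
    obtain ⟨w, h1, h2, h3, -⟩ := hcone b k (by simp at hk; omega) h
    exact ⟨w, h1, h2, h3⟩
  · have hτb : ∀ b, b - b₀ ∈ lattice a (insert c B) →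
        ∃ m : ℤ, τ (castVec b) = τ (castVec b₀) + m := by
      rintro b ⟨m, hm, hmb⟩
      refine ⟨m c, ?_⟩
      have := hτ (fun e => (m e : ℝ)) fun e he => by simp [hm e he]
      rw [comb_intCast, hmb, map_sub, map_sub] at this
      linarith
    by_cases hint : ∃ m₀ : ℤ, τ (castVec b₀) = m₀
    · obtain ⟨m₀, hm₀⟩ := hint
      -- The base point is shifted so that b - τ(b) a_c always falls in the same coset of the
      -- smaller lattice.
      obtain ⟨p, hp, hpf⟩ := hfp (b₀ - m₀ • a c)
      refine ⟨fun x => p (x - τ x • castVec (a c)), ?_, fun b hb hbc => ?_⟩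
      · refine hp.comp fun i => (IsPolyFun.coord i).sub ?_
        simpa [mul_comm] using (IsPolyFun.linear τ).const_mul (a c i : ℝ)
      · obtain ⟨w, hw, hpos, hwb⟩ := hbc
        obtain ⟨m, hm, hmb⟩ := hb
        have h1 := hτ (fun e => (m e : ℝ)) fun e he => by simp [hm e he]
        rw [comb_intCast, hmb, map_sub, map_sub, hm₀] at h1
        have h2 := hτ w hw
        rw [hwb] at h2
        have hwc : w c = ((m₀ + m c : ℤ) : ℝ) := by push_cast; linarith
        have hmem : castVec (b - (m₀ + m c) • a c) ∈ openCone a B := by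
          refine ⟨w - Pi.single c (w c), fun e he => ?_, fun e he => ?_, ?_⟩
          · by_cases hec : e = c
            · subst hec; simp
            · simp [hec, hw e (by simp [hec, he])]
          · have hec : e ≠ c := fun h => hcB (h ▸ he)
            simpa [hec] using hpos e (by simp [he])
          · rw [map_sub, hwb, comb_single, map_sub, castVec_zsmul, hwc]
        have hpos' : (0 : ℝ) < ((m₀ + m c : ℤ) : ℝ) := hwc ▸ hpos c (by simp)
        unfold rayConv
        rw [Finset.sum_eq_single (m₀ + m c)]
        · beta_reduce
          rw [hpf _ _ hmem, map_sub, castVec_zsmul, h2, hwc]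
          refine ⟨m - Pi.single c (m c), fun e he => ?_, ?_⟩
          · by_cases hec : e = c
            · subst hec; simp
            · simp [hec, hm e (by simp [hec, he])]
          · have : ∑ e, (m - Pi.single c (m c) : E → ℤ) e • a e = (b - b₀) - m c • a c := by
              rw [← hmb]
              simp [sub_smul, Finset.sum_sub_distrib, Pi.single_apply, ite_smul]
            rw [this, add_smul]
            abel
        · intro k hk hne
          refine hf0 _ fun h => hne ?_
          obtain ⟨w', h1', -, h3', h4'⟩ := hcone b k (by simp at hk; omega) h
          have := hτ w' h1'
          rw [h3', h4', h2, hwc] at this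
          exact_mod_cast this.symm
        · intro h
          refine absurd (Finset.mem_Icc.mpr ⟨?_, le_floor_of_mem_openCone hl hmem⟩) h
          have : 0 < m₀ + m c := by exact_mod_cast hpos'
          omega
    · refine ⟨fun _ => 0, IsPolyFun.const 0, fun b hb _ => ?_⟩
      refine Finset.sum_eq_zero fun k hk => hf0 _ fun h => hint ?_
      obtain ⟨w, h1, h2, h3, h4⟩ := hcone b k (by simp at hk; omega) h
      obtain ⟨m, hm⟩ := hτb b hb
      have := hτ w h1
      rw [h3, h4, hm] at this
      exact ⟨k - m, by push_cast; linarith⟩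

end Positive

end VectorPartition

/-- Telescoping with step 2, as only 2 • a c, rather than a c itself, need be in the lattice of a
dependent cone. Each end leaves two terms. -/
theorem Finset.sum_Ico_sub_add_two {M : Type*} [AddCommGroup M] (Ψ : ℤ → M) {m m' : ℤ}
    (h : m ≤ m') : ∑ k ∈ Finset.Ico m m', (Ψ k - Ψ (k + 2)) =
      (Ψ m + Ψ (m + 1)) - (Ψ m' + Ψ (m' + 1)) := by
  induction m', h using Int.leInduction with
  | base => simp
  | succ k hk ih =>
    rw [← Finset.insert_Ico_right_eq_Ico_add_one hk, Finset.sum_insert (by simp), ih,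
      show k + 2 = k + 1 + 1 by ring]
    abel

/-! ### Circuits and the ends of segments -/

namespace VectorPartition

variable {E : Type*} [Fintype E] [DecidableEq E] {n : ℕ} {a : E → Fin n → ℤ}

/-- `z` spans the space of linear relations between the vectors `a e`, for `e` in `A`. -/
structure IsCircuit (a : E → Fin n → ℤ) (A : Finset E) (z : E → ℝ) : Prop where
  supp : SuppOn A z
  comb_eq : comb a z = 0
  exists_smul : ∀ w, SuppOn A w → comb a w = 0 → ∃ κ : ℝ, w = κ • z

namespace IsCircuit

variable {A : Finset E} {z : E → ℝ}

omit [DecidableEq E] in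
theorem neg (hz : IsCircuit a A z) : IsCircuit a A (-z) where
  supp e he := by simp [hz.supp e he]
  comb_eq := by simp [hz.comb_eq]
  exists_smul w hw h := by
    obtain ⟨κ, rfl⟩ := hz.exists_smul w hw h
    exact ⟨-κ, by simp⟩

/-- A relation avoiding `D` is a multiple of `z` that vanishes at `i`, where `z` does not. -/
theorem indep_sdiff (hz : IsCircuit a A z) {D : Finset E} {i : E} (hi : i ∈ D) (hzi : z i ≠ 0) :
    Indep a (A \ D) := by
  intro w hw h
  obtain ⟨κ, rfl⟩ := hz.exists_smul w (hw.mono Finset.sdiff_subset) h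
  have := hw i (by simp [hi])
  simp only [Pi.smul_apply, smul_eq_mul, mul_eq_zero, hzi, or_false] at this
  simp [this]

/-- A positive representation of `b` is moved along `z` until some coordinates first vanish; `D` is
the set of these coordinates, and they can only be ones where `z` is negative. -/
theorem exists_end (hz : IsCircuit a A z) {i₀ : E} (hi₀ : z i₀ < 0) {b : Fin n → ℝ}
    (hb : b ∈ openCone a A) :
    ∃ D ⊆ A.filter (fun e => z e < 0), D.Nonempty ∧ b ∈ openCone a (A \ D) := by
  obtain ⟨y, hy, hpos, rfl⟩ := hb
  have hi₀A : i₀ ∈ A := by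
    by_contra h
    exact hi₀.ne (hz.supp _ h)
  -- The first vanishing time is the smallest ratio y e / (-z e), attained at `j`.
  obtain ⟨j, hj, hmin⟩ := Finset.exists_min_image (A.filter fun e => z e < 0)
    (fun e => y e / (-z e)) ⟨i₀, by simp [hi₀A, hi₀]⟩
  obtain ⟨hjA, hzj⟩ := Finset.mem_filter.mp hj
  set κ := y j / (-z j) with hκ
  have hκpos : 0 < κ := div_pos (hpos j hjA) (by linarith)
  have hnn : ∀ e ∈ A, 0 ≤ (y + κ • z) e := by
    intro e he
    simp only [Pi.add_apply, Pi.smul_apply, smul_eq_mul]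
    rcases lt_or_ge (z e) 0 with hze | hze
    · have := (le_div_iff₀ (by linarith)).mp (hmin e (by simp [he, hze]))
      linarith
    · have := hpos e he
      have := mul_nonneg hκpos.le hze
      linarith
  refine ⟨A.filter fun e => (y + κ • z) e = 0, fun e he => ?_, ⟨j, ?_⟩, y + κ • z,
    fun e he => ?_, fun e he => ?_, ?_⟩
  · simp only [Finset.mem_filter, Pi.add_apply, Pi.smul_apply, smul_eq_mul] at he ⊢
    refine ⟨he.1, ?_⟩
    by_contra hze
    have := hpos e he.1
    have := mul_nonneg hκpos.le (not_lt.mp hze)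
    linarith
  · simp only [Finset.mem_filter, hjA, true_and, Pi.add_apply, Pi.smul_apply, smul_eq_mul, hκ]
    have := hzj.ne
    field_simp
    ring
  · simp only [Finset.mem_sdiff, Finset.mem_filter, not_and, not_forall, not_not] at he
    by_cases heA : e ∈ A
    · exact (he heA).2
    · simp [hy e heA, hz.supp e heA]
  · simp only [Finset.mem_sdiff, Finset.mem_filter, not_and] at he
    exact lt_of_le_of_ne (hnn e he.1) (Ne.symm (he.2 he.1))
  · simp [hz.comb_eq]

/-- A small step back from the end, in the direction -z, makes the coordinates in `D` positive and
keeps the others positive. -/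
theorem mem_openCone_of_end (hz : IsCircuit a A z) {D : Finset E}
    (hD : D ⊆ A.filter (fun e => z e < 0)) {b : Fin n → ℝ} (hb : b ∈ openCone a (A \ D)) :
    b ∈ openCone a A := by
  obtain ⟨t, ht, hpos, rfl⟩ := hb
  have hev : ∀ᶠ ε : ℝ in nhdsWithin 0 (Set.Ioi 0), ∀ e ∈ A, 0 < t e - ε * z e := by
    refine (Finset.eventually_all A).mpr fun e he => ?_
    by_cases heD : e ∈ D
    · have hze := (Finset.mem_filter.mp (hD heD)).2
      filter_upwards [self_mem_nhdsWithin] with ε hε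
      rw [ht e (by simp [heD])]
      have := mul_neg_of_pos_of_neg (Set.mem_Ioi.mp hε) hze
      linarith
    · have h1 : Filter.Tendsto (fun ε : ℝ => t e - ε * z e) (nhdsWithin 0 (Set.Ioi 0))
          (nhds (t e - 0 * z e)) :=
        (Continuous.tendsto (by fun_prop) 0).mono_left nhdsWithin_le_nhds
      exact h1.eventually_const_lt (by simpa using hpos e (by simp [he, heD]))
  obtain ⟨ε, hε⟩ := hev.exists
  refine ⟨t - ε • z, fun e he => ?_, fun e he => by simpa using hε e he, by simp [hz.comb_eq]⟩
  simp [ht e (by simp [he]), hz.supp e he]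

/-- Two ends over the same point differ by κ • z. Each is non-negative and has a zero where `z` is
negative, which gives κ ≤ 0 and κ ≥ 0. The ends coincide, and `D` is recovered as the set of zeros
in `A`. -/
theorem end_unique (hz : IsCircuit a A z) {D D' : Finset E}
    (hD : D ⊆ A.filter (fun e => z e < 0)) (hD' : D' ⊆ A.filter (fun e => z e < 0))
    (hne : D.Nonempty) (hne' : D'.Nonempty) {b : Fin n → ℝ} (hb : b ∈ openCone a (A \ D))
    (hb' : b ∈ openCone a (A \ D')) : D = D' := by
  obtain ⟨t, ht, hpos, rfl⟩ := hb
  obtain ⟨t', ht', hpos', htt'⟩ := hb'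
  have h0 := nonneg_of_suppOn ht hpos
  have h0' := nonneg_of_suppOn ht' hpos'
  obtain ⟨κ, hκ⟩ := hz.exists_smul (t' - t)
    (fun e he => by simp [ht e (by simp [he]), ht' e (by simp [he])]) (by simp [htt'])
  have hκ' : ∀ e, t' e - t e = κ * z e := fun e => congrFun hκ e
  have hκ0 : κ = 0 := by
    obtain ⟨i, hi⟩ := hne
    obtain ⟨j, hj⟩ := hne'
    have hzi := (Finset.mem_filter.mp (hD hi)).2
    have hzj := (Finset.mem_filter.mp (hD' hj)).2
    have h1 := hκ' i
    have h2 := hκ' j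
    rw [ht i (by simp [hi])] at h1
    rw [ht' j (by simp [hj])] at h2
    have h3 := h0' i
    have h4 := h0 j
    rcases lt_trichotomy κ 0 with h | h | h
    · nlinarith [mul_pos_of_neg_of_neg h hzj]
    · exact h
    · nlinarith [mul_neg_of_pos_of_neg h hzi]
  have hzero : ∀ {t : E → ℝ} {D : Finset E}, D ⊆ A.filter (fun e => z e < 0) →
      SuppOn (A \ D) t → (∀ e ∈ A \ D, 0 < t e) → ∀ e, e ∈ D ↔ e ∈ A ∧ t e = 0 := by
    intro t D hD ht hpos e
    refine ⟨fun he => ⟨(Finset.mem_filter.mp (hD he)).1, ht e (by simp [he])⟩, fun he => ?_⟩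
    by_contra h
    exact (hpos e (by simp [he.1, h])).ne' he.2
  ext e
  rw [hzero hD ht hpos, hzero hD' ht' hpos']
  have := hκ' e
  rw [hκ0, zero_mul, sub_eq_zero] at this
  rw [this]

end IsCircuit

/-- `Φ` is polynomial of degree at most `d` on every coset of the lattice generated by `B`. -/
def IsQuasiPoly (a : E → Fin n → ℤ) (B : Finset E) (d : ℕ) (Φ : (Fin n → ℤ) → ℝ) : Prop :=
  ∀ b₀, ∃ p : (Fin n → ℝ) → ℝ, IsPolyFun d p ∧
    ∀ b, b - b₀ ∈ lattice a B → Φ b = p (castVec b)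

open Classical in
/-- The contribution of one end of the segments parallel to `a c` to a sum over segments. -/
noncomputable def endSum (a : E → Fin n → ℤ) (c : E) (B : Finset E) (τ : (Fin n → ℝ) →ₗ[ℝ] ℝ)
    (rnd : ℝ → ℤ) (Φ : (Fin n → ℤ) → ℝ) (b : Fin n → ℤ) : ℝ :=
  if castVec b ∈ openCone a B then
    Φ (b - rnd (τ (castVec b)) • a c) + Φ (b - (rnd (τ (castVec b)) + 1) • a c)
  else 0

/-- Rounding commutes with integral translations, so on a coset of the lattice of `B'` the
difference rnd(τ b) - τ b is constant. The arguments of `Φ` are then affine in `b`, and they stay in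
one coset of the lattice of `B` because the coefficient of `c` cancels. -/
theorem isPiece_endSum {T B B' : Finset E} {c : E} {d : ℕ} {Φ : (Fin n → ℤ) → ℝ}
    (hΦ : IsQuasiPoly a B d Φ) (hB' : B' ⊆ insert c B) (hT : B' ⊆ T) (hind : Indep a B')
    {τ : (Fin n → ℝ) →ₗ[ℝ] ℝ}
    (hτ : ∀ w, SuppOn B' w → τ (comb a w) = w c) {rnd : ℝ → ℤ}
    (hrnd : ∀ (x : ℝ) (m : ℤ), rnd (x + m) = rnd x + m) :
    IsPiece a T d (endSum a c B' τ rnd Φ) := by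
  refine ⟨B', hT, hind, fun b hb => by simp [endSum, hb], fun b₀ => ?_⟩
  have key : ∀ j : ℤ, ∃ p : (Fin n → ℝ) → ℝ, IsPolyFun d p ∧ ∀ b, b - b₀ ∈ lattice a B' →
      Φ (b - (rnd (τ (castVec b)) + j) • a c) = p (castVec b) := by
    intro j
    obtain ⟨p, hp, hpΦ⟩ := hΦ (b₀ - (rnd (τ (castVec b₀)) + j) • a c)
    refine ⟨fun x => p (x - (rnd (τ (castVec b₀)) + j + (τ x - τ (castVec b₀))) •
      castVec (a c)), ?_, fun b hb => ?_⟩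
    · refine hp.comp fun i => (IsPolyFun.coord i).sub ?_
      simpa [mul_comm] using (((IsPolyFun.const _).add
        ((IsPolyFun.linear τ).sub (IsPolyFun.const (τ (castVec b₀))))).const_mul (a c i : ℝ))
    · obtain ⟨m, hm, hmb⟩ := hb
      have h1 := hτ (fun e => (m e : ℝ)) fun e he => by simp [hm e he]
      rw [comb_intCast, hmb, map_sub, map_sub, sub_eq_iff_eq_add'] at h1
      have hr : rnd (τ (castVec b)) = rnd (τ (castVec b₀)) + m c := by rw [h1, hrnd]
      rw [hpΦ]
      · congr 1
        rw [map_sub, castVec_zsmul, hr, h1]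
        push_cast
        congr 2
        ring
      · refine ⟨m - Pi.single c (m c), fun e he => ?_, ?_⟩
        · by_cases hec : e = c
          · subst hec; simp
          · have : e ∉ B' := fun h => by simpa [hec, he] using hB' h
            simp [hec, hm e this]
        · have : ∑ e, (m - Pi.single c (m c) : E → ℤ) e • a e = (b - b₀) - m c • a c := by
            rw [← hmb]
            simp [sub_smul, Finset.sum_sub_distrib, Pi.single_apply, ite_smul]
          rw [this, hr]
          simp only [add_smul]
          abel
  obtain ⟨p, hp, hpb⟩ := key 0
  obtain ⟨q, hq, hqb⟩ := key 1
  refine ⟨_, hp.add hq, fun b hb hbc => ?_⟩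
  rw [endSum, if_pos hbc, ← hpb b hb, ← hqb b hb, add_zero]

end VectorPartition

/-! ### Summation along segments and structure of the partition function -/

namespace VectorPartition

variable {E : Type*} [Fintype E] [DecidableEq E] {n : ℕ} {a : E → Fin n → ℤ}

theorem exists_isCircuit {B : Finset E} {c : E} (hB : Indep a B)
    (hcB : ¬ Indep a (insert c B)) : ∃ z, IsCircuit a (insert c B) z ∧ z c = 1 := by
  simp only [Indep, not_forall] at hcB
  obtain ⟨w, hw, hw0, hne⟩ := hcB
  have hsub : ∀ w' : E → ℝ, SuppOn (insert c B) w' → w' c = 0 → SuppOn B w' := by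
    intro w' hw' h e he
    by_cases hec : e = c
    · rw [hec, h]
    · exact hw' e (by simp [hec, he])
  have hwc : w c ≠ 0 := fun h => hne (hB w (hsub w hw h) hw0)
  have hz : SuppOn (insert c B) ((w c)⁻¹ • w) := fun e he => by simp [hw e he]
  refine ⟨(w c)⁻¹ • w, ⟨hz, by simp [hw0], fun w' hw' h' => ⟨w' c, ?_⟩⟩, by simp [hwc]⟩
  have := hB (w' - w' c • ((w c)⁻¹ • w))
    (hsub _ (fun e he => by simp [hw' e he, hw e he]) (by simp [hwc])) (by simp [hw0, h'])
  exact sub_eq_zero.mp this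

omit [DecidableEq E] in
-- Since `v` is in the lattice, b and b - v share a coset, so polynomial antidifferences can be
-- chosen coset by coset. The representative `rep` makes the choice depend on the coset only.
theorem exists_quasiPoly_antidifference {B : Finset E} {v : Fin n → ℤ} {d : ℕ}
    {f : (Fin n → ℤ) → ℝ} (hv : castVec v ≠ 0) (hvB : v ∈ lattice a B)
    (hfp : ∀ b₀, ∃ p : (Fin n → ℝ) → ℝ, IsPolyFun d p ∧
      ∀ b, b - b₀ ∈ lattice a B → castVec b ∈ openCone a B → f b = p (castVec b)) :
    ∃ Φ, IsQuasiPoly a B (d + 1) Φ ∧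
      ∀ b, castVec b ∈ openCone a B → f b = Φ b - Φ (b - v) := by
  choose p hp hpf using hfp
  choose P hP hPp using fun b₀ => (hp b₀).exists_antidifference hv
  let rep : (Fin n → ℤ) → (Fin n → ℤ) := fun b => (b : (Fin n → ℤ) ⧸ lattice a B).out
  have hrep : ∀ b b', b' - b ∈ lattice a B → rep b' = rep b := fun b b' h => by
    have : (b' : (Fin n → ℤ) ⧸ lattice a B) = b := by
      rw [eq_comm, QuotientAddGroup.eq]
      simpa [sub_eq_neg_add] using h
    simp only [rep, this]
  have hmem : ∀ b, b - rep b ∈ lattice a B := fun b => by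
    have : ((rep b : Fin n → ℤ) : (Fin n → ℤ) ⧸ lattice a B) = b := Quotient.out_eq' _
    rw [QuotientAddGroup.eq] at this
    simpa [sub_eq_neg_add] using this
  refine ⟨fun b => P (rep b) (castVec b), fun b₀ => ⟨P (rep b₀), hP _, fun b hb => ?_⟩,
    fun b hb => ?_⟩
  · beta_reduce
    rw [hrep b₀ b hb]
  · have : rep (b - v) = rep b := hrep _ _ (by simpa using neg_mem hvB)
    beta_reduce
    rw [this, map_sub, hPp]
    exact hpf _ b (hmem b) hb

variable {l : (Fin n → ℝ) →ₗ[ℝ] ℝ}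

/-- The points b - k • a c in the cone of `B` with k > 0 correspond to representations of `b`
positive on `A` with c-coordinate k, and such representations form an open segment parallel to the
circuit `z`. Its ends lie in cones of independent subfamilies A \ D, with one `D` for each end. With
f(b) = Φ(b) - Φ(b - 2 a_c) the sum telescopes to the contributions of these ends, of degree d + 1.
-/
theorem rayConv_mem_span_of_dep (hl : ∀ e, 0 < l (castVec (a e))) (h2 : TwoSaturated a)
    {T B : Finset E} {d : ℕ} {c : E} (hc : c ∉ T) (hB : B ⊆ T) (hind : Indep a B)
    (hdep : ¬ Indep a (insert c B)) {f : (Fin n → ℤ) → ℝ}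
    (hf0 : ∀ b, castVec b ∉ openCone a B → f b = 0)
    (hfp : ∀ b₀, ∃ p : (Fin n → ℝ) → ℝ, IsPolyFun d p ∧
      ∀ b, b - b₀ ∈ lattice a B → castVec b ∈ openCone a B → f b = p (castVec b)) :
    rayConv a l c f ∈ Submodule.span ℝ {f | IsPiece a (insert c T) (d + 1) f} := by
  have hcB : c ∉ B := fun h => hc (hB h)
  obtain ⟨z, hz, hzc⟩ := exists_isCircuit hind hdep
  -- Without a negative coordinate, `l` would be positive on the combination given by `z`, which is
  -- zero. Hence the segment is bounded in both directions.
  obtain ⟨i₀, hi₀⟩ : ∃ i, z i < 0 := by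
    by_contra! h
    have := mul_le_of_nonneg hl h c
    rw [hz.comb_eq, hzc, map_zero, one_mul] at this
    exact absurd (hl c) this.not_gt
  have hac : castVec (a c) ≠ 0 := fun h => by simpa [h] using hl c
  have h2c : (2 : ℤ) • a c ∈ lattice a B := by
    refine h2 B (a c) (Pi.single c 1 - z) hind (fun e he => ?_) ?_
    · by_cases hec : e = c
      · subst hec; simp [hzc]
      · simp [hec, hz.supp e (by simp [hec, he])]
    · rw [map_sub, hz.comb_eq, comb_single, one_smul, sub_zero]
  obtain ⟨Φ, hΦ, hfΦ⟩ := exists_quasiPoly_antidifference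
    (by rw [castVec_zsmul]; simpa using hac) h2c hfp
  set A := insert c B with hA
  have hτ : ∀ D, ∃ τ : (Fin n → ℝ) →ₗ[ℝ] ℝ, Indep a (A \ D) →
      ∀ w, SuppOn (A \ D) w → τ (comb a w) = w c := fun D => by
    by_cases h : Indep a (A \ D)
    · obtain ⟨τ, hτ⟩ := h.exists_coord c
      exact ⟨τ, fun _ => hτ⟩
    · exact ⟨0, fun h' => absurd h' h⟩
  choose τ hτ using hτ
  -- integral points of the segment through `b`
  have hline : ∀ (b : Fin n → ℤ) (k : ℤ), (0 < k ∧ castVec (b - k • a c) ∈ openCone a B) ↔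
      ∃ y, SuppOn A y ∧ (∀ e ∈ A, 0 < y e) ∧ comb a y = castVec b ∧ y c = k := by
    intro b k
    constructor
    · rintro ⟨hk, w, hw, hpos, hwb⟩
      refine ⟨w + Pi.single c (k : ℝ), fun e he => ?_, fun e he => ?_, ?_, ?_⟩
      · simp only [hA, Finset.mem_insert, not_or] at he
        simp [he.1, hw e he.2]
      · by_cases hec : e = c
        · subst hec; simpa [hw e hcB] using hk
        · simpa [hec] using hpos e (by simpa [hA, hec] using he)
      · rw [map_add, hwb, comb_single, map_sub, castVec_zsmul, sub_add_cancel]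
      · simp [hw c hcB]
    · rintro ⟨y, hy, hpos, hyb, hyc⟩
      have h1 : 0 < y c := hpos c (by simp [hA])
      refine ⟨by rw [hyc] at h1; exact_mod_cast h1, y - Pi.single c (y c), fun e he => ?_,
        fun e he => ?_, ?_⟩
      · by_cases hec : e = c
        · subst hec; simp
        · simp [hec, hy e (by simp [hA, hec, he])]
      · have hec : e ≠ c := fun h => hcB (h ▸ he)
        simpa [hec] using hpos e (by simp [hA, he])
      · rw [map_sub, hyb, comb_single, map_sub, castVec_zsmul, hyc]
  -- Lower ends are ends for -z and upper ends are ends for z. Rounding gives the first integer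
  -- above the lower end and the first integer not below the upper end.
  have key : rayConv a l c f =
      ∑ D ∈ (A.filter (fun e => (-z) e < 0)).powerset.erase ∅,
        endSum a c (A \ D) (τ D) (fun x => ⌊x⌋ + 1) Φ -
      ∑ D ∈ (A.filter (fun e => z e < 0)).powerset.erase ∅,
        endSum a c (A \ D) (τ D) (fun x => ⌈x⌉) Φ := by
    ext b
    simp only [Pi.sub_apply, Finset.sum_apply]
    by_cases hb : castVec b ∈ openCone a A
    · obtain ⟨D, hD, hDne, hDb⟩ := hz.exists_end hi₀ hb
      obtain ⟨D', hD', hDne', hDb'⟩ := hz.neg.exists_end (i₀ := c) (by simp [hzc]) hb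
      rw [Finset.sum_eq_single D', Finset.sum_eq_single D]
      rotate_left
      · intro D₁ hD₁ hne
        refine if_neg fun h => hne ?_
        simp only [Finset.mem_erase, Finset.mem_powerset] at hD₁
        exact hz.end_unique hD₁.2 hD (Finset.nonempty_iff_ne_empty.mpr hD₁.1) hDne h hDb
      · intro h
        exact absurd (by simpa [hDne.ne_empty] using hD) h
      · intro D₁ hD₁ hne
        refine if_neg fun h => hne ?_
        simp only [Finset.mem_erase, Finset.mem_powerset] at hD₁
        exact hz.neg.end_unique hD₁.2 hD' (Finset.nonempty_iff_ne_empty.mpr hD₁.1) hDne' h hDb'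
      · intro h
        exact absurd (by simpa [hDne'.ne_empty] using hD') h
      rw [endSum, endSum, if_pos hDb, if_pos hDb']
      obtain ⟨i, hi⟩ := hDne
      obtain ⟨j, hj⟩ := hDne'
      have hzD : ∀ e ∈ D, z e < 0 := fun e he => (Finset.mem_filter.mp (hD he)).2
      have hzD' : ∀ e ∈ D', 0 < z e := fun e he => by
        simpa using (Finset.mem_filter.mp (hD' he)).2
      obtain ⟨t, ht, htpos, htb⟩ := hDb
      obtain ⟨t', ht', htpos', htb'⟩ := hDb'
      have hs := hτ D (hz.indep_sdiff hi (hzD i hi).ne) t ht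
      have hs' := hτ D' (hz.indep_sdiff hj (hzD' j hj).ne') t' ht'
      rw [htb] at hs
      rw [htb'] at hs'
      rw [hs, hs']
      have htA : SuppOn A t := ht.mono Finset.sdiff_subset
      have htA' : SuppOn A t' := ht'.mono Finset.sdiff_subset
      -- Because z c = 1, the c-coordinate parametrizes the segment, which runs from t' to t.
      have hbetween : ∀ y, SuppOn A y → (∀ e ∈ A, 0 < y e) → comb a y = castVec b →
          t' c < y c ∧ y c < t c := by
        intro y hy hpos hyb
        obtain ⟨κ, hκ⟩ := hz.exists_smul (t - y)
          (fun e he => by simp [htA e he, hy e he]) (by simp [htb, hyb])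
        obtain ⟨κ', hκ'⟩ := hz.exists_smul (t' - y)
          (fun e he => by simp [htA' e he, hy e he]) (by simp [htb', hyb])
        have h1 : ∀ e, t e - y e = κ * z e := fun e => congrFun hκ e
        have h2 : ∀ e, t' e - y e = κ' * z e := fun e => congrFun hκ' e
        have h3 := h1 c
        have h4 := h2 c
        have h5 := h1 i
        have h6 := h2 j
        rw [ht i (by simp [hi])] at h5
        rw [ht' j (by simp [hj])] at h6
        have h7 := hpos i (Finset.mem_filter.mp (hD hi)).1
        have h8 := hpos j (Finset.mem_filter.mp (hD' hj)).1
        have h9 : 0 < κ := by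
          by_contra h
          have := mul_nonneg_of_nonpos_of_nonpos (not_lt.mp h) (hzD i hi).le
          linarith
        have h10 : κ' < 0 := by
          by_contra h
          have := mul_nonneg (not_lt.mp h) (hzD' j hj).le
          linarith
        rw [hzc] at h3 h4
        constructor <;> linarith
      have hlt : t' c < t c := by
        obtain ⟨y, hy, hpos, hyb⟩ := hb
        exact (hbetween y hy hpos hyb).1.trans (hbetween y hy hpos hyb).2
      have hiff : ∀ k : ℤ, (0 < k ∧ castVec (b - k • a c) ∈ openCone a B) ↔
          t' c < k ∧ k < t c := by
        intro k
        rw [hline]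
        constructor
        · rintro ⟨y, hy, hpos, hyb, hyc⟩
          exact hyc ▸ hbetween y hy hpos hyb
        · rintro ⟨hk1, hk2⟩
          refine ⟨t' + ((k : ℝ) - t' c) • z, fun e he => ?_, fun e he => ?_, ?_, ?_⟩
          · simp [htA' e he, hz.supp e he]
          · obtain ⟨κ, hκ⟩ := hz.exists_smul (t - t')
              (fun e he => by simp [htA e he, htA' e he]) (by simp [htb, htb'])
            have h1 : ∀ e, t e - t' e = κ * z e := fun e => congrFun hκ e
            have hκc := h1 c
            rw [hzc, mul_one] at hκc
            have h2 := h1 e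
            rw [← hκc] at h2
            -- The point with c-coordinate k is a convex combination of the two ends. Their zero
            -- sets `D` and `D'` in `A` are disjoint, so it is positive on `A`.
            have h3 : (t c - t' c) * (t' e + (k - t' c) * z e) =
                (t c - k) * t' e + (k - t' c) * t e := by linear_combination -(k - t' c) * h2
            have h4 := nonneg_of_suppOn ht htpos e
            have h5 := nonneg_of_suppOn ht' htpos' e
            have h6 : 0 < (t c - k) * t' e + (k - t' c) * t e := by
              by_cases heD : e ∈ D
              · have : e ∉ D' := fun h => absurd (hzD e heD) (hzD' e h).not_gt
                have := mul_pos (sub_pos.mpr hk2) (htpos' e (by simp [he, this]))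
                have := mul_nonneg (sub_pos.mpr hk1).le h4
                linarith
              · have := mul_pos (sub_pos.mpr hk1) (htpos e (by simp [he, heD]))
                have := mul_nonneg (sub_pos.mpr hk2).le h5
                linarith
            rw [← h3] at h6
            simpa using pos_of_mul_pos_right h6 (by linarith)
          · simp [htb', hz.comb_eq]
          · simp [hzc]
      have hsub : Finset.Ico (⌊t' c⌋ + 1) ⌈t c⌉ ⊆
          Finset.Icc (1 : ℤ) ⌊l (castVec b) / l (castVec (a c))⌋ := by
        intro k hk
        rw [Finset.mem_Ico, Int.add_one_le_iff, Int.floor_lt, Int.lt_ceil] at hk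
        obtain ⟨h1, h2⟩ := (hiff k).mpr hk
        exact Finset.mem_Icc.mpr ⟨by omega, le_floor_of_mem_openCone hl h2⟩
      have hmm : ⌊t' c⌋ + 1 ≤ ⌈t c⌉ := by
        rw [Int.add_one_le_iff, Int.lt_ceil]
        exact (Int.floor_le _).trans_lt hlt
      unfold rayConv
      rw [← Finset.sum_subset hsub, ← Finset.sum_Ico_sub_add_two (fun k => Φ (b - k • a c)) hmm]
      · refine Finset.sum_congr rfl fun k hk => ?_
        rw [Finset.mem_Ico, Int.add_one_le_iff, Int.floor_lt, Int.lt_ceil] at hk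
        rw [hfΦ _ ((hiff k).mpr hk).2, add_smul, sub_sub]
      · intro k hk hk'
        refine hf0 _ fun h => hk' ?_
        rw [Finset.mem_Ico, Int.add_one_le_iff, Int.floor_lt, Int.lt_ceil, ← hiff]
        exact ⟨by simp at hk; omega, h⟩
    · rw [Finset.sum_eq_zero, Finset.sum_eq_zero, sub_zero]
      · refine Finset.sum_eq_zero fun k hk => hf0 _ fun h => hb ?_
        obtain ⟨y, h1, h2, h3, -⟩ := (hline b k).mp ⟨by simp at hk; omega, h⟩
        exact ⟨y, h1, h2, h3⟩
      · intro D hD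
        simp only [Finset.mem_erase, Finset.mem_powerset] at hD
        exact if_neg fun h => hb (hz.mem_openCone_of_end hD.2 h)
      · intro D hD
        simp only [Finset.mem_erase, Finset.mem_powerset] at hD
        exact if_neg fun h => hb (hz.neg.mem_openCone_of_end hD.2 h)
  have hpiece : ∀ z' : E → ℝ, IsCircuit a A z' → ∀ (rnd : ℝ → ℤ),
      (∀ (x : ℝ) (m : ℤ), rnd (x + m) = rnd x + m) →
      ∀ D ∈ (A.filter (fun e => z' e < 0)).powerset.erase ∅,
        endSum a c (A \ D) (τ D) rnd Φ ∈
          Submodule.span ℝ {f | IsPiece a (insert c T) (d + 1) f} := by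
    intro z' hz' rnd hrnd D hD
    simp only [Finset.mem_erase, Finset.mem_powerset] at hD
    obtain ⟨i, hi⟩ := Finset.nonempty_iff_ne_empty.mpr hD.1
    have hind' := hz'.indep_sdiff hi (Finset.mem_filter.mp (hD.2 hi)).2.ne
    refine Submodule.subset_span (isPiece_endSum hΦ Finset.sdiff_subset
      (Finset.sdiff_subset.trans (Finset.insert_subset_insert c hB)) hind' (hτ D hind') hrnd)
  rw [key]
  exact sub_mem
    (Submodule.sum_mem _ (hpiece _ hz.neg _ fun x m => by rw [Int.floor_add_intCast]; ring))
    (Submodule.sum_mem _ (hpiece _ hz _ fun x m => Int.ceil_add_intCast x m))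

omit [Fintype E] [DecidableEq E] in
theorem rayConv_mem_span {c : E} {P Q : ((Fin n → ℤ) → ℝ) → Prop}
    (h : ∀ f, P f → rayConv a l c f ∈ Submodule.span ℝ {f | Q f}) {f : (Fin n → ℤ) → ℝ}
    (hf : f ∈ Submodule.span ℝ {f | P f}) : rayConv a l c f ∈ Submodule.span ℝ {f | Q f} := by
  induction hf using Submodule.span_induction with
  | mem f hf => exact h f hf
  | zero =>
    have : rayConv a l c 0 = 0 := by ext b; simp [rayConv]
    rw [this]
    exact zero_mem _
  | add f g _ _ hf hg =>
    convert add_mem hf hg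
    ext b
    simp [rayConv, Finset.sum_add_distrib]
  | smul x f _ hf =>
    convert Submodule.smul_mem _ x hf
    ext b
    simp [rayConv, Finset.mul_sum]

/-- Starting from the indicator of 0 for the empty family, every step is of the independent kind, so
the degree remains 0. -/
theorem partitionCount_mem_span_of_indep (hl : ∀ e, 0 < l (castVec (a e))) {T : Finset E}
    (hT : Indep a T) :
    (fun b => (partitionCount a T b : ℝ)) ∈ Submodule.span ℝ {f | IsPiece a T 0 f} := by
  induction T using Finset.induction_on with
  | empty =>
    refine Submodule.subset_span ⟨∅, subset_rfl, hT, fun b hb => ?_, fun b₀ =>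
      ⟨fun _ => 1, IsPolyFun.const 1, fun b _ hb => ?_⟩⟩
    · refine Nat.cast_eq_zero.mpr ((congrArg Set.ncard ?_).trans (Set.ncard_empty (E → ℤ)))
      refine Set.eq_empty_of_forall_notMem ?_
      rintro w ⟨hw, -, hwb⟩
      refine hb ⟨fun e => (w e : ℝ), fun e he => by simp [hw e he], by simp, ?_⟩
      rw [comb_intCast, hwb]
    · have hb0 : b = 0 := by
        obtain ⟨w, hw, -, hwb⟩ := hb
        have : w = 0 := funext fun e => hw e (by simp)
        rw [this, map_zero] at hwb
        ext i
        simpa using (congrFun hwb i).symm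
      refine Nat.cast_eq_one.mpr (Set.ncard_eq_one.mpr ⟨0, ?_⟩)
      ext w
      constructor
      · rintro ⟨hw, -⟩
        exact funext fun e => hw e (by simp)
      · rintro rfl
        exact ⟨fun _ _ => rfl, by simp, by simp [hb0]⟩
  | insert c T hc ih =>
    have : (fun b => (partitionCount a (insert c T) b : ℝ)) =
        rayConv a l c (fun b => (partitionCount a T b : ℝ)) :=
      funext fun b => partitionCount_insert hl hc b
    rw [this]
    refine rayConv_mem_span (fun f hf => ?_) (ih (hT.mono (Finset.subset_insert c T)))
    obtain ⟨B, hB, hind, hf0, hfp⟩ := hf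
    exact Submodule.subset_span (isPiece_rayConv_of_indep hl hc hB
      (hT.mono (Finset.insert_subset_insert c hB)) hf0 hfp)

/-- The partition function is a combination of quasi-polynomials supported on relatively open
simplicial cones. -/
theorem partitionCount_mem_span (hl : ∀ e, 0 < l (castVec (a e))) (h2 : TwoSaturated a)
    {T₀ T₁ : Finset E} (h₀ : Indep a T₀) (hdisj : Disjoint T₀ T₁) :
    (fun b => (partitionCount a (T₀ ∪ T₁) b : ℝ)) ∈
      Submodule.span ℝ {f | IsPiece a (T₀ ∪ T₁) T₁.card f} := by
  induction T₁ using Finset.induction_on with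
  | empty => simpa using partitionCount_mem_span_of_indep hl h₀
  | insert c T hc ih =>
    rw [Finset.disjoint_insert_right] at hdisj
    have hc' : c ∉ T₀ ∪ T := by simp [hdisj.1, hc]
    have : (fun b => (partitionCount a (insert c (T₀ ∪ T)) b : ℝ)) =
        rayConv a l c (fun b => (partitionCount a (T₀ ∪ T) b : ℝ)) :=
      funext fun b => partitionCount_insert hl hc' b
    rw [Finset.union_insert, this, Finset.card_insert_of_notMem hc]
    refine rayConv_mem_span (fun f hf => ?_) (ih hdisj.2)
    obtain ⟨B, hB, hind, hf0, hfp⟩ := hf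
    -- Only the dependent case uses the extra degree allowed by the new vector.
    by_cases hdep : Indep a (insert c B)
    · refine Submodule.subset_span (isPiece_rayConv_of_indep hl hc' hB hdep hf0 fun b₀ => ?_)
      obtain ⟨p, hp, hpf⟩ := hfp b₀
      exact ⟨p, hp.mono (Nat.le_succ _), hpf⟩
    · exact rayConv_mem_span_of_dep hl h2 hc' hB hind hdep hf0 hfp

end VectorPartition

/-! ### Wall forms and edges -/

section WallForms

variable {n : ℕ}

/-- `wallForm I J` as a linear form. -/
noncomputable def wallLin (I J : Finset (Fin n)) : (Fin n → ℝ) →ₗ[ℝ] ℝ where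
  toFun := wallForm I J
  map_add' x y := by simp [wallForm, Finset.sum_add_distrib]; ring
  map_smul' c x := by simp [wallForm, ← Finset.mul_sum]; ring

@[simp]
theorem wallLin_apply (I J : Finset (Fin n)) (x : Fin n → ℝ) : wallLin I J x = wallForm I J x :=
  rfl

theorem wallForm_castVec (I J : Finset (Fin n)) (x : Fin n → ℤ) :
    wallForm I J (castVec x) = ((∑ i ∈ I, x i - ∑ j ∈ J, x j : ℤ) : ℝ) := by
  simp [wallForm]

theorem wallForm_single (I J : Finset (Fin n)) (u : Fin n) :
    wallForm I J (Pi.single u 1) = (if u ∈ I then 1 else 0) - (if u ∈ J then 1 else 0) := by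
  simp [wallForm]

/-- The incidence vector of an edge with ends `u` and `v`, with sign `s`. -/
def edgeVec (s : ℤ) (u v : Fin n) : Fin n → ℤ := s • (Pi.single u 1 + Pi.single v 1)

theorem castVec_edgeVec (s : ℤ) (u v : Fin n) :
    castVec (edgeVec s u v) = (s : ℝ) • (Pi.single u 1 + Pi.single v 1) := by
  ext i
  simp [edgeVec, Pi.single_apply]
  split_ifs <;> ring

/-- A linear form vanishing on a set of edges but not at `x` can be replaced by a wall form. -/
theorem exists_wallForm_of_linear {S : Set (Fin n × Fin n)} {φ : (Fin n → ℝ) →ₗ[ℝ] ℝ}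
    (hφ : ∀ e ∈ S, φ (Pi.single e.1 1 + Pi.single e.2 1) = 0) {x : Fin n → ℝ} (hx : φ x ≠ 0) :
    ∃ I J : Finset (Fin n), Disjoint I J ∧
      (∀ e ∈ S, wallForm I J (Pi.single e.1 1 + Pi.single e.2 1) = 0) ∧ wallForm I J x ≠ 0 := by
  classical
  set f : Fin n → ℝ := fun i => φ (Pi.single i 1) with hf
  have hφx : φ x = ∑ i, x i * f i := by
    conv_lhs => rw [LinearMap.pi_apply_eq_sum_univ φ x]
    refine Finset.sum_congr rfl fun i _ => ?_
    rw [smul_eq_mul, hf]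
    congr 2
    ext j
    simp [Pi.single_apply, eq_comm]
  let I : ℝ → Finset (Fin n) := fun t => Finset.univ.filter fun i => f i = t
  -- `φ` is split along the level sets of the absolute values of its coefficients, as a combination
  -- of wall forms with I = {f = t} and J = {f = -t}. Some term with t ≠ 0 is non-zero at `x`. It
  -- still vanishes on the edges of `S`, since their ends have opposite coefficients.
  have hdec : φ x = ∑ t ∈ Finset.univ.image (fun i => |f i|), t * wallForm (I t) (I (-t)) x := by
    have h1 : ∀ t ∈ Finset.univ.image (fun i => |f i|), t * wallForm (I t) (I (-t)) x =
        ∑ i with |f i| = t, x i * f i := by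
      intro t ht
      obtain ⟨i₀, -, hi₀⟩ := Finset.mem_image.mp ht
      have ht0 : 0 ≤ t := hi₀ ▸ abs_nonneg _
      rcases ht0.eq_or_lt with rfl | ht0
      · rw [zero_mul, Finset.sum_eq_zero]
        intro i hi
        simp [abs_eq_zero.mp (Finset.mem_filter.mp hi).2]
      · have h2 : (Finset.univ.filter fun i => |f i| = t) = I t ∪ I (-t) := by
          ext i
          simp [I, abs_eq ht0.le]
        have h3 : Disjoint (I t) (I (-t)) := by
          refine Finset.disjoint_left.mpr fun i hi hi' => ?_
          simp only [I, Finset.mem_filter, Finset.mem_univ, true_and] at hi hi'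
          linarith
        rw [h2, Finset.sum_union h3, wallForm, mul_sub, Finset.mul_sum, Finset.mul_sum,
          sub_eq_add_neg, ← Finset.sum_neg_distrib]
        congr 1 <;> refine Finset.sum_congr rfl fun i hi => ?_
        · rw [(Finset.mem_filter.mp hi).2]; ring
        · rw [(Finset.mem_filter.mp hi).2]; ring
    rw [Finset.sum_congr rfl h1, hφx, Finset.sum_fiberwise_of_maps_to]
    exact fun i _ => Finset.mem_image_of_mem _ (Finset.mem_univ i)
  rw [hdec] at hx
  obtain ⟨t, ht, htx⟩ := Finset.exists_ne_zero_of_sum_ne_zero hx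
  obtain ⟨i₀, -, hi₀⟩ := Finset.mem_image.mp ht
  have ht0 : t ≠ 0 := left_ne_zero_of_mul htx
  refine ⟨I t, I (-t), ?_, fun e he => ?_, right_ne_zero_of_mul htx⟩
  · refine Finset.disjoint_left.mpr fun i hi hi' => ht0 ?_
    simp only [I, Finset.mem_filter, Finset.mem_univ, true_and] at hi hi'
    linarith
  · have h1 := hφ e he
    rw [map_add] at h1
    have h2 : f e.1 = -f e.2 := by simp only [hf]; linarith
    rw [← wallLin_apply, map_add, wallLin_apply, wallLin_apply, wallForm_single, wallForm_single]
    simp only [I, Finset.mem_filter, Finset.mem_univ, true_and, h2, neg_inj]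
    simp only [neg_eq_iff_eq_neg]
    ring

/-- The value on an edge is 0, ±1 or ±2, so it divides 2 unless it vanishes. All factors 2 in the
lattice arguments come from here. -/
theorem wallForm_edge_mem {I J : Finset (Fin n)} (hIJ : Disjoint I J) (u v : Fin n)
    (h : wallForm I J (Pi.single u 1 + Pi.single v 1) ≠ 0) :
    ∃ k : ℤ, 2 = k * wallForm I J (Pi.single u 1 + Pi.single v 1) := by
  rw [← wallLin_apply, map_add, wallLin_apply, wallLin_apply, wallForm_single,
    wallForm_single] at h ⊢
  have h1 : u ∈ I → u ∉ J := fun h h' => Finset.disjoint_left.mp hIJ h h'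
  have h2 : v ∈ I → v ∉ J := fun h h' => Finset.disjoint_left.mp hIJ h h'
  by_cases hu : u ∈ I <;> by_cases hv : v ∈ I <;> by_cases hu' : u ∈ J <;>
    by_cases hv' : v ∈ J <;> simp only [hu, hv, hu', hv', if_true, if_false] at h ⊢ <;>
    first | exact absurd hu' (h1 hu) | exact absurd hv' (h2 hv) |
      (refine ⟨1, ?_⟩; norm_num; done) | (refine ⟨2, ?_⟩; norm_num; done) |
      (refine ⟨-1, ?_⟩; norm_num; done) | (refine ⟨-2, ?_⟩; norm_num; done) |
      (refine (h ?_).elim; norm_num)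

end WallForms

/-! ### Unimodularity up to a factor two -/

namespace VectorPartition

variable {E : Type*} [Fintype E] {n : ℕ} {a : E → Fin n → ℤ}

/-- The span of a subfamily. -/
def spanOn (a : E → Fin n → ℤ) (B : Finset E) : Submodule ℝ (Fin n → ℝ) where
  carrier := {x | ∃ w, SuppOn B w ∧ comb a w = x}
  zero_mem' := ⟨0, fun _ _ => rfl, map_zero _⟩
  add_mem' := by
    rintro _ _ ⟨w, hw, rfl⟩ ⟨w', hw', rfl⟩
    exact ⟨w + w', fun e he => by simp [hw e he, hw' e he], map_add _ _ _⟩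
  smul_mem' := by
    rintro c _ ⟨w, hw, rfl⟩
    exact ⟨c • w, fun e he => by simp [hw e he], map_smul _ _ _⟩

theorem castVec_mem_spanOn {B : Finset E} {e : E} (he : e ∈ B) : castVec (a e) ∈ spanOn a B := by
  classical
  exact ⟨Pi.single e 1, fun e' he' => Pi.single_eq_of_ne (fun h : e' = e => he' (h ▸ he)) _,
    by rw [comb_single, one_smul]⟩

theorem map_comb_eq_zero {B : Finset E} {φ : (Fin n → ℝ) →ₗ[ℝ] ℝ}
    (hφ : ∀ e ∈ B, φ (castVec (a e)) = 0) {w : E → ℝ} (hw : SuppOn B w) : φ (comb a w) = 0 := by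
  rw [map_comb]
  refine Finset.sum_eq_zero fun e _ => ?_
  by_cases he : e ∈ B
  · rw [hφ e he, mul_zero]
  · rw [hw e he, zero_mul]

theorem map_comb_eq_single {B : Finset E} {φ : (Fin n → ℝ) →ₗ[ℝ] ℝ} {i : E}
    (hφ : ∀ e ∈ B, e ≠ i → φ (castVec (a e)) = 0) {w : E → ℝ} (hw : SuppOn B w) :
    φ (comb a w) = w i * φ (castVec (a i)) := by
  rw [map_comb, Finset.sum_eq_single i]
  · intro e _ hei
    by_cases he : e ∈ B
    · rw [hφ e he hei, mul_zero]
    · rw [hw e he, zero_mul]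
  · simp

/-- The family consists of signed incidence vectors of edges. -/
def IsEdgeFamily (a : E → Fin n → ℤ) : Prop :=
  ∀ e, ∃ (s : ℤ) (u v : Fin n), (s = 1 ∨ s = -1) ∧ a e = edgeVec s u v

namespace IsEdgeFamily

omit [Fintype E] in
theorem exists_wallForm (ha : IsEdgeFamily a) {B : Finset E} {φ : (Fin n → ℝ) →ₗ[ℝ] ℝ}
    (hφ : ∀ e ∈ B, φ (castVec (a e)) = 0) {x : Fin n → ℝ} (hx : φ x ≠ 0) :
    ∃ I J : Finset (Fin n), Disjoint I J ∧ (∀ e ∈ B, wallForm I J (castVec (a e)) = 0) ∧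
      wallForm I J x ≠ 0 := by
  choose s u v hs hav using ha
  have hs0 : ∀ e, (s e : ℝ) ≠ 0 := fun e => by rcases hs e with h | h <;> simp [h]
  have key : ∀ (φ : (Fin n → ℝ) →ₗ[ℝ] ℝ) e,
      φ (castVec (a e)) = 0 ↔ φ (Pi.single (u e) 1 + Pi.single (v e) 1) = 0 := fun φ e => by
    rw [hav, castVec_edgeVec, map_smul, smul_eq_zero]
    simp [hs0]
  obtain ⟨I, J, h1, h2, h3⟩ := exists_wallForm_of_linear (S := (fun e => (u e, v e)) '' B) (φ := φ)
    (by rintro _ ⟨e, he, rfl⟩; exact (key φ e).mp (hφ e he)) hx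
  refine ⟨I, J, h1, fun e he => ?_, h3⟩
  exact (key (wallLin I J) e).mpr (h2 _ ⟨e, he, rfl⟩)

theorem exists_wallForm_of_notMem (ha : IsEdgeFamily a) {B : Finset E} {x : Fin n → ℝ}
    (hx : x ∉ spanOn a B) :
    ∃ I J : Finset (Fin n), Disjoint I J ∧ (∀ e ∈ B, wallForm I J (castVec (a e)) = 0) ∧
      wallForm I J x ≠ 0 := by
  obtain ⟨φ, hφ, hB⟩ := Submodule.exists_le_ker_of_notMem hx
  exact ha.exists_wallForm (fun e he => hB (castVec_mem_spanOn he)) hφ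

omit [Fintype E] in
theorem exists_two_eq (ha : IsEdgeFamily a) {I J : Finset (Fin n)} (hIJ : Disjoint I J) {e : E}
    (h : wallForm I J (castVec (a e)) ≠ 0) : ∃ k : ℤ, 2 = k * wallForm I J (castVec (a e)) := by
  obtain ⟨s, u, v, hs, hav⟩ := ha e
  rw [hav, castVec_edgeVec, ← wallLin_apply, map_smul, wallLin_apply, smul_eq_mul] at h ⊢
  obtain ⟨k, hk⟩ := wallForm_edge_mem hIJ u v (right_ne_zero_of_mul h)
  rcases hs with rfl | rfl
  · exact ⟨k, by simpa using hk⟩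
  · exact ⟨-k, by simpa using hk⟩

/-- The coordinate form at `i` kills the other edges of `B`. A wall form killing the same edges but
not a i is proportional to it on the span of `B`. -/
theorem exists_wallForm_coord (ha : IsEdgeFamily a) {B : Finset E} (hB : Indep a B) {i : E}
    (hi : i ∈ B) : ∃ I J : Finset (Fin n), Disjoint I J ∧ wallForm I J (castVec (a i)) ≠ 0 ∧
      ∀ w, SuppOn B w → wallForm I J (comb a w) = w i * wallForm I J (castVec (a i)) := by
  classical
  obtain ⟨l, hl⟩ := hB.exists_coord i
  have hle : ∀ e ∈ B, l (castVec (a e)) = (Pi.single e 1 : E → ℝ) i := fun e he => by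
    rw [← hl (Pi.single e 1) fun e' he' => Pi.single_eq_of_ne (fun h : e' = e => he' (h ▸ he)) _,
      comb_single, one_smul]
  obtain ⟨I, J, h1, h2, h3⟩ := ha.exists_wallForm (B := B.erase i) (φ := l) (x := castVec (a i))
    (fun e he => by
      rw [hle e (Finset.mem_of_mem_erase he)]
      exact Pi.single_eq_of_ne (Finset.ne_of_mem_erase he).symm _)
    (by rw [hle i hi]; simp)
  exact ⟨I, J, h1, h3, fun w hw => map_comb_eq_single (φ := wallLin I J)
    (fun e he hei => h2 e (Finset.mem_erase.mpr ⟨hei, he⟩)) hw⟩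

/-- A wall form proportional to the coordinate at `i` takes at the integral point `x` the integral
value w_i times its value on a_i, which divides 2. Hence 2 w_i is integral. -/
theorem twoSaturated (ha : IsEdgeFamily a) : TwoSaturated a := by
  intro B x w hB hw hwx
  have : ∀ i, ∃ m : ℤ, (m : ℝ) = 2 * w i := by
    intro i
    by_cases hi : i ∈ B
    · obtain ⟨I, J, hIJ, h0, h⟩ := ha.exists_wallForm_coord hB hi
      obtain ⟨k, hk⟩ := ha.exists_two_eq hIJ h0
      have h1 := h w hw
      rw [hwx, wallForm_castVec] at h1
      refine ⟨k * (∑ i ∈ I, x i - ∑ j ∈ J, x j), ?_⟩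
      rw [Int.cast_mul, h1]
      linear_combination -(w i) * hk
    · exact ⟨0, by simp [hw i hi]⟩
  choose m hm using this
  refine ⟨m, fun e he => ?_, ?_⟩
  · have := hm e
    rw [hw e he] at this
    exact_mod_cast this.trans (mul_zero _)
  · have h1 : castVec (∑ e, m e • a e) = castVec ((2 : ℤ) • x) := by
      rw [← comb_intCast, castVec_zsmul, ← hwx, ← map_smul]
      congr 1
      ext e
      simp [hm]
    ext i
    have := congrFun h1 i
    simp only [castVec_apply] at this
    exact_mod_cast this

end IsEdgeFamily

end VectorPartition

/-! ### Cells, cones and cosets -/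

section Cells

variable {n : ℕ} {C : Set (Fin n → ℝ)}

theorem IsCell.sign_eq (hC : IsCell C) {b b' : Fin n → ℝ} (hb : b ∈ C) (hb' : b' ∈ C)
    {I J : Finset (Fin n)} (hIJ : Disjoint I J) :
    SignType.sign (wallForm I J b) = SignType.sign (wallForm I J b') := by
  obtain ⟨b₀, rfl⟩ := hC
  exact (hb I J hIJ).trans (hb' I J hIJ).symm

theorem IsCell.mem_of_sign_eq (hC : IsCell C) {b b' : Fin n → ℝ} (hb : b ∈ C)
    (h : ∀ I J : Finset (Fin n), Disjoint I J →
      SignType.sign (wallForm I J b') = SignType.sign (wallForm I J b)) : b' ∈ C := by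
  obtain ⟨b₀, rfl⟩ := hC
  exact fun I J hIJ => (h I J hIJ).trans (hb I J hIJ)

theorem sign_eq_sign_iff {x y : ℝ} : SignType.sign x = SignType.sign y ↔
    (x = 0 ↔ y = 0) ∧ (0 < x ↔ 0 < y) := by
  rw [← sign_eq_zero_iff (a := x), ← sign_eq_zero_iff (a := y), ← sign_eq_one_iff (a := x),
    ← sign_eq_one_iff (a := y)]
  generalize SignType.sign x = s
  generalize SignType.sign y = t
  revert s t
  decide

open VectorPartition

variable {E : Type*} [Fintype E] {a : E → Fin n → ℤ}

/-- Membership in the span of `B` and positivity of the coordinates are both detected by signs of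
wall forms, so a cell meeting the open cone lies inside it. -/
theorem IsCell.mem_openCone (hC : IsCell C) (ha : IsEdgeFamily a) {B : Finset E}
    (hB : Indep a B) {b b' : Fin n → ℝ} (hb : b ∈ C) (hb' : b' ∈ C) (h : b ∈ openCone a B) :
    b' ∈ openCone a B := by
  obtain ⟨w, hw, hpos, rfl⟩ := h
  have hspan : b' ∈ spanOn a B := by
    by_contra hspan
    obtain ⟨I, J, hIJ, h0, h1⟩ := ha.exists_wallForm_of_notMem hspan
    have := (sign_eq_sign_iff.mp (hC.sign_eq hb hb' hIJ)).1.mp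
      (map_comb_eq_zero (φ := wallLin I J) h0 hw)
    exact h1 this
  obtain ⟨w', hw', rfl⟩ := hspan
  refine ⟨w', hw', fun e he => ?_, rfl⟩
  obtain ⟨I, J, hIJ, h0, h1⟩ := ha.exists_wallForm_coord hB he
  have := hC.sign_eq hb hb' hIJ
  rw [h1 w hw, h1 w' hw', sign_mul, sign_mul, sign_pos (hpos e he), one_mul] at this
  have h2 : SignType.sign (wallForm I J (castVec (a e))) ≠ 0 := by simpa using h0
  have h3 : SignType.sign (w' e) = 1 := by
    revert this h2
    generalize SignType.sign (wallForm I J (castVec (a e))) = x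
    generalize SignType.sign (w' e) = y
    revert x y
    decide
  exact sign_eq_one_iff.mp h3

/-- If the cone of a piece contains a point of C ∩ Λ, it contains all of them. Two of them differ by
2 • y with y integral in the span of `B`, hence by an element of the lattice of `B`, so one
polynomial serves for all. -/
theorem IsCell.exists_isPolyFun (hC : IsCell C) (ha : IsEdgeFamily a) {T : Finset E} {d : ℕ}
    {f : (Fin n → ℤ) → ℝ} (hf : f ∈ Submodule.span ℝ {f | IsPiece a T d f}) (r : Fin n → ℤ) :
    ∃ p : (Fin n → ℝ) → ℝ, IsPolyFun d p ∧ ∀ b ∈ cosetPoints C r, f b = p (castVec b) := by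
  induction hf using Submodule.span_induction with
  | mem f hf =>
    obtain ⟨B, -, hB, hf0, hfp⟩ := hf
    by_cases h : ∃ b₀ ∈ cosetPoints C r, castVec b₀ ∈ openCone a B
    · obtain ⟨b₀, hb₀, hb₀B⟩ := h
      obtain ⟨p, hp, hpf⟩ := hfp b₀
      refine ⟨p, hp, fun b hb => hpf b ?_ (hC.mem_openCone ha hB hb₀.1 hb.1 hb₀B)⟩
      obtain ⟨w, hw, -, hwb⟩ := hC.mem_openCone ha hB hb₀.1 hb.1 hb₀B
      obtain ⟨w₀, hw₀, -, hwb₀⟩ := hb₀B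
      have h2 : ∀ i, ∃ y : ℤ, b i - b₀ i = 2 * y := fun i =>
        ((hb.2 i).trans (hb₀.2 i).symm).symm.dvd
      choose y hy using h2
      have hy' : b - b₀ = (2 : ℤ) • y := by
        ext i
        simp [hy]
      rw [hy']
      refine ha.twoSaturated B y ((2 : ℝ)⁻¹ • (w - w₀)) hB
        (fun e he => by simp [hw e he, hw₀ e he]) ?_
      rw [map_smul, map_sub, hwb, hwb₀]
      change (2 : ℝ)⁻¹ • (castVec b - castVec b₀) = _
      rw [← map_sub, hy', castVec_zsmul]
      simp
    · push Not at h
      exact ⟨fun _ => 0, IsPolyFun.const 0, fun b hb => hf0 b (h b hb)⟩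
  | zero => exact ⟨fun _ => 0, IsPolyFun.const 0, fun b _ => rfl⟩
  | add f g _ _ hf hg =>
    obtain ⟨p, hp, hpf⟩ := hf
    obtain ⟨q, hq, hqg⟩ := hg
    exact ⟨_, hp.add hq, fun b hb => by simp [hpf b hb, hqg b hb]⟩
  | smul x f _ hf =>
    obtain ⟨p, hp, hpf⟩ := hf
    exact ⟨_, hp.const_mul x, fun b hb => by simp [hpf b hb]⟩

end Cells

/-! ### Edges, static edges and the relative interior -/

namespace RibbonGraph

variable {H : Type*} (G : RibbonGraph H)

theorem edgeOf_eq_iff {h h' : H} : G.edgeOf h = G.edgeOf h' ↔ h = h' ∨ h = G.opp h' := by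
  have hsq : G.opp * G.opp = 1 := Equiv.ext G.opp_opp
  have : G.edgeOf h = G.edgeOf h' ↔ G.opp.SameCycle h h' :=
    Quotient.eq (r := Equiv.Perm.SameCycle.setoid G.opp)
  rw [this]
  constructor
  · rintro ⟨i, hi⟩
    rcases Int.even_or_odd' i with ⟨k, rfl | rfl⟩
    · left
      rw [zpow_mul, zpow_two, hsq, one_zpow] at hi
      exact hi
    · right
      rw [zpow_add, zpow_mul, zpow_two, hsq, one_zpow, one_mul, zpow_one] at hi
      rw [← hi, G.opp_opp]
  · rintro (rfl | rfl)
    · exact Equiv.Perm.SameCycle.refl _ _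
    · exact ⟨1, by simp [G.opp_opp]⟩

@[simp]
theorem edgeOf_opp (h : H) : G.edgeOf (G.opp h) = G.edgeOf h := (G.edgeOf_eq_iff).mpr (Or.inr rfl)

@[simp]
theorem edgeOf_out (e : G.Edge) : G.edgeOf (Quotient.out e) = e := Quotient.out_eq e

open Classical in
theorem sum_halfEdges [Fintype H] {M : Type*} [AddCommMonoid M] (f : H → M) :
    ∑ h, f h = ∑ e : G.Edge, (f (Quotient.out e) + f (G.opp (Quotient.out e))) := by
  rw [← Finset.sum_fiberwise_of_maps_to (t := Finset.univ) (g := G.edgeOf) (by simp)]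
  refine Finset.sum_congr rfl fun e _ => ?_
  rw [← Finset.sum_pair (G.opp_ne _).symm]
  congr 1
  ext h
  have : G.edgeOf h = e ↔ G.edgeOf h = G.edgeOf (Quotient.out e) := by rw [G.edgeOf_out]
  rw [Finset.mem_filter, this, G.edgeOf_eq_iff]
  simp

variable {G}

theorem Connected.induction (hG : G.Connected) {P : H → Prop} (hnext : ∀ h, P h ↔ P (G.next h))
    (hopp : ∀ h, P h ↔ P (G.opp h)) {h₀ : H} (h₀P : P h₀) (h : H) : P h := by
  obtain ⟨g, rfl⟩ := hG.2.exists_smul_eq h₀ h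
  obtain ⟨g, hg⟩ := g
  suffices ∀ x, P x ↔ P (g x) from (this h₀).mp h₀P
  induction hg using Subgroup.closure_induction with
  | mem g hg =>
    rcases hg with rfl | rfl
    · exact hnext
    · exact hopp
  | one => exact fun _ => Iff.rfl
  | mul g g' _ _ hg hg' => exact fun x => (hg' x).trans (hg _)
  | inv g _ hg => exact fun x => by rw [hg (g⁻¹ x)]; simp

end RibbonGraph

namespace LabelledRibbonGraph

open VectorPartition

variable {n : ℕ} {H : Type*} (G : LabelledRibbonGraph n H)

/-- The incidence vector of an edge. -/
noncomputable def inc (e : G.Edge) : Fin n → ℤ :=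
  edgeVec 1 (G.label (Quotient.out e)) (G.label (G.opp (Quotient.out e)))

theorem castVec_inc (e : G.Edge) : castVec (G.inc e) =
    Pi.single (G.label (Quotient.out e)) 1 + Pi.single (G.label (G.opp (Quotient.out e))) 1 := by
  rw [inc, castVec_edgeVec, Int.cast_one, one_smul]

theorem inc_edgeOf (h : H) :
    G.inc (G.edgeOf h) = Pi.single (G.label h) 1 + Pi.single (G.label (G.opp h)) 1 := by
  have : G.edgeOf (Quotient.out (G.edgeOf h)) = G.edgeOf h := G.edgeOf_out _
  rw [inc, edgeVec, one_smul]
  rcases G.edgeOf_eq_iff.mp this with h | h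
  · rw [h]
  · rw [h, G.opp_opp, add_comm]

theorem castVec_inc_edgeOf (h : H) : castVec (G.inc (G.edgeOf h)) =
    Pi.single (G.label h) 1 + Pi.single (G.label (G.opp h)) 1 := by
  rw [inc_edgeOf]
  ext i
  simp [Pi.single_apply]

theorem isEdgeFamily_inc : IsEdgeFamily G.inc := fun _ => ⟨1, _, _, Or.inl rfl, rfl⟩

theorem perimeters_eq_comb [Fintype H] (w : G.Edge → ℝ) : G.perimeters w = comb G.inc w := by
  classical
  ext i
  have : G.perimeters w i = ∑ h, if G.label h = i then w (G.edgeOf h) else 0 := by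
    rw [← Finset.sum_filter]
    simp only [perimeters, LinearMap.coe_mk, AddHom.coe_mk]
  rw [this, G.sum_halfEdges, comb_apply, Finset.sum_apply]
  refine Finset.sum_congr rfl fun e _ => ?_
  rw [castVec_inc]
  simp [Pi.single_apply, mul_add, eq_comm]

variable {G}

theorem VertexLabelled.label_next (hG : G.VertexLabelled) (h : H) :
    G.label (G.next h) = G.label h :=
  (hG.2 _ _).mpr ⟨-1, by simp⟩

/-- Such a form takes opposite values at the two ends of every edge. By connectedness its absolute
value is constant on the vertices; if this were non-zero, its sign would be a proper two-colouring.
-/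
theorem eq_zero_of_inc (hc : G.Connected) (hv : G.VertexLabelled) (hb : ¬ G.Bipartite)
    {φ : (Fin n → ℝ) →ₗ[ℝ] ℝ} (hφ : ∀ e, φ (castVec (G.inc e)) = 0) : φ = 0 := by
  by_contra hne
  have hopp : ∀ h, φ (Pi.single (G.label (G.opp h)) 1) = -φ (Pi.single (G.label h) 1) := by
    intro h
    have := hφ (G.edgeOf h)
    rw [castVec_inc_edgeOf, map_add] at this
    linarith
  obtain ⟨i, hi⟩ : ∃ i, φ (Pi.single i 1) ≠ 0 := by
    by_contra! h
    refine hne (LinearMap.pi_ext' fun i => LinearMap.ext_ring ?_)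
    simpa using h i
  obtain ⟨h₀, rfl⟩ := hv.1 i
  have habs : ∀ h, |φ (Pi.single (G.label h) 1)| = |φ (Pi.single (G.label h₀) 1)| :=
    hc.induction (fun h => by rw [hv.label_next]) (fun h => by rw [hopp, abs_neg]) rfl
  refine hb ⟨fun u => decide (0 < φ (Pi.single u 1)), fun h => ?_⟩
  have h0 : φ (Pi.single (G.label h) 1) ≠ 0 := by
    rw [← abs_pos, habs, abs_pos]
    exact hi
  beta_reduce
  rw [hopp, ne_eq, decide_eq_decide, Left.neg_pos_iff]
  rcases lt_or_gt_of_ne h0 with h | h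
  · simp [h, h.not_gt]
  · simp [h, h.not_gt]

/-- The sign of `φ` colours the component of G - e of a vertex where `φ` is non-zero. -/
theorem isStatic_of_linear {e : G.Edge} {φ : (Fin n → ℝ) →ₗ[ℝ] ℝ}
    (hφ : ∀ e', e' ≠ e → φ (castVec (G.inc e')) = 0) (he : φ (castVec (G.inc e)) ≠ 0) :
    G.IsStatic e := by
  have hopp : ∀ h, G.edgeOf h ≠ e →
      φ (Pi.single (G.label (G.opp h)) 1) = -φ (Pi.single (G.label h) 1) := by
    intro h hh
    have := hφ _ hh
    rw [castVec_inc_edgeOf, map_add] at this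
    linarith
  obtain ⟨v, hv⟩ : ∃ v, φ (Pi.single v 1) ≠ 0 := by
    by_contra! h
    rw [castVec_inc, map_add, h, h, add_zero] at he
    exact he rfl
  have habs : ∀ u, G.SameComponent e v u → |φ (Pi.single u 1)| = |φ (Pi.single v 1)| := by
    intro u hu
    induction hu with
    | refl => rfl
    | tail _ h ih =>
      obtain ⟨h, hh, rfl, rfl⟩ := h
      rw [hopp h hh, abs_neg, ih]
  refine ⟨v, fun u => decide (0 < φ (Pi.single u 1)), fun h hh hc => ?_⟩
  have h0 : φ (Pi.single (G.label h) 1) ≠ 0 := by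
    rw [← abs_pos, habs _ hc, abs_pos]
    exact hv
  beta_reduce
  rw [hopp h hh, ne_eq, decide_eq_decide, Left.neg_pos_iff]
  rcases lt_or_gt_of_ne h0 with h | h
  · simp [h, h.not_gt]
  · simp [h, h.not_gt]

variable [Fintype H]

/-- If the vector of `e` were outside the span of the other edges, a form separating it from them
would make `e` static. The resulting relation shows that the weight of `e` varies freely on every
fibre. -/
theorem exists_relation_of_not_isStatic {e : G.Edge} (he : ¬ G.IsStatic e) :
    ∃ z : G.Edge → ℝ, G.perimeters z = 0 ∧ z e = 1 := by
  classical
  have hmem : castVec (G.inc e) ∈ spanOn G.inc (Finset.univ.erase e) := by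
    by_contra hmem
    obtain ⟨φ, hφ, hB⟩ := Submodule.exists_le_ker_of_notMem hmem
    exact he (isStatic_of_linear (fun e' he' => hB (castVec_mem_spanOn (by simpa using he'))) hφ)
  obtain ⟨w, hw, hwe⟩ := hmem
  refine ⟨Pi.single e 1 - w, ?_, by simp [hw e (by simp)]⟩
  rw [perimeters_eq_comb, map_sub, comb_single, hwe, one_smul, sub_self]

open Classical in
theorem staticWeight_eq_wallForm {e : G.Edge} (he : G.IsStatic e) :
    ∃ (I J : Finset (Fin n)) (κ : ℝ), Disjoint I J ∧
      ∀ b, G.staticWeight he b = wallForm I J b / κ := by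
  obtain ⟨κ, hκ⟩ : ∃ κ : ℝ, ∀ b, G.staticWeight he b =
    (∑ u with G.SameComponent e he.choose u, colourSign (he.choose_spec.choose u) * b u) / κ :=
    ⟨_, fun b => rfl⟩
  refine ⟨Finset.univ.filter fun u =>
    G.SameComponent e he.choose u ∧ he.choose_spec.choose u = true, Finset.univ.filter fun u =>
    G.SameComponent e he.choose u ∧ he.choose_spec.choose u = false, κ, ?_, fun b => ?_⟩
  rotate_left
  · rw [hκ]
    congr 1
    rw [wallForm, Finset.sum_filter, Finset.sum_filter, Finset.sum_filter,
      ← Finset.sum_sub_distrib]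
    refine Finset.sum_congr rfl fun u _ => ?_
    by_cases hu : G.SameComponent e he.choose u
    · cases h : he.choose_spec.choose u <;> simp [hu, colourSign]
    · simp [hu]
  · refine Finset.disjoint_left.mpr fun u hu hu' => ?_
    simp only [Finset.mem_filter] at hu hu'
    exact absurd (hu.2.2.symm.trans hu'.2.2) (by simp)

open Classical in
-- The signed colouring, extended by zero, is a form `g` that vanishes on every edge except `e`, so
-- at the perimeters of `w` it equals w e times the signed number `D` of ends. If `D` were zero, `g`
-- would vanish on all edges, which a connected non-bipartite graph forbids.
theorem staticWeight_perimeters (hc : G.Connected) (hv : G.VertexLabelled) (hb : ¬ G.Bipartite)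
    {e : G.Edge} (he : G.IsStatic e) (w : G.Edge → ℝ) :
    G.staticWeight he (G.perimeters w) = w e := by
  set v := he.choose with hvdef
  set c := he.choose_spec.choose with hcdef
  have hcol : G.IsColouring e v c := he.choose_spec.choose_spec
  set g : Fin n → ℝ := fun u => if G.SameComponent e v u then colourSign (c u) else 0 with hg
  set D := ∑ h with G.edgeOf h = e ∧ G.SameComponent e v (G.label h),
    colourSign (c (G.label h)) with hD
  have hgopp : ∀ h, G.edgeOf h ≠ e → g (G.label h) + g (G.label (G.opp h)) = 0 := by
    intro h hh
    have hiff : G.SameComponent e v (G.label h) ↔ G.SameComponent e v (G.label (G.opp h)) :=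
      ⟨fun H => H.tail ⟨h, hh, rfl, rfl⟩,
        fun H => H.tail ⟨G.opp h, by simpa using hh, rfl, by rw [G.opp_opp]⟩⟩
    by_cases H : G.SameComponent e v (G.label h)
    · have := hcol h hh H
      simp only [hg, if_pos H, if_pos (hiff.mp H)]
      revert this
      cases c (G.label h) <;> cases c (G.label (G.opp h)) <;> simp [colourSign]
    · simp only [hg, if_neg H, if_neg fun H' => H (hiff.mpr H'), add_zero]
  have hDe : D = g (G.label (Quotient.out e)) + g (G.label (G.opp (Quotient.out e))) := by
    rw [hD, Finset.sum_filter, G.sum_halfEdges, Finset.sum_eq_single e]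
    · simp [hg]
    · intro e' _ he'
      simp [he']
    · simp
  have hnum : ∀ b : Fin n → ℝ, ∑ u with G.SameComponent e v u, colourSign (c u) * b u =
      Fintype.linearCombination ℝ g b := by
    intro b
    rw [Finset.sum_filter]
    refine Finset.sum_congr rfl fun u _ => ?_
    simp only [hg]
    split_ifs <;> simp [mul_comm]
  have hlin : ∀ e', Fintype.linearCombination ℝ g (castVec (G.inc e')) =
      g (G.label (Quotient.out e')) + g (G.label (G.opp (Quotient.out e'))) := by
    intro e'
    rw [castVec_inc, map_add]
    simp [Fintype.linearCombination_apply_single]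
  have hlin0 : ∀ e', e' ≠ e → Fintype.linearCombination ℝ g (castVec (G.inc e')) = 0 := by
    intro e' he'
    rw [hlin]
    exact hgopp _ (by simpa using he')
  have hval : Fintype.linearCombination ℝ g (G.perimeters w) = w e * D := by
    rw [perimeters_eq_comb, map_comb_eq_single (B := Finset.univ) (i := e)
      (fun e' _ => hlin0 e') (fun e' he' => absurd (Finset.mem_univ _) he'), hlin, hDe]
  have hD0 : D ≠ 0 := by
    intro hD0
    have h0 : Fintype.linearCombination ℝ g = 0 := by
      refine eq_zero_of_inc hc hv hb fun e' => ?_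
      by_cases he' : e' = e
      · rw [he', hlin, ← hDe, hD0]
      · exact hlin0 e' he'
    have h1 := LinearMap.congr_fun h0 (Pi.single v 1)
    rw [Fintype.linearCombination_apply_single, LinearMap.zero_apply, one_smul] at h1
    have h2 : G.SameComponent e v v := Relation.ReflTransGen.refl
    simp only [hg, if_pos h2] at h1
    revert h1
    cases c v <;> simp [colourSign]
  have : G.staticWeight he (G.perimeters w) =
      (∑ u with G.SameComponent e v u, colourSign (c u) * G.perimeters w u) / D := rfl
  rw [this, hnum, hval, mul_div_cancel_right₀ _ hD0]

/-- At an interior point the weight of a non-static edge can be decreased slightly along a relation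
within the fibre, so it is positive. Conversely, finitely many strict inequalities are an open
condition. -/
theorem mem_relInterior_iff {b : Fin n → ℝ} {w : G.Edge → ℝ} :
    w ∈ G.relInterior b ↔ G.perimeters w = b ∧ ∀ e, ¬ G.IsStatic e → 0 < w e := by
  constructor
  · rintro ⟨⟨w, hw⟩, hint, rfl⟩
    refine ⟨hw, fun e he => ?_⟩
    obtain ⟨z, hz, hze⟩ := exists_relation_of_not_isStatic he
    let γ : ℝ → G.fibre b := fun s => ⟨w - s • z, by
      have : G.perimeters w = b := hw
      simp [fibre, hz, this]⟩
    have hγ : Continuous γ := Continuous.subtype_mk (by fun_prop) _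
    have h0 : γ 0 ∈ interior {w : G.fibre b | (w : G.Edge → ℝ) ∈ G.polytope b} := by
      convert hint
      simp [γ]
    have hev : ∀ᶠ s in nhdsWithin (0 : ℝ) (Set.Ioi 0), (γ s : G.Edge → ℝ) ∈ G.polytope b :=
      ((hγ.tendsto 0).eventually (mem_interior_iff_mem_nhds.mp h0)).filter_mono
        nhdsWithin_le_nhds
    obtain ⟨s, hs, hs0⟩ := (hev.and self_mem_nhdsWithin).exists
    have := hs.2 e he
    simp only [γ, Pi.sub_apply, Pi.smul_apply, hze, smul_eq_mul, mul_one] at this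
    have hs0' : 0 < s := hs0
    show 0 < w e
    linarith
  · rintro ⟨hw, hpos⟩
    refine ⟨⟨w, hw⟩, mem_interior.mpr ⟨{w | ∀ e, ¬ G.IsStatic e → 0 < (w : G.Edge → ℝ) e},
      fun w' hw' => ⟨w'.2, fun e he => (hw' e he).le⟩, ?_, hpos⟩, rfl⟩
    simp only [Set.ofPred_forall]
    exact isOpen_iInter_of_finite fun e => isOpen_iInter_of_finite fun _ =>
      isOpen_lt continuous_const ((continuous_apply e).comp continuous_subtype_val)

end LabelledRibbonGraph

/-! ### Bases of the edge lattice -/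

namespace VectorPartition

variable {E : Type*} [Fintype E] {n : ℕ} {a : E → Fin n → ℤ}

theorem mem_lattice_of_mem {B : Finset E} {e : E} (he : e ∈ B) : a e ∈ lattice a B := by
  classical
  exact ⟨Pi.single e 1, fun e' he' => Pi.single_eq_of_ne (fun h : e' = e => he' (h ▸ he)) _,
    by simp [Pi.single_apply, ite_smul]⟩

theorem lattice_le {B : Finset E} {L : AddSubgroup (Fin n → ℤ)} (h : ∀ e ∈ B, a e ∈ L) :
    lattice a B ≤ L := by
  rintro _ ⟨m, hm, rfl⟩
  refine sum_mem fun e _ => ?_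
  by_cases he : e ∈ B
  · exact zsmul_mem (h e he) _
  · rw [hm e he, zero_smul]
    exact zero_mem _

/-- The edges of a linearly independent subfamily can be exchanged so that it generates the
lattice of the whole family. -/
theorem IsEdgeFamily.exists_indep_lattice_eq (ha : IsEdgeFamily a) :
    ∃ B, Indep a B ∧ lattice a Finset.univ ≤ lattice a B := by
  classical
  have hne : {B : Finset E | Indep a B}.Nonempty :=
    ⟨∅, fun w hw _ => funext fun e => hw e (by simp)⟩
  -- `B` has maximal lattice for inclusion. A vector a c outside this lattice is contradicted by an
  -- independent family containing `c` with a lattice at least as large.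
  obtain ⟨B, hB, hmax⟩ := (Set.toFinite {B : Finset E | Indep a B}).exists_maximalFor
    (lattice a) _ hne
  have hB : Indep a B := hB
  refine ⟨B, hB, lattice_le fun c _ => ?_⟩
  by_contra hc
  suffices ∃ B', Indep a B' ∧ c ∈ B' ∧ lattice a B ≤ lattice a B' by
    obtain ⟨B', hB', hcB', hle⟩ := this
    exact hc (hmax hB' hle (mem_lattice_of_mem hcB'))
  have hcB : c ∉ B := fun h => hc (mem_lattice_of_mem h)
  by_cases hdep : Indep a (insert c B)
  · exact ⟨_, hdep, by simp, lattice_mono (Finset.subset_insert c B)⟩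
  · obtain ⟨z, hz, hzc⟩ := exists_isCircuit hB hdep
    obtain ⟨m, hm, hmc⟩ : (2 : ℤ) • a c ∈ lattice a B := by
      refine ha.twoSaturated B (a c) (Pi.single c 1 - z) hB (fun e he => ?_) ?_
      · by_cases hec : e = c
        · subst hec; simp [hzc]
        · simp [hec, hz.supp e (by simp [hec, he])]
      · rw [map_sub, hz.comb_eq, comb_single, one_smul, sub_zero]
    have hmR : comb a (fun e => (m e : ℝ)) = (2 : ℝ) • castVec (a c) := by
      rw [comb_intCast, hmc, castVec_zsmul, Int.cast_ofNat]
    have hmsupp : SuppOn B fun e => (m e : ℝ) := fun e he => by simp [hm e he]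
    -- If all coefficients of 2 • a c were even, halving them would put a c in the lattice.
    obtain ⟨i, hi⟩ : ∃ i, ¬ Even (m i) := by
      by_contra! h
      choose k hk using h
      refine hc ⟨k, fun e he => ?_, ?_⟩
      · have := hk e
        rw [hm e he] at this
        omega
      · have h1 : (2 : ℤ) • ∑ e, k e • a e = (2 : ℤ) • a c := by
          rw [← hmc, Finset.smul_sum]
          refine Finset.sum_congr rfl fun e _ => ?_
          rw [smul_smul, hk e, two_mul]
        ext j
        have := congrFun h1 j
        simpa using this
    have hiB : i ∈ B := by
      by_contra h
      exact hi (by simp [hm i h])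
    have hic : i ≠ c := fun h => hcB (h ▸ hiB)
    have hm1 : m i = 1 ∨ m i = -1 := by
      obtain ⟨I, J, hIJ, h0, h⟩ := ha.exists_wallForm_coord hB hiB
      have h1 := h _ hmsupp
      rw [hmR, ← wallLin_apply, map_smul, wallLin_apply, smul_eq_mul] at h1
      have hmi : (m i : ℝ) ≠ 0 := fun h => hi (by
        rw [Int.cast_eq_zero] at h
        simp [h])
      have h0' : wallForm I J (castVec (a c)) ≠ 0 := fun h' => by
        rw [h', mul_zero] at h1
        exact mul_ne_zero hmi h0 h1.symm
      obtain ⟨k, hk⟩ := ha.exists_two_eq hIJ h0'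
      -- Applying the wall form of the coordinate `i` gives m_i f(a_i) = 2 f(a_c), and f(a_c)
      -- divides 2, so m_i divides 4. Being odd it is ±1, which allows `i` to be exchanged for `c`.
      have hdvd : m i ∣ 4 := by
        refine ⟨k * (∑ j ∈ I, a i j - ∑ j ∈ J, a i j), ?_⟩
        have : (4 : ℝ) = m i * (k * wallForm I J (castVec (a i))) := by
          linear_combination 2 * hk + k * h1
        rw [wallForm_castVec] at this
        exact_mod_cast this
      have h2 : (m i).natAbs ∣ 4 := by
        have := Int.natAbs_dvd_natAbs.mpr hdvd
        simpa using this
      have h3 : (m i).natAbs ≤ 4 := Nat.le_of_dvd (by norm_num) h2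
      rw [← Int.natAbs_even] at hi
      interval_cases h4 : (m i).natAbs
      · simp at h2
      · exact Int.natAbs_eq_iff.mp h4
      · exact absurd (by decide) hi
      · norm_num at h2
      · exact absurd (by decide) hi
    refine ⟨insert c (B.erase i), fun w hw hw0 => ?_, by simp, lattice_le fun e he => ?_⟩
    · have hy := hB (w - Pi.single c (w c) + (w c / 2) • fun e => (m e : ℝ)) (fun e he => ?_) ?_
      · have h1 := congrFun hy i
        have h2 : w i = 0 := hw i (by simp [hic])
        have h3 : (m i : ℝ) ≠ 0 := by rcases hm1 with h | h <;> simp [h]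
        have h4 : w c = 0 := by simpa [h2, hic, h3] using h1
        refine hB w (fun e he => ?_) hw0
        by_cases hec : e = c
        · rw [hec, h4]
        · exact hw e (by simp [hec, he])
      · by_cases hec : e = c
        · subst hec; simp [hm e he]
        · simp [hec, hm e he, hw e (by simp [hec, he])]
      · rw [map_add, map_sub, hw0, comb_single, map_smul, hmR, smul_smul]
        simp
    · by_cases hei : e = i
      · subst hei
        have h1 : m e • a e = (2 : ℤ) • a c - ∑ j ∈ Finset.univ.erase e, m j • a j := by
          rw [← hmc, ← Finset.add_sum_erase _ _ (Finset.mem_univ e), add_sub_cancel_right]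
        have h2 : m e • a e ∈ lattice a (insert c (B.erase e)) := by
          rw [h1]
          refine sub_mem (zsmul_mem (mem_lattice_of_mem (by simp)) _)
            (sum_mem fun j hj => ?_)
          by_cases hjB : j ∈ B
          · exact zsmul_mem (mem_lattice_of_mem (by
              simp [hjB, Finset.ne_of_mem_erase hj])) _
          · rw [hm j hjB, zero_smul]
            exact zero_mem _
        rcases hm1 with h | h <;> simpa [h] using h2
      · exact mem_lattice_of_mem (by simp [hei, he])

theorem Indep.card_eq {B : Finset E} (hB : Indep a B)
    (hspan : ∀ i, (2 : ℤ) • Pi.single i 1 ∈ lattice a B) : B.card = n := by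
  classical
  have hext : ∀ w : E → ℝ, SuppOn B w → comb a w = ∑ e : B, w e • castVec (a e) := by
    intro w hw
    rw [comb_apply, Finset.sum_coe_sort B fun e => w e • castVec (a e)]
    refine (Finset.sum_subset (Finset.subset_univ B) fun e _ he => ?_).symm
    rw [hw e he, zero_smul]
  have hli : LinearIndependent ℝ fun e : B => castVec (a e) := by
    rw [Fintype.linearIndependent_iff]
    intro g hg i
    have h1 : SuppOn B fun e => if h : e ∈ B then g ⟨e, h⟩ else 0 := fun e he => by simp [he]
    have := congrFun (hB _ h1 ((hext _ h1).trans ?_)) i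
    · simpa using this
    · simpa using hg
  have hsp : ⊤ ≤ Submodule.span ℝ (Set.range fun e : B => castVec (a e)) := by
    rw [← (Pi.basisFun ℝ (Fin n)).span_eq, Submodule.span_le]
    rintro _ ⟨i, rfl⟩
    obtain ⟨m, hm, hmi⟩ := hspan i
    have h1 : castVec (Pi.single i 1) = (2 : ℝ)⁻¹ • comb a (fun e => (m e : ℝ)) := by
      rw [comb_intCast, hmi, castVec_zsmul]
      simp
    have h2 : Pi.basisFun ℝ (Fin n) i = castVec (Pi.single i 1) := by
      ext j
      simp [Pi.single_apply]
    rw [h2, h1, hext _ fun e he => by simp [hm e he]]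
    exact Submodule.smul_mem _ _ (Submodule.sum_mem _ fun e _ =>
      Submodule.smul_mem _ _ (Submodule.subset_span ⟨e, rfl⟩))
  simpa using (Module.finrank_eq_card_basis (Module.Basis.mk hli hsp)).symm

end VectorPartition

/-! ### Lattice points in the polytope of a non-bipartite graph -/

namespace LabelledRibbonGraph

open VectorPartition

variable {n : ℕ} {H : Type*} [Fintype H] {G : LabelledRibbonGraph n H}

omit [Fintype H] in
theorem sum_inc (e : G.Edge) : ∑ i, G.inc e i = 2 := by
  simp [inc, edgeVec, Finset.sum_add_distrib]

theorem even_sum_of_mem_lattice {B : Finset G.Edge} {x : Fin n → ℤ} (hx : x ∈ lattice G.inc B) :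
    Even (∑ i, x i) := by
  obtain ⟨m, -, rfl⟩ := hx
  simp only [Finset.sum_apply, Pi.smul_apply, smul_eq_mul]
  rw [Finset.sum_comm]
  simp only [← Finset.mul_sum, sum_inc]
  exact Finset.even_sum _ fun e _ => even_two.mul_left _

/-- Modulo the edge lattice every basis vector equals ±r for one fixed `r`, because the sign flips
along each edge. If 2 • r were not in the lattice, these signs would be a proper two-colouring. A
vector with even sum reduces to an even multiple of `r`. -/
theorem mem_lattice_univ (hc : G.Connected) (hv : G.VertexLabelled) (hb : ¬ G.Bipartite)
    {x : Fin n → ℤ} (hx : Even (∑ i, x i)) : x ∈ lattice G.inc Finset.univ := by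
  obtain ⟨h₀⟩ := hc.1
  set Λ := lattice G.inc Finset.univ with hΛ
  set r : Fin n → ℤ := Pi.single (G.label h₀) 1 with hr
  have hedge : ∀ h, Pi.single (G.label h) 1 + Pi.single (G.label (G.opp h)) 1 ∈ Λ := fun h => by
    rw [← inc_edgeOf]
    exact mem_lattice_of_mem (Finset.mem_univ _)
  have hε : ∀ i, ∃ ε : ℤ, (ε = 1 ∨ ε = -1) ∧ Pi.single i 1 - ε • r ∈ Λ := by
    intro i
    obtain ⟨h, rfl⟩ := hv.1 i
    have step : ∀ h, (∃ ε : ℤ, (ε = 1 ∨ ε = -1) ∧ Pi.single (G.label h) 1 - ε • r ∈ Λ) →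
        ∃ ε : ℤ, (ε = 1 ∨ ε = -1) ∧ Pi.single (G.label (G.opp h)) 1 - ε • r ∈ Λ := by
      rintro h ⟨ε, hε, hmem⟩
      refine ⟨-ε, by omega, ?_⟩
      convert sub_mem (hedge h) hmem using 1
      rw [neg_smul]
      abel
    refine hc.induction (P := fun h => ∃ ε : ℤ, (ε = 1 ∨ ε = -1) ∧
      Pi.single (G.label h) 1 - ε • r ∈ Λ) (fun h => by rw [hv.label_next])
      (fun h => ⟨step h, fun H => by simpa [G.opp_opp] using step _ H⟩)
      (h₀ := h₀) ⟨1, Or.inl rfl, ?_⟩ h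
    rw [one_smul, sub_self]
    exact zero_mem _
  choose ε hε hmem using hε
  have h2r : (2 : ℤ) • r ∈ Λ := by
    by_contra h2r
    refine hb ⟨fun i => decide (ε i = 1), fun h => ?_⟩
    rw [ne_eq, decide_eq_decide]
    intro hiff
    have heq : ε (G.label h) = ε (G.label (G.opp h)) := by
      rcases hε (G.label h) with h1 | h1 <;> rcases hε (G.label (G.opp h)) with h2 | h2 <;> omega
    have h1 := sub_mem (sub_mem (hedge h) (hmem (G.label h))) (hmem (G.label (G.opp h)))
    have h3 : Pi.single (G.label h) 1 + Pi.single (G.label (G.opp h)) 1 -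
        (Pi.single (G.label h) 1 - ε (G.label h) • r) -
        (Pi.single (G.label (G.opp h)) 1 - ε (G.label (G.opp h)) • r) =
        ε (G.label (G.opp h)) • (2 : ℤ) • r := by
      rw [heq, smul_comm, two_smul]
      abel
    rw [h3] at h1
    rcases hε (G.label (G.opp h)) with h4 | h4
    · exact h2r (by simpa [h4] using h1)
    · exact h2r (by simpa [h4] using h1)
  have hdec : x = ∑ i, x i • (Pi.single i 1 - ε i • r) + (∑ i, x i * ε i) • r := by
    simp only [smul_sub, Finset.sum_sub_distrib, Finset.sum_smul, smul_smul, sub_add_cancel]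
    ext j
    simp [Finset.sum_apply, Pi.single_apply]
  have heven : Even (∑ i, x i * ε i) := by
    have : ∑ i, x i * ε i = ∑ i, x i - ∑ i, x i * (1 - ε i) := by
      rw [← Finset.sum_sub_distrib]
      exact Finset.sum_congr rfl fun i _ => by ring
    rw [this]
    refine hx.sub (Finset.even_sum _ fun i _ => Even.mul_left ?_ _)
    rcases hε i with h | h <;> rw [h] <;> decide
  obtain ⟨k, hk⟩ := heven
  rw [hdec, hk, ← two_mul, mul_comm, ← smul_smul]
  exact add_mem (sum_mem fun i _ => zsmul_mem (hmem i) _) (zsmul_mem h2r _)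

/-- Some edges form a basis of the lattice of integral vectors with even sum. -/
theorem exists_lattice_basis (hc : G.Connected) (hv : G.VertexLabelled) (hb : ¬ G.Bipartite) :
    ∃ B : Finset G.Edge, Indep G.inc B ∧ B.card = n ∧
      ∀ x, x ∈ lattice G.inc B ↔ Even (∑ i, x i) := by
  obtain ⟨B, hB, hle⟩ := G.isEdgeFamily_inc.exists_indep_lattice_eq
  have hiff : ∀ x, x ∈ lattice G.inc B ↔ Even (∑ i, x i) := fun x =>
    ⟨even_sum_of_mem_lattice, fun hx => hle (mem_lattice_univ hc hv hb hx)⟩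
  refine ⟨B, hB, hB.card_eq fun i => (hiff _).mpr ?_, hiff⟩
  simp [← Finset.mul_sum]

/-- Normalizing the signs of the static weights, which are constant on the cell, identifies the
interior count with a vector partition function. -/
theorem interiorCount_isPolyFun (hc : G.Connected) (hv : G.VertexLabelled) (hb : ¬ G.Bipartite)
    {C : Set (Fin n → ℝ)} (hC : IsCell C) (r : Fin n → ℤ) :
    n ≤ Fintype.card G.Edge ∧ ∃ p : (Fin n → ℝ) → ℝ, IsPolyFun (Fintype.card G.Edge - n) p ∧
      ∀ b ∈ cosetPoints C r, (G.interiorCount (castVec b) : ℝ) = p (castVec b) := by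
  classical
  obtain ⟨B, hB, hBn, -⟩ := exists_lattice_basis hc hv hb
  have hnE : n ≤ Fintype.card G.Edge := hBn.symm.trans_le (Finset.card_le_univ B)
  refine ⟨hnE, ?_⟩
  obtain ⟨b₀, rfl⟩ := id hC
  set C := {b : Fin n → ℝ | ∀ I J : Finset (Fin n), Disjoint I J →
    SignType.sign (wallForm I J b) = SignType.sign (wallForm I J b₀)} with hCdef
  have hb₀ : b₀ ∈ C := fun _ _ _ => rfl
  -- linear forms giving the static weights
  have hφ : ∀ e : G.Edge, ∃ φ : (Fin n → ℝ) →ₗ[ℝ] ℝ,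
      (¬ G.IsStatic e → φ = 0) ∧
      (G.IsStatic e → ∀ w, φ (G.perimeters w) = w e) ∧
      ∀ b ∈ C, SignType.sign (φ b) = SignType.sign (φ b₀) := by
    intro e
    by_cases he : G.IsStatic e
    · obtain ⟨I, J, κ, hIJ, h⟩ := staticWeight_eq_wallForm he
      have h' : ∀ b, (κ⁻¹ • wallLin I J) b = G.staticWeight he b := fun b => by
        rw [h, LinearMap.smul_apply, wallLin_apply, smul_eq_mul, inv_mul_eq_div]
      refine ⟨κ⁻¹ • wallLin I J, fun h => absurd he h, fun _ w => ?_, fun b hb => ?_⟩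
      · rw [h', staticWeight_perimeters hc hv hb]
      · simp only [LinearMap.smul_apply, wallLin_apply, smul_eq_mul, sign_mul, hb I J hIJ]
    · exact ⟨0, fun _ => rfl, fun h => absurd h he, fun _ _ => rfl⟩
  choose φ hφ0 hφw hφs using hφ
  set σ : G.Edge → ℤ := fun e => if φ e b₀ < 0 then -1 else 1 with hσ
  have hσ1 : ∀ e, σ e = 1 ∨ σ e = -1 := fun e => by
    simp only [hσ]
    split_ifs <;> simp
  have hσσ : ∀ e, σ e * σ e = 1 := fun e => by rcases hσ1 e with h | h <;> simp [h]
  set a : G.Edge → Fin n → ℤ := fun e => σ e • G.inc e with ha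
  have haR : ∀ e, castVec (a e) = (σ e : ℝ) • castVec (G.inc e) := fun e => castVec_zsmul _ _
  have hfam : IsEdgeFamily a := fun e =>
    ⟨σ e, G.label (Quotient.out e), G.label (G.opp (Quotient.out e)), hσ1 e, by
      simp only [ha, inc, edgeVec, one_smul]⟩
  have hcomb : ∀ w : G.Edge → ℝ, comb a w = comb G.inc fun e => σ e * w e := by
    intro w
    simp only [comb_apply, haR, smul_smul]
    exact Finset.sum_congr rfl fun e _ => by rw [mul_comm]
  have hBa : Indep a B := by
    intro w hw hw0
    rw [hcomb] at hw0
    have := hB _ (fun e he => by simp [hw e he]) hw0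
    ext e
    have h1 := congrFun this e
    have h2 : (σ e : ℝ) ≠ 0 := by rcases hσ1 e with h | h <;> simp [h]
    simpa [h2] using h1
  obtain ⟨l, hl⟩ : ∃ l : (Fin n → ℝ) →ₗ[ℝ] ℝ, ∀ e, 0 < l (castVec (a e)) := by
    -- The sum of coordinates is 2 on each incidence vector. Subtracting three times the static
    -- forms of the reversed edges makes it -1 on those vectors, so it is 1 on them after reversal.
    refine ⟨Fintype.linearCombination ℝ (fun _ => (1 : ℝ)) -
      (3 : ℝ) • ∑ e with φ e b₀ < 0, φ e, fun e => ?_⟩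
    have hval : ∀ e', φ e' b₀ < 0 → φ e' (castVec (G.inc e)) = if e' = e then 1 else 0 := by
      intro e' he'
      have hst : G.IsStatic e' := by
        by_contra h
        rw [hφ0 e' h, LinearMap.zero_apply] at he'
        exact he'.false
      have := hφw e' hst (Pi.single e 1)
      rw [perimeters_eq_comb, comb_single, one_smul] at this
      rw [this, Pi.single_apply]
    have h1 : (Fintype.linearCombination ℝ (fun _ : Fin n => (1 : ℝ))) (castVec (G.inc e)) = 2 := by
      have := sum_inc e
      simp only [Fintype.linearCombination_apply, castVec_apply, smul_eq_mul, mul_one]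
      exact_mod_cast this
    have h2 : ∑ e' with φ e' b₀ < 0, φ e' (castVec (G.inc e)) = if φ e b₀ < 0 then 1 else 0 := by
      rw [Finset.sum_congr rfl fun e' he' => hval e' (Finset.mem_filter.mp he').2]
      simp
    rw [haR, map_smul, LinearMap.sub_apply, h1, LinearMap.smul_apply, LinearMap.sum_apply, h2]
    simp only [hσ]
    split_ifs <;> norm_num
  -- Static edges of weight zero are omitted, since partitions require positive coefficients.
  set T : Finset G.Edge := Finset.univ.filter fun e => ¬ (G.IsStatic e ∧ φ e b₀ = 0) with hT
  have hspan := partitionCount_mem_span hl hfam.twoSaturated (T₀ := B ∩ T) (T₁ := T \ B)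
    (hBa.mono Finset.inter_subset_left)
    (Finset.disjoint_of_subset_left Finset.inter_subset_left Finset.disjoint_sdiff)
  rw [Finset.inter_comm, Finset.union_comm, Finset.sdiff_union_inter] at hspan
  obtain ⟨p, hp, hpT⟩ := hC.exists_isPolyFun hfam hspan r
  refine ⟨p, hp.mono ?_, fun b hb => ?_⟩
  -- The basis part B ∩ T costs no degree, and T \ B has at most |E| - n edges.
  · have h1 := Finset.card_le_card (Finset.sdiff_subset_sdiff (Finset.subset_univ T)
      (subset_refl B))
    rwa [Finset.card_sdiff_of_subset (Finset.subset_univ B), hBn, Finset.card_univ] at h1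
  · rw [← hpT b hb]
    congr 1
    have hsum : ∀ w : G.Edge → ℤ, ∑ e, w e • a e = b ↔
        G.perimeters (fun e => ((σ e * w e : ℤ) : ℝ)) = castVec b := by
      intro w
      rw [perimeters_eq_comb, comb_intCast]
      have : ∑ e, (σ e * w e) • G.inc e = ∑ e, w e • a e :=
        Finset.sum_congr rfl fun e _ => by rw [ha, smul_smul, mul_comm]
      rw [this]
      refine ⟨fun h => by rw [h], fun h => ?_⟩
      ext i
      have := congrFun h i
      simp only [castVec_apply] at this
      exact_mod_cast this
    have hinj : Function.Injective fun (w : G.Edge → ℤ) e => σ e * w e := by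
      intro w w' h
      ext e
      have := congrArg (fun x => σ e * x) (congrFun h e)
      simpa [← mul_assoc, hσσ] using this
    refine Eq.trans (congrArg Set.ncard ?_) (Set.ncard_image_of_injective _ hinj)
    ext m
    simp only [Set.mem_ofPred_eq, mem_relInterior_iff, Set.mem_image]
    constructor
    · rintro ⟨hm, hpos⟩
      have hmφ : ∀ e, G.IsStatic e → (m e : ℝ) = φ e (castVec b) := fun e he => by
        rw [← hm, hφw e he]
      refine ⟨fun e => σ e * m e, ⟨fun e he => ?_, fun e he => ?_, ?_⟩, ?_⟩
      · simp only [hT, Finset.mem_filter, Finset.mem_univ, true_and, not_not] at he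
        have h1 := hφs e _ hb.1
        rw [he.2, sign_zero, sign_eq_zero_iff] at h1
        have h2 := (hmφ e he.1).trans h1
        rw [Int.cast_eq_zero] at h2
        simp [h2]
      · simp only [hT, Finset.mem_filter, Finset.mem_univ, true_and, not_and] at he
        by_cases hst : G.IsStatic e
        · have h1 := hφs e _ hb.1
          have h2 := hmφ e hst
          change SignType.sign (φ e (castVec b)) = _ at h1
          rw [← h2] at h1
          simp only [hσ]
          split_ifs with h3
          · rw [sign_neg h3, sign_eq_neg_one_iff, Int.cast_lt_zero] at h1
            linarith
          · rw [sign_pos (lt_of_le_of_ne (not_lt.mp h3) (Ne.symm (he hst))), sign_eq_one_iff,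
              Int.cast_pos] at h1
            linarith
        · have h1 := hpos e hst
          rw [Int.cast_pos] at h1
          simp only [hσ, hφ0 e hst, LinearMap.zero_apply, lt_irrefl, if_false, one_mul]
          exact h1
      · rw [hsum]
        simp only [← mul_assoc, hσσ, one_mul]
        exact hm
      · ext e
        simp only [← mul_assoc, hσσ, one_mul]
    · rintro ⟨w, ⟨hw, hpos, hwb⟩, rfl⟩
      refine ⟨(hsum w).mp hwb, fun e he => ?_⟩
      have h1 : σ e = 1 := by simp [hσ, hφ0 e he]
      beta_reduce
      rw [h1, one_mul, Int.cast_pos]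
      exact hpos e (by simp [hT, he])

end LabelledRibbonGraph

/-! ### Volumes of the polytopes: continuity -/

open MeasureTheory Filter Topology

namespace VectorPartition

variable {E : Type*} [Fintype E] {n : ℕ}

open Classical in
/-- The vector obtained from `x` by setting the coordinates in `B` to zero. -/
noncomputable def cut (B : Finset E) : (E → ℝ) →ₗ[ℝ] (E → ℝ) :=
  LinearMap.pi fun e => if e ∈ B then 0 else LinearMap.proj e

omit [Fintype E] in
theorem cut_of_mem {B : Finset E} {e : E} (he : e ∈ B) (x : E → ℝ) : cut B x e = 0 := by
  simp [cut, he]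

omit [Fintype E] in
theorem cut_of_notMem {B : Finset E} {e : E} (he : e ∉ B) (x : E → ℝ) : cut B x e = x e := by
  simp [cut, he]

/-- A basis `B` of the lattice of vectors with even sum, consisting of members of the family `a`,
with the corresponding section `sec` of `comb a`, and a bound on the polytopes of weights which are
non-negative on `N`. -/
structure LatticeSection (a : E → Fin n → ℤ) (N : Set E) where
  B : Finset E
  indep : Indep a B
  card_eq : B.card = n
  mem_lattice : ∀ x, x ∈ lattice a B ↔ Even (∑ i, x i)
  even_sum : ∀ e, Even (∑ i, a e i)
  sec : (Fin n → ℝ) →ₗ[ℝ] (E → ℝ)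
  sec_supp : ∀ b, SuppOn B (sec b)
  comb_sec : ∀ b, comb a (sec b) = b
  exists_relation : ∀ e ∈ N, ∃ z, comb a z = 0 ∧ z e = 1
  bound : (Fin n → ℝ) → ℝ
  continuous_bound : Continuous bound
  abs_le : ∀ w, (∀ e ∈ N, 0 ≤ w e) → ∀ e, |w e| ≤ bound (comb a w)

namespace LatticeSection

variable {a : E → Fin n → ℤ} {N : Set E} (D : LatticeSection a N)

theorem sec_comb {w : E → ℝ} (hw : SuppOn D.B w) : D.sec (comb a w) = w :=
  sub_eq_zero.mp (D.indep _ (fun e he => by simp [hw e he, D.sec_supp _ e he])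
    (by rw [map_sub, D.comb_sec, sub_self]))

/-- The point of the kernel of `comb a` with the same coordinates as `x` outside of `B`. -/
noncomputable def proj : (E → ℝ) →ₗ[ℝ] (E → ℝ) :=
  cut D.B - D.sec ∘ₗ comb a ∘ₗ cut D.B

theorem proj_apply (x : E → ℝ) : D.proj x = cut D.B x - D.sec (comb a (cut D.B x)) := rfl

theorem comb_proj (x : E → ℝ) : comb a (D.proj x) = 0 := by
  rw [proj_apply, map_sub, D.comb_sec, sub_self]

theorem proj_of_notMem {e : E} (he : e ∉ D.B) (x : E → ℝ) : D.proj x e = x e := by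
  simp [proj_apply, cut_of_notMem he, D.sec_supp _ e he]

theorem proj_congr {x y : E → ℝ} (h : ∀ e ∉ D.B, x e = y e) : D.proj x = D.proj y := by
  have : cut D.B x = cut D.B y := by
    ext e
    by_cases he : e ∈ D.B
    · rw [cut_of_mem he, cut_of_mem he]
    · rw [cut_of_notMem he, cut_of_notMem he, h e he]
  rw [proj_apply, proj_apply, this]

theorem sec_add_proj (w : E → ℝ) : D.sec (comb a w) + D.proj w = w := by
  have h := D.sec_comb (w := w - cut D.B w) fun e he => by simp [cut_of_notMem he]
  rw [map_sub, map_sub, sub_eq_sub_iff_add_eq_add] at h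
  rw [proj_apply, add_sub, h, add_sub_cancel_right]

theorem comb_sec_add_proj (b : Fin n → ℝ) (x : E → ℝ) : comb a (D.sec b + D.proj x) = b := by
  rw [map_add, D.comb_sec, D.comb_proj, add_zero]

theorem exists_proj_ne {e : E} (he : e ∈ N) : ∃ z, D.proj z e ≠ 0 := by
  obtain ⟨z, hz, hze⟩ := D.exists_relation e he
  refine ⟨z, ?_⟩
  have := D.sec_add_proj z
  rw [hz, map_zero, zero_add] at this
  rw [this, hze]
  exact one_ne_zero

/-- The product of the projection of the polytope along the coordinates in `B` with a
half-open unit cube. -/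
def body (b : Fin n → ℝ) : Set (E → ℝ) :=
  {x | (∀ e ∈ N, 0 ≤ (D.sec b + D.proj x) e) ∧ ∀ e ∈ D.B, 0 ≤ x e ∧ x e < 1}

/-- The variant of `body` with strict inequalities. -/
def openBody (b : Fin n → ℝ) : Set (E → ℝ) :=
  {x | (∀ e ∈ N, 0 < (D.sec b + D.proj x) e) ∧ ∀ e ∈ D.B, 0 ≤ x e ∧ x e < 1}

theorem openBody_subset (b : Fin n → ℝ) : D.openBody b ⊆ D.body b :=
  fun _ hx => ⟨fun e he => (hx.1 e he).le, hx.2⟩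

theorem _root_.MeasureTheory.volume_levelSet_eq_zero {f : (E → ℝ) →ₗ[ℝ] ℝ} {z : E → ℝ}
    (hz : f z ≠ 0) (c : ℝ) : volume {x | f x = c} = 0 := by
  rcases Set.eq_empty_or_nonempty {x | f x = c} with h | ⟨x₀, hx₀⟩
  · rw [h, measure_empty]
  · have h1 : {x | f x = c} = (AffineSubspace.mk' x₀ (LinearMap.ker f) : Set (E → ℝ)) := by
      ext x
      have hx₀ : f x₀ = c := hx₀
      simp [AffineSubspace.mem_mk', hx₀, sub_eq_zero]
    rw [h1]
    refine Measure.addHaar_affineSubspace _ _ fun h => hz ?_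
    have := congrArg AffineSubspace.direction h
    rw [AffineSubspace.direction_mk', AffineSubspace.direction_top] at this
    rw [← LinearMap.mem_ker, this]
    trivial

theorem volume_wall_eq_zero {e : E} (he : e ∈ N) (b : Fin n → ℝ) :
    volume {x | (D.sec b + D.proj x) e = 0} = 0 := by
  obtain ⟨z, hz⟩ := D.exists_proj_ne he
  rw [← volume_levelSet_eq_zero (f := LinearMap.proj e ∘ₗ D.proj) (z := z) hz (-D.sec b e)]
  congr 1
  ext x
  simp only [Set.mem_ofPred_eq, Pi.add_apply, LinearMap.comp_apply, LinearMap.proj_apply]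
  constructor <;> intro h <;> linarith

/-- On fibres no coordinate in `N` is constant, so each wall is a proper affine hyperplane or empty.
Strict and weak inequalities therefore give the same volume. -/
theorem ae_ne_zero (b : Fin n → ℝ) : ∀ᵐ x, ∀ e ∈ N, (D.sec b + D.proj x) e ≠ 0 := by
  rw [ae_all_iff]
  intro e
  by_cases he : e ∈ N
  · have := D.volume_wall_eq_zero he b
    filter_upwards [measure_eq_zero_iff_ae_notMem.mp this] with x hx _ h0
    exact hx h0
  · exact Filter.Eventually.of_forall fun x h => absurd h he

theorem volume_openBody (b : Fin n → ℝ) : volume (D.openBody b) = volume (D.body b) := by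
  refine measure_congr ?_
  filter_upwards [D.ae_ne_zero b] with x hx
  refine propext ⟨fun h => D.openBody_subset b h, fun h => ⟨fun e he => ?_, h.2⟩⟩
  exact lt_of_le_of_ne (h.1 e he) (hx e he).symm

theorem continuous_coord (b : Fin n → ℝ) (e : E) :
    Continuous fun x => (D.sec b + D.proj x) e :=
  (continuous_apply e).comp
    (continuous_const.add (LinearMap.continuous_of_finiteDimensional D.proj))

theorem measurableSet_cube : MeasurableSet {x : E → ℝ | ∀ e ∈ D.B, 0 ≤ x e ∧ x e < 1} := by
  simp only [Set.ofPred_forall]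
  exact MeasurableSet.iInter fun e => MeasurableSet.iInter fun _ =>
    (measurableSet_le measurable_const (measurable_pi_apply e)).inter
      (measurableSet_lt (measurable_pi_apply e) measurable_const)

theorem measurableSet_body (b : Fin n → ℝ) : MeasurableSet (D.body b) := by
  refine MeasurableSet.inter (s₁ := {x | ∀ e ∈ N, 0 ≤ (D.sec b + D.proj x) e}) ?_
    D.measurableSet_cube
  simp only [Set.ofPred_forall]
  exact MeasurableSet.iInter fun e => MeasurableSet.iInter fun _ =>
    measurableSet_le measurable_const (D.continuous_coord b e).measurable

theorem measurableSet_openBody (b : Fin n → ℝ) : MeasurableSet (D.openBody b) := by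
  refine MeasurableSet.inter (s₁ := {x | ∀ e ∈ N, 0 < (D.sec b + D.proj x) e}) ?_
    D.measurableSet_cube
  simp only [Set.ofPred_forall]
  exact MeasurableSet.iInter fun e => MeasurableSet.iInter fun _ =>
    measurableSet_lt measurable_const (D.continuous_coord b e).measurable

theorem convex_openBody (b : Fin n → ℝ) : Convex ℝ (D.openBody b) := by
  intro x hx y hy s t hs ht hst
  refine ⟨fun e he => ?_, fun e he => ?_⟩
  · have h1 := hx.1 e he
    have h2 := hy.1 e he
    simp only [Pi.add_apply, map_add, map_smul, Pi.smul_apply, smul_eq_mul] at h1 h2 ⊢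
    have h3 : D.sec b e + (s * D.proj x e + t * D.proj y e) =
        s * (D.sec b e + D.proj x e) + t * (D.sec b e + D.proj y e) := by
      linear_combination -(D.sec b e) * hst
    rw [h3]
    rcases hs.eq_or_lt with rfl | hs
    · rw [show t = 1 by linarith]
      simpa using h2
    · have := mul_pos hs h1
      have := mul_nonneg ht h2.le
      linarith
  · obtain ⟨h1, h2⟩ := hx.2 e he
    obtain ⟨h3, h4⟩ := hy.2 e he
    simp only [Pi.add_apply, Pi.smul_apply, smul_eq_mul]
    refine ⟨by positivity, ?_⟩
    rcases hs.eq_or_lt with rfl | hs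
    · rw [show t = 1 by linarith]
      simpa using h4
    · have := mul_lt_mul_of_pos_left h2 hs
      have := mul_le_mul_of_nonneg_left h4.le ht
      linarith

theorem body_subset_Icc (b : Fin n → ℝ) :
    D.body b ⊆ Set.Icc (fun _ => -(D.bound b + 1)) (fun _ => D.bound b + 1) := by
  intro x hx
  have h := D.abs_le _ hx.1
  rw [D.comb_sec_add_proj] at h
  rw [← Set.pi_univ_Icc]
  intro e _
  have h0 : 0 ≤ D.bound b := (abs_nonneg _).trans (h e)
  rw [Set.mem_Icc, ← _root_.abs_le]
  by_cases he : e ∈ D.B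
  · obtain ⟨h1, h2⟩ := hx.2 e he
    rw [abs_of_nonneg h1]
    linarith
  · have := h e
    rw [Pi.add_apply, D.sec_supp b e he, zero_add, D.proj_of_notMem he] at this
    linarith

theorem isBounded_openBody (b : Fin n → ℝ) : Bornology.IsBounded (D.openBody b) :=
  (Metric.isBounded_Icc _ _).subset ((D.openBody_subset b).trans (D.body_subset_Icc b))

theorem volume_body_ne_top (b : Fin n → ℝ) : volume (D.body b) ≠ ⊤ :=
  ((measure_mono (D.body_subset_Icc b)).trans_lt measure_Icc_lt_top).ne

/-- For almost every x no inequality is an equality at b₀, so the indicator at x is locally constant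
in b. Near b₀ all the bodies lie in one box, which permits passing to the limit. -/
theorem continuous_volume_body : Continuous fun b => volume.real (D.body b) := by
  rw [continuous_iff_continuousAt]
  intro b₀
  refine (ENNReal.tendsto_toReal (D.volume_body_ne_top b₀)).comp ?_
  refine tendsto_measure_of_ae_tendsto_indicator (nhds b₀) (D.measurableSet_body b₀)
    (fun b => D.measurableSet_body b)
    (B := Set.Icc (fun _ => -(D.bound b₀ + 1 + 1)) (fun _ => D.bound b₀ + 1 + 1))
    measurableSet_Icc measure_Icc_lt_top.ne ?_ ?_
  · have : ∀ᶠ b in nhds b₀, D.bound b < D.bound b₀ + 1 :=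
      (D.continuous_bound.tendsto b₀).eventually_lt_const (by linarith)
    filter_upwards [this] with b hb
    refine (D.body_subset_Icc b).trans (Set.Icc_subset_Icc ?_ ?_)
    · intro e
      simp only
      linarith
    · intro e
      simp only
      linarith
  · filter_upwards [D.ae_ne_zero b₀] with x hx
    have hev : ∀ᶠ b in nhds b₀, ∀ e ∈ N,
        (0 ≤ (D.sec b + D.proj x) e ↔ 0 ≤ (D.sec b₀ + D.proj x) e) := by
      refine (Set.toFinite N).eventually_all.mpr fun e he => ?_
      have hcont : Continuous fun b => (D.sec b + D.proj x) e :=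
        (continuous_apply e).comp
          ((LinearMap.continuous_of_finiteDimensional D.sec).add continuous_const)
      rcases lt_or_gt_of_ne (hx e he) with h | h
      · filter_upwards [(hcont.tendsto b₀).eventually_lt_const h] with b hb
        exact iff_of_false hb.not_ge h.not_ge
      · filter_upwards [(hcont.tendsto b₀).eventually_const_lt h] with b hb
        exact iff_of_true hb.le h.le
    filter_upwards [hev] with b hb
    simp only [body, Set.mem_ofPred_eq]
    exact and_congr (forall₂_congr hb) Iff.rfl

end LatticeSection

end VectorPartition

/-! ### Homogeneity and asymptotic counting -/

namespace VectorPartition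

variable {E : Type*} [Fintype E] {n : ℕ}

namespace LatticeSection

open scoped Pointwise

variable {a : E → Fin n → ℤ} {N : Set E} (D : LatticeSection a N)

include D in
theorem card_compl : n ≤ Fintype.card E := by
  rw [← D.card_eq]
  exact Finset.card_le_univ _

open Classical in
-- Only the |E| - n coordinates outside `B` are rescaled; the unit cube in the coordinates of `B` is
-- left alone.
theorem volume_body_smul {τ : ℝ} (hτ : 0 < τ) (b : Fin n → ℝ) :
    volume.real (D.body (τ • b)) = τ ^ (Fintype.card E - n) * volume.real (D.body b) := by
  set c : E → ℝ := fun e => if e ∈ D.B then 1 else τ⁻¹ with hc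
  set F := Matrix.toLin' (Matrix.diagonal c) with hF
  have hFx : ∀ x e, F x e = c e * x e := fun x e => by
    rw [hF, Matrix.toLin'_apply, Matrix.mulVec_diagonal]
  have hdet : LinearMap.det F = τ⁻¹ ^ (Fintype.card E - n) := by
    rw [hF, LinearMap.det_toLin', Matrix.det_diagonal, hc, Finset.prod_ite, Finset.prod_const_one,
      one_mul, Finset.prod_const]
    congr 1
    rw [Finset.filter_not, Finset.filter_mem_eq_inter, Finset.univ_inter,
      Finset.card_sdiff_of_subset (Finset.subset_univ _), D.card_eq, Finset.card_univ]
  have hset : D.body (τ • b) = F ⁻¹' D.body b := by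
    ext x
    have h1 : D.proj x = τ • D.proj (F x) := by
      rw [← map_smul]
      refine D.proj_congr fun e he => ?_
      simp [hFx, hc, he, hτ.ne']
    refine and_congr (forall₂_congr fun e _ => ?_) (forall₂_congr fun e he => ?_)
    · rw [h1, map_smul, ← smul_add, Pi.smul_apply, smul_eq_mul, mul_nonneg_iff_of_pos_left hτ]
    · rw [hFx]
      simp [hc, he]
  have hdet0 : LinearMap.det F ≠ 0 := by
    rw [hdet]
    positivity
  rw [hset, measureReal_def, Measure.addHaar_preimage_linearMap _ hdet0, hdet, ENNReal.toReal_mul,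
    ENNReal.toReal_ofReal (abs_nonneg _), inv_pow, inv_inv, abs_of_nonneg (by positivity),
    measureReal_def]

/-- The number of integral weights with given vertex perimeters which are positive on `N`. -/
noncomputable def count (_ : LatticeSection a N) (c : Fin n → ℤ) : ℕ :=
  {m : E → ℤ | comb a (fun e => (m e : ℝ)) = castVec c ∧ ∀ e ∈ N, 0 < m e}.ncard

omit [Fintype E] in
theorem _root_.mem_inv_smul_span_basisFun [Finite E] {t : ℝ} (ht : t ≠ 0) (x : E → ℝ) :
    x ∈ t⁻¹ • (Submodule.span ℤ (Set.range (Pi.basisFun ℝ E)) : Set (E → ℝ)) ↔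
      ∃ k : E → ℤ, ∀ e, t * x e = k e := by
  rw [Set.mem_inv_smul_set_iff₀ ht, SetLike.mem_coe, Module.Basis.mem_span_iff_repr_mem]
  simp only [Pi.basisFun_repr, Pi.smul_apply, smul_eq_mul, Set.mem_range, algebraMap_int_eq,
    eq_intCast]
  rw [Classical.skolem]
  simp only [eq_comm]

/-- The coordinates outside `B` are free: the remaining perimeter vector has even sum, so it is an
integral combination of the basis. -/
theorem exists_int_lift {b : Fin n → ℤ} (hb : Even (∑ i, b i)) (k : E → ℤ) :
    ∃ m : E → ℤ, comb a (fun e => (m e : ℝ)) = castVec b ∧ ∀ e ∉ D.B, m e = k e := by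
  classical
  set k' : E → ℤ := fun e => if e ∈ D.B then 0 else k e
  have : b - ∑ e, k' e • a e ∈ lattice a D.B := by
    rw [D.mem_lattice]
    simp only [Pi.sub_apply, Finset.sum_sub_distrib]
    refine hb.sub ?_
    simp only [Finset.sum_apply, Pi.smul_apply, smul_eq_mul]
    rw [Finset.sum_comm]
    refine Finset.even_sum _ fun e _ => ?_
    rw [← Finset.mul_sum]
    exact (D.even_sum e).mul_left _
  obtain ⟨z, hz, hzb⟩ := this
  refine ⟨z + k', ?_, fun e he => by simp [hz e he, k', he]⟩
  rw [comb_intCast]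
  simp only [Pi.add_apply, add_smul, Finset.sum_add_distrib, hzb, sub_add_cancel]

/-- A point of the lattice of mesh 1/t in the open body amounts to an integral weight function with
perimeters t • b, which fixes the coordinates outside `B`, and a free choice of t values for each of
the n coordinates in `B`. -/
theorem card_openBody_inter {b : Fin n → ℤ} (hb : Even (∑ i, b i)) {t : ℕ} (ht : 0 < t) :
    Nat.card ↑(D.openBody (castVec b) ∩
      (t : ℝ)⁻¹ • (Submodule.span ℤ (Set.range (Pi.basisFun ℝ E)) : Set (E → ℝ))) =
      D.count (t • b) * t ^ n := by
  classical
  have ht' : (0 : ℝ) < t := Nat.cast_pos.mpr ht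
  have hcast : castVec (t • b) = (t : ℝ) • castVec b := by
    ext i
    simp
  set X := {m : E → ℤ | comb a (fun e => (m e : ℝ)) = castVec (t • b) ∧ ∀ e ∈ N, 0 < m e} with hX
  have key : ∀ (x : E → ℝ) (m : E → ℤ), comb a (fun e => (m e : ℝ)) = castVec (t • b) →
      (∀ e ∉ D.B, t * x e = m e) →
        ∀ e, (t : ℝ) * (D.sec (castVec b) + D.proj x) e = m e := by
    intro x m hm hx e
    have h1 := D.sec_add_proj fun e => (m e : ℝ)
    rw [hm, hcast, map_smul, ← D.proj_congr (x := (t : ℝ) • x) (by simpa using hx), map_smul,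
      ← smul_add] at h1
    exact congrFun h1 e
  let g : X × (D.B → Fin t) → E → ℝ := fun q e =>
    (if h : e ∈ D.B then (((q.2 ⟨e, h⟩ : ℕ) : ℤ) : ℝ) else q.1.1 e) / t
  have hg1 : ∀ q e (h : e ∈ D.B), t * g q e = (q.2 ⟨e, h⟩ : ℕ) := fun q e h => by
    simp only [g, h, dif_pos, Int.cast_natCast]
    field_simp
  have hg2 : ∀ q, ∀ e ∉ D.B, t * g q e = q.1.1 e := fun q e h => by
    simp only [g, h, dif_neg, not_false_eq_true]
    field_simp
  have hmem : ∀ q, g q ∈ D.openBody (castVec b) ∩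
      (t : ℝ)⁻¹ • (Submodule.span ℤ (Set.range (Pi.basisFun ℝ E)) : Set (E → ℝ)) := by
    intro q
    refine ⟨⟨fun e he => ?_, fun e he => ?_⟩, ?_⟩
    · rw [← mul_pos_iff_of_pos_left ht', key _ q.1.1 q.1.2.1 (hg2 q)]
      exact_mod_cast q.1.2.2 e he
    · have h1 := hg1 q e he
      have h2 : ((q.2 ⟨e, he⟩ : ℕ) : ℝ) < t := Nat.cast_lt.mpr (q.2 ⟨e, he⟩).2
      have h3 : (0 : ℝ) ≤ (q.2 ⟨e, he⟩ : ℕ) := Nat.cast_nonneg _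
      constructor
      · exact nonneg_of_mul_nonneg_right (h1 ▸ h3) ht'
      · exact lt_of_mul_lt_mul_left (by rw [h1, mul_one]; exact h2) ht'.le
    · rw [mem_inv_smul_span_basisFun ht'.ne']
      refine ⟨fun e => if h : e ∈ D.B then ((q.2 ⟨e, h⟩ : ℕ) : ℤ) else q.1.1 e, fun e => ?_⟩
      by_cases he : e ∈ D.B
      · simp [hg1 q e he, he]
      · simp [hg2 q e he, he]
  have hbij : Function.Bijective fun q => (⟨g q, hmem q⟩ : ↑(D.openBody (castVec b) ∩
      (t : ℝ)⁻¹ • (Submodule.span ℤ (Set.range (Pi.basisFun ℝ E)) : Set (E → ℝ)))) := by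
    constructor
    · intro q q' h
      have h : g q = g q' := congrArg Subtype.val h
      refine Prod.ext (Subtype.ext (funext fun e => ?_)) (funext fun e => ?_)
      · have h1 := key _ q.1.1 q.1.2.1 (hg2 q) e
        rw [h, key _ q'.1.1 q'.1.2.1 (hg2 q') e] at h1
        exact_mod_cast h1.symm
      · have h1 := hg1 q e e.2
        rw [h, hg1 q' e e.2] at h1
        exact Fin.ext (by exact_mod_cast h1.symm)
    · rintro ⟨x, hx, hx'⟩
      rw [mem_inv_smul_span_basisFun ht'.ne'] at hx'
      obtain ⟨k, hk⟩ := hx'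
      obtain ⟨m, hm, hmk⟩ := D.exists_int_lift (b := t • b)
        (by simpa [← Finset.mul_sum] using hb.mul_left (t : ℤ)) k
      have hk0 : ∀ e ∈ D.B, 0 ≤ k e ∧ k e < t := by
        intro e he
        obtain ⟨h1, h2⟩ := hx.2 e he
        constructor
        · exact_mod_cast hk e ▸ mul_nonneg ht'.le h1
        · have := hk e ▸ mul_lt_mul_of_pos_left h2 ht'
          rw [mul_one] at this
          exact_mod_cast this
      have hmX : m ∈ X := by
        refine ⟨hm, fun e he => ?_⟩
        have h1 := key x m hm (fun e he => by rw [hk, hmk e he]) e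
        have h2 := mul_pos ht' (hx.1 e he)
        rw [h1] at h2
        exact_mod_cast h2
      refine ⟨⟨⟨m, hmX⟩, fun e => ⟨(k e).toNat, ?_⟩⟩, Subtype.ext (funext fun e => ?_)⟩
      · have := hk0 e e.2
        omega
      · refine mul_left_cancel₀ ht'.ne' ?_
        by_cases he : e ∈ D.B
        · rw [hg1 _ e he, hk e]
          have := (hk0 e he).1
          simp only
          rw [← Int.cast_natCast, Int.toNat_of_nonneg this]
        · rw [hg2 _ e he, hk e, ← hmk e he]
  rw [← Nat.card_congr (Equiv.ofBijective _ hbij), Nat.card_prod, Nat.card_coe_set_eq]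
  congr 1
  rw [Nat.card_fun]
  simp [D.card_eq]

/-- The number of points of mesh 1/t in a bounded convex set, divided by t^|E|, tends to its volume.
The cube accounts for a factor t^n. -/
theorem tendsto_count {b : Fin n → ℤ} (hb : Even (∑ i, b i)) :
    Tendsto (fun t : ℕ => (D.count (t • b) : ℝ) / (t : ℝ) ^ (Fintype.card E - n)) atTop
      (𝓝 (volume.real (D.body (castVec b)))) := by
  have h := tendsto_card_div_pow_atTop_volume (D.openBody (castVec b))
    (D.isBounded_openBody _) (D.measurableSet_openBody _)
    ((D.convex_openBody _).addHaar_frontier volume)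
  rw [measureReal_def, D.volume_openBody, ← measureReal_def] at h
  refine h.congr' ?_
  filter_upwards [eventually_gt_atTop 0] with t ht
  have ht' : (t : ℝ) ≠ 0 := Nat.cast_ne_zero.mpr ht.ne'
  rw [D.card_openBody_inter hb ht, Nat.cast_mul, Nat.cast_pow,
    ← Nat.sub_add_cancel D.card_compl, pow_add, Nat.add_sub_cancel,
    mul_div_mul_right _ _ (pow_ne_zero _ ht')]

/-- The image is the lattice of vectors with even sum, of index 2. The determinant divides 2 because
a matrix of determinant 2 factors through `M`, and it is even because the rows of `M` sum to zero
mod 2. -/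
theorem _root_.Matrix.natAbs_det_eq_two {M : Matrix (Fin n) (Fin n) ℤ} (hn : 0 < n)
    (h : ∀ x, (∃ y, M.mulVec y = x) ↔ Even (∑ i, x i)) : M.det.natAbs = 2 := by
  classical
  refine Nat.dvd_antisymm ?_ ?_
  · let r : Fin n := ⟨0, hn⟩
    -- The j-th column of `K` is e_j + e_r, which has even sum.
    let K : Matrix (Fin n) (Fin n) ℤ := 1 + Matrix.replicateCol Unit (Pi.single r (1 : ℤ)) *
      Matrix.replicateRow Unit (fun _ => (1 : ℤ))
    have hK : K.det = 2 := by
      rw [Matrix.det_one_add_replicateCol_mul_replicateRow]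
      simp
    have hKe : ∀ i j, K i j = (if i = j then 1 else 0) + if i = r then 1 else 0 := fun i j => by
      simp [K, Matrix.one_apply, Matrix.mul_apply, Pi.single_apply]
    have hcol : ∀ j, ∃ y, M.mulVec y = fun i => K i j := fun j => by
      rw [h]
      simp [hKe, Finset.sum_add_distrib]
    choose U hU using hcol
    have hKM : K = M * Matrix.of fun i j => U j i := by
      ext i j
      rw [← congrFun (hU j) i, Matrix.mul_apply]
      rfl
    have : M.det ∣ 2 := ⟨_, by rw [← hK, hKM, Matrix.det_mul]⟩
    exact Int.natAbs_dvd_natAbs.mpr this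
  · have h0 : ((M.det : ℤ) : ZMod 2) = 0 := by
      rw [← eq_intCast (Int.castRingHom (ZMod 2)), RingHom.map_det,
        ← Matrix.exists_vecMul_eq_zero_iff]
      refine ⟨fun _ => 1, fun h0 => one_ne_zero (congrFun h0 ⟨0, hn⟩), funext fun j => ?_⟩
      have := (h fun i => M i j).mp ⟨Pi.single j 1, by ext i; simp⟩
      have := (ZMod.intCast_zmod_eq_zero_iff_dvd _ 2).mpr (even_iff_two_dvd.mp this)
      simpa [Matrix.vecMul, dotProduct] using this
    rw [ZMod.intCast_zmod_eq_zero_iff_dvd] at h0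
    exact Int.natAbs_dvd_natAbs.mpr h0

end LatticeSection

end VectorPartition

/-! ### The factor two between body and quotient volume -/

namespace VectorPartition

variable {E : Type*} [Fintype E] {n : ℕ}

namespace LatticeSection

variable {a : E → Fin n → ℤ} {N : Set E} (D : LatticeSection a N)

/-- An enumeration of the basis. -/
noncomputable def enum : {e // e ∈ D.B} ≃ Fin n := D.B.equivFinOfCardEq D.card_eq

open Classical in
/-- The matrix of the linear map replacing the coordinates in `B` by the vertex perimeters. -/
noncomputable def mat : Matrix E E ℝ := Matrix.of fun e f =>
  if h : e ∈ D.B then (a f (D.enum ⟨e, h⟩) : ℝ) else if e = f then 1 else 0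

open Classical in
-- The matrix is block triangular, with an identity block outside `B` and the integral matrix of the
-- lattice basis, of determinant ±2, on `B`.
theorem abs_det_mat (hn : 0 < n) : |D.mat.det| = 2 := by
  let M : Matrix (Fin n) (Fin n) ℤ := Matrix.of fun i j => a (D.enum.symm j) i
  have hM : M.det.natAbs = 2 := by
    refine Matrix.natAbs_det_eq_two hn fun x => ?_
    rw [← D.mem_lattice, VectorPartition.mem_lattice]
    have hmul : ∀ y : Fin n → ℤ, M.mulVec y = ∑ j, y j • a (D.enum.symm j) := fun y => by
      ext i
      simp [M, Matrix.mulVec, dotProduct, mul_comm]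
    constructor
    · rintro ⟨y, rfl⟩
      refine ⟨fun e => if h : e ∈ D.B then y (D.enum ⟨e, h⟩) else 0, fun e he => by simp [he], ?_⟩
      rw [hmul, ← D.enum.sum_comp, ← Finset.sum_subset (Finset.subset_univ D.B),
        ← Finset.sum_coe_sort]
      · exact Finset.sum_congr rfl fun e _ => by simp
      · exact fun e _ he => by simp [he]
    · rintro ⟨m, hm, rfl⟩
      refine ⟨fun j => m (D.enum.symm j), ?_⟩
      rw [hmul, ← Finset.sum_subset (Finset.subset_univ D.B) fun e _ he => by simp [hm e he],
        ← Finset.sum_coe_sort D.B, ← D.enum.sum_comp]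
      exact Finset.sum_congr rfl fun e _ => by simp
  have h1 : (D.mat.toSquareBlockProp fun e => ¬ e ∈ D.B) = 1 := by
    ext e f
    simp [mat, Matrix.toSquareBlockProp, e.2, Matrix.one_apply, Subtype.ext_iff]
  have h2 (i : Fintype {e // e ∈ D.B}) : (D.mat.toSquareBlockProp fun e => e ∈ D.B).det =
      (M.map (Int.castRingHom ℝ)).det := by
    rw [← Matrix.det_submatrix_equiv_self D.enum (M.map (Int.castRingHom ℝ))]
    congr 1
    ext e f
    simp [mat, M, Matrix.toSquareBlockProp]
  rw [Matrix.twoBlockTriangular_det D.mat (fun e => e ∈ D.B), h1, h2, Matrix.det_one, mul_one,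
    ← RingHom.mapMatrix_apply, ← RingHom.map_det, eq_intCast, ← Int.cast_abs, Int.abs_eq_natAbs,
    hM]
  · norm_num
  · intro e he f hf
    have : e ≠ f := fun h => he (h ▸ hf)
    simp [mat, he, this]

open Classical in
theorem mat_mulVec_of_mem (x : E → ℝ) {e : E} (he : e ∈ D.B) :
    D.mat.mulVec x e = comb a x (D.enum ⟨e, he⟩) := by
  simp [Matrix.mulVec, dotProduct, mat, he, comb_apply, mul_comm]

open Classical in
theorem mat_mulVec_of_notMem (x : E → ℝ) {e : E} (he : e ∉ D.B) :
    D.mat.mulVec x e = x e := by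
  simp [Matrix.mulVec, dotProduct, mat, he]

/-- The polytope of weights which are non-negative on `N`. -/
def poly (_ : LatticeSection a N) (b : Fin n → ℝ) : Set (E → ℝ) :=
  {w | comb a w = b ∧ ∀ e ∈ N, 0 ≤ w e}

theorem mem_prism_iff {b : Fin n → ℝ} {x : E → ℝ} : x ∈ prism D.sec (D.poly b) ↔
    comb a x - b ∈ Set.Icc (0 : Fin n → ℝ) 1 ∧ ∀ e ∈ N, 0 ≤ (D.sec b + D.proj x) e := by
  constructor
  · rintro ⟨w, ⟨hw, hw0⟩, t, ht, rfl⟩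
    have h1 : comb a (w + D.sec t) = b + t := by rw [map_add, hw, D.comb_sec]
    have h2 := D.sec_add_proj (w + D.sec t)
    rw [h1, map_add, add_right_comm, add_left_inj] at h2
    rw [h1, add_sub_cancel_left, h2]
    exact ⟨ht, hw0⟩
  · rintro ⟨h1, h2⟩
    refine ⟨_, ⟨D.comb_sec_add_proj b x, h2⟩, _, h1, ?_⟩
    rw [map_sub, add_right_comm, add_sub_cancel, D.sec_add_proj]

/-- Trading the coordinates in `B` for the perimeters, translated by -b, sends the prism onto the
body with a closed cube, whose extra points are null. This linear map has determinant ±2. -/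
theorem volume_prism (hn : 0 < n) (b : Fin n → ℝ) :
    volume (D.body b) = 2 * volume (prism D.sec (D.poly b)) := by
  classical
  let β : E → ℝ := fun e => if h : e ∈ D.B then -b (D.enum ⟨e, h⟩) else 0
  let K : Set (E → ℝ) := {x | (∀ e ∈ N, 0 ≤ (D.sec b + D.proj x) e) ∧
    ∀ e ∈ D.B, 0 ≤ x e ∧ x e ≤ 1}
  have hK : volume (D.body b) = volume K := by
    refine measure_congr ?_
    have : ∀ᵐ x : E → ℝ, ∀ e, x e ≠ 1 := by
      rw [ae_all_iff]
      exact fun e => measure_eq_zero_iff_ae_notMem.mp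
        (volume_levelSet_eq_zero (f := LinearMap.proj e) (z := fun _ => 1) (by simp) 1)
    filter_upwards [this] with x hx
    refine propext (and_congr Iff.rfl (forall₂_congr fun e _ => and_congr Iff.rfl ?_))
    exact (lt_iff_le_and_ne.trans (and_iff_left (hx e)))
  have hdet : |LinearMap.det (Matrix.toLin' D.mat)| = 2 := by
    rw [LinearMap.det_toLin', D.abs_det_mat hn]
  have hset : prism D.sec (D.poly b) =
      Matrix.toLin' D.mat ⁻¹' ((fun x => x + β) ⁻¹' K) := by
    ext x
    rw [D.mem_prism_iff, and_comm]
    have hx : ∀ e ∉ D.B, (Matrix.toLin' D.mat x + β) e = x e := fun e he => by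
      simp [D.mat_mulVec_of_notMem x he, β, he]
    refine and_congr (by rw [D.proj_congr hx]) ?_
    rw [← Set.pi_univ_Icc]
    simp only [Set.mem_pi, Set.mem_univ, true_imp_iff, Set.mem_Icc]
    rw [← D.enum.forall_congr_right, Subtype.forall]
    refine forall₂_congr fun e he => ?_
    simp only [Matrix.toLin'_apply, Pi.add_apply, D.mat_mulVec_of_mem x he, β, he, dif_pos,
      Pi.sub_apply, Pi.zero_apply, Pi.one_apply, ← sub_eq_add_neg]
  have hdet0 : LinearMap.det (Matrix.toLin' D.mat) ≠ 0 := fun h => by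
    rw [h, abs_zero] at hdet
    norm_num at hdet
  rw [hset, Measure.addHaar_preimage_linearMap _ hdet0, measure_preimage_add_right, hK, abs_inv,
    hdet, ← mul_assoc, ENNReal.ofReal_inv_of_pos two_pos, ENNReal.ofReal_ofNat,
    ENNReal.mul_inv_cancel two_ne_zero ENNReal.ofNat_ne_top, one_mul]

end LatticeSection

end VectorPartition

/-! ### Volumes for ribbon graphs -/

namespace LabelledRibbonGraph

open VectorPartition

variable {n : ℕ} {H : Type*} [Fintype H] (G : LabelledRibbonGraph n H)

omit [Fintype H] in
variable {G} in
theorem pos_of_connected (hc : G.Connected) : 0 < n := by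
  obtain ⟨h⟩ := hc.1
  exact (G.label h).pos

variable {G} in
theorem continuous_staticWeight {e : G.Edge} (he : G.IsStatic e) :
    Continuous (G.staticWeight he) := by
  obtain ⟨I, J, κ, -, h⟩ := G.staticWeight_eq_wallForm he
  rw [funext h]
  unfold wallForm
  fun_prop

variable {G} in
theorem sum_perimeters (w : G.Edge → ℝ) : ∑ i, G.perimeters w i = 2 * ∑ e, w e := by
  have h : ∀ e, ∑ i, (G.inc e i : ℝ) = 2 := fun e => by exact_mod_cast G.sum_inc e
  simp only [perimeters_eq_comb, comb_apply, Finset.sum_apply, Pi.smul_apply, castVec_apply,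
    smul_eq_mul]
  rw [Finset.sum_comm]
  simp only [← Finset.mul_sum, h, ← Finset.sum_mul]
  ring

/-- The lattice section of the family of edges of a non-bipartite graph. -/
theorem nonempty_latticeSection (hc : G.Connected) (hv : G.VertexLabelled) (hb : ¬ G.Bipartite) :
    Nonempty (LatticeSection G.inc {e | ¬ G.IsStatic e}) := by
  classical
  obtain ⟨B, hind, hcard, hB⟩ := G.exists_lattice_basis hc hv hb
  have hsec : ∀ i : Fin n, ∃ w : G.Edge → ℝ, SuppOn B w ∧ comb G.inc w = Pi.single i 1 := by
    intro i
    -- Twice a basis vector has even sum, so it is an integral combination of the basis edges;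
    -- halving it defines the section.
    obtain ⟨m, hm, hmi⟩ := (hB (Pi.single i 2)).mpr (by simp)
    refine ⟨(1 / 2 : ℝ) • fun e => (m e : ℝ), fun e he => by simp [hm e he], ?_⟩
    rw [map_smul, comb_intCast, hmi]
    ext j
    by_cases h : j = i <;> simp [h]
  choose s hs1 hs2 using hsec
  set φ : G.Edge → (Fin n → ℝ) → ℝ := fun e b =>
    if h : G.IsStatic e then G.staticWeight h b else 0 with hφ
  have hφc : ∀ e, Continuous (φ e) := fun e => by
    by_cases h : G.IsStatic e
    · simpa only [hφ, h, dif_pos] using continuous_staticWeight h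
    · simpa only [hφ, h, dif_neg, not_false_eq_true] using continuous_const
  refine ⟨⟨B, hind, hcard, hB, fun e => by simp [G.sum_inc], Fintype.linearCombination ℝ s,
    fun b e he => ?_, fun b => ?_, fun e he => ?_, fun b => |∑ i, b i| + ∑ e, |φ e b|, ?_, ?_⟩⟩
  · simp [Fintype.linearCombination_apply, hs1 _ e he]
  · simp only [Fintype.linearCombination_apply, map_sum, map_smul, hs2]
    ext i
    simp [Pi.single_apply]
  · obtain ⟨z, hz, hze⟩ := G.exists_relation_of_not_isStatic he
    exact ⟨z, by rw [← perimeters_eq_comb, hz], hze⟩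
  · fun_prop
  -- The total weight is half the sum of the perimeters, static weights are functions of the
  -- perimeters, and the other weights are non-negative. Together these bound every weight.
  · intro w hw e
    rw [← perimeters_eq_comb]
    have hsum := sum_perimeters w
    have hst : ∀ e, G.IsStatic e → φ e (G.perimeters w) = w e := fun e he => by
      simp only [hφ, he, dif_pos]
      exact G.staticWeight_perimeters hc hv hb he w
    have hle : ∀ e, -|φ e (G.perimeters w)| ≤ w e := fun e => by
      by_cases he : G.IsStatic e
      · rw [hst e he]
        exact neg_abs_le _
      · exact (neg_nonpos.mpr (abs_nonneg _)).trans (hw e he)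
    by_cases he : G.IsStatic e
    · rw [← hst e he]
      exact (Finset.single_le_sum (f := fun e => |φ e (G.perimeters w)|)
        (fun _ _ => abs_nonneg _) (Finset.mem_univ e)).trans (le_add_of_nonneg_left (abs_nonneg _))
    · rw [abs_of_nonneg (hw e he)]
      have h1 : ∑ e' ∈ Finset.univ.erase e, -|φ e' (G.perimeters w)| ≤
          ∑ e' ∈ Finset.univ.erase e, w e' := Finset.sum_le_sum fun e' _ => hle e'
      have h2 := Finset.add_sum_erase Finset.univ w (Finset.mem_univ e)
      have h3 := Finset.add_sum_erase Finset.univ (fun e' => |φ e' (G.perimeters w)|)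
        (Finset.mem_univ e)
      simp only [Finset.sum_neg_distrib] at h1 h3
      have h4 := abs_nonneg (φ e (G.perimeters w))
      have h5 := le_abs_self (∑ i, G.perimeters w i)
      have h6 := abs_nonneg (∑ i, G.perimeters w i)
      linarith

theorem polytope_eq (D : LatticeSection G.inc {e | ¬ G.IsStatic e}) (b : Fin n → ℝ) :
    G.polytope b = D.poly b := by
  ext w
  simp [polytope, fibre, LatticeSection.poly, perimeters_eq_comb]

theorem polytopeVolume_eq (D : LatticeSection G.inc {e | ¬ G.IsStatic e}) (hn : 0 < n)
    (b : Fin n → ℝ) : volume.real (D.body b) = 2 * G.polytopeVolume b := by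
  rw [polytopeVolume, quotientVolume_eq (s := D.sec) (b := b), G.polytope_eq D, measureReal_def,
    D.volume_prism hn, ENNReal.toReal_mul, ENNReal.toReal_ofNat]
  · refine LinearMap.ext fun t => ?_
    rw [LinearMap.comp_apply, perimeters_eq_comb, D.comb_sec, LinearMap.id_apply]
  · exact fun w hw => hw.1

theorem interiorCount_eq_count (D : LatticeSection G.inc {e | ¬ G.IsStatic e}) (b : Fin n → ℤ) :
    G.interiorCount (castVec b) = D.count b := by
  rw [interiorCount, LatticeSection.count]
  congr 1
  ext m
  rw [Set.mem_ofPred_eq, mem_relInterior_iff, perimeters_eq_comb]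
  simp

variable {G}

theorem continuous_polytopeVolume (hc : G.Connected) (hv : G.VertexLabelled) (hb : ¬ G.Bipartite) :
    Continuous G.polytopeVolume := by
  obtain ⟨D⟩ := G.nonempty_latticeSection hc hv hb
  have : G.polytopeVolume = fun b => 2⁻¹ * volume.real (D.body b) := funext fun b => by
    rw [G.polytopeVolume_eq D (pos_of_connected hc), inv_mul_cancel_left₀ two_ne_zero]
  rw [this]
  exact continuous_const.mul D.continuous_volume_body

theorem polytopeVolume_smul (hc : G.Connected) (hv : G.VertexLabelled) (hb : ¬ G.Bipartite)
    {τ : ℝ} (hτ : 0 < τ) (b : Fin n → ℝ) :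
    G.polytopeVolume (τ • b) = τ ^ (Fintype.card G.Edge - n) * G.polytopeVolume b := by
  obtain ⟨D⟩ := G.nonempty_latticeSection hc hv hb
  have h := D.volume_body_smul hτ b
  rw [G.polytopeVolume_eq D (pos_of_connected hc), G.polytopeVolume_eq D (pos_of_connected hc)] at h
  linarith

theorem tendsto_interiorCount (hc : G.Connected) (hv : G.VertexLabelled) (hb : ¬ G.Bipartite)
    {b : Fin n → ℤ} (hbe : Even (∑ i, b i)) :
    Tendsto (fun t : ℕ => (G.interiorCount (castVec (t • b)) : ℝ) /
      (t : ℝ) ^ (Fintype.card G.Edge - n)) atTop (𝓝 (2 * G.polytopeVolume (castVec b))) := by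
  obtain ⟨D⟩ := G.nonempty_latticeSection hc hv hb
  rw [← G.polytopeVolume_eq D (pos_of_connected hc)]
  simpa only [G.interiorCount_eq_count D] using D.tendsto_count hbe

end LabelledRibbonGraph

/-! ### Homogeneous components from growth along rays -/

section HomogeneousComponents

open Polynomial in
-- A finite limit excludes degree above D, and otherwise the limit is the coefficient of degree D.
-- No bound on the degree of P is assumed, which allows arbitrary interpolating polynomials later.
theorem Polynomial.coeff_eq_of_tendsto {P : ℝ[X]} {D : ℕ} {c : ℝ} {l : ℕ → ℝ}
    (hl : Tendsto l atTop atTop)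
    (h : Tendsto (fun s => P.eval (l s) / l s ^ D) atTop (𝓝 c)) : P.coeff D = c := by
  have hX : ∀ x : ℝ, (X ^ D : ℝ[X]).eval x = x ^ D := fun x => by simp
  have hX0 : (X ^ D : ℝ[X]) ≠ 0 := pow_ne_zero _ X_ne_zero
  rcases lt_trichotomy P.degree (X ^ D : ℝ[X]).degree with hd | hd | hd
  · have h1 := (div_tendsto_atTop_zero_of_degree_lt P _ hd).comp hl
    simp only [Function.comp_def, hX] at h1
    rw [degree_X_pow] at hd
    rw [coeff_eq_zero_of_degree_lt hd, tendsto_nhds_unique h h1]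
  · have h1 := (div_tendsto_atTop_leadingCoeff_div_of_degree_eq P _ hd).comp hl
    simp only [Function.comp_def, hX] at h1
    rw [degree_X_pow] at hd
    rw [tendsto_nhds_unique h h1, leadingCoeff_X_pow, div_one, leadingCoeff,
      natDegree_eq_of_degree_eq_some hd]
  · have h1 := (abs_div_tendsto_atTop_atTop_of_degree_gt P _ hd hX0).comp hl
    simp only [Function.comp_def, hX] at h1
    exact absurd h.abs (not_tendsto_nhds_of_tendsto_atTop h1 _)

namespace MvPolynomial

variable {σ : Type*} [Fintype σ]

theorem IsHomogeneous.eval_smul {p : MvPolynomial σ ℝ} {d : ℕ} (hp : p.IsHomogeneous d) (t : ℝ)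
    (x : σ → ℝ) : p.eval (t • x) = t ^ d * p.eval x := by
  rw [eval_eq', eval_eq', Finset.mul_sum]
  refine Finset.sum_congr rfl fun m hm => ?_
  have : ∑ i, m i = d := by
    rw [← hp (mem_support_iff.mp hm), Finsupp.weight_apply, Finsupp.sum_fintype _ _ (by simp)]
    simp
  simp only [Pi.smul_apply, smul_eq_mul, mul_pow, Finset.prod_mul_distrib,
    Finset.prod_pow_eq_pow_sum, this]
  ring

/-- On the ray through x, p becomes a polynomial in one variable whose coefficients are the values
at x of its homogeneous components. -/
theorem eval_homogeneousComponent_of_tendsto {p : MvPolynomial σ ℝ} {D : ℕ} {c : ℝ} {x : σ → ℝ}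
    {l : ℕ → ℝ} (hl : Tendsto l atTop atTop)
    (h : Tendsto (fun s => p.eval (l s • x) / l s ^ D) atTop (𝓝 c)) :
    (p.homogeneousComponent D).eval x = c := by
  set P : Polynomial ℝ := ∑ k ∈ Finset.range (p.totalDegree + 1),
    Polynomial.monomial k ((p.homogeneousComponent k).eval x) with hP
  have h1 : ∀ t, P.eval t = p.eval (t • x) := fun t => by
    conv_rhs => rw [← sum_homogeneousComponent p]
    rw [hP, Polynomial.eval_finsetSum, map_sum]
    refine Finset.sum_congr rfl fun k _ => ?_
    rw [Polynomial.eval_monomial, (homogeneousComponent_isHomogeneous k p).eval_smul, mul_comm]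
  have h2 : P.coeff D = (p.homogeneousComponent D).eval x := by
    rw [hP, Polynomial.finsetSum_coeff]
    simp only [Polynomial.coeff_monomial, Finset.sum_ite_eq', Finset.mem_range]
    split_ifs with h
    · rfl
    · rw [homogeneousComponent_eq_zero _ _ (by omega), map_zero]
  simp only [← h1] at h
  rw [← h2, Polynomial.coeff_eq_of_tendsto hl h]

end MvPolynomial

end HomogeneousComponents

/-! ### Rational and integral points of cells -/

section Density

variable {n : ℕ} {C : Set (Fin n → ℝ)}

theorem IsCell.smul_mem (hC : IsCell C) {b : Fin n → ℝ} (hb : b ∈ C) {t : ℝ} (ht : 0 < t) :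
    t • b ∈ C := by
  refine hC.mem_of_sign_eq hb fun I J _ => ?_
  rw [← wallLin_apply, ← wallLin_apply, map_smul, smul_eq_mul, sign_mul, sign_pos ht, one_mul]

theorem IsCell.add_mem (hC : IsCell C) {b b' : Fin n → ℝ} (hb : b ∈ C) (hb' : b' ∈ C) :
    b + b' ∈ C := by
  refine hC.mem_of_sign_eq hb fun I J hIJ => ?_
  have h := hC.sign_eq hb hb' hIJ
  rw [← wallLin_apply, ← wallLin_apply, map_add, wallLin_apply, wallLin_apply]
  rcases lt_trichotomy (wallForm I J b) 0 with h1 | h1 | h1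
  · rw [sign_neg h1, eq_comm, sign_eq_neg_one_iff] at h
    rw [sign_neg h1, sign_neg (by linarith)]
  · rw [h1, sign_zero, eq_comm, sign_eq_zero_iff] at h
    rw [h1, h, add_zero]
  · rw [sign_pos h1, eq_comm, sign_eq_one_iff] at h
    rw [sign_pos h1, sign_pos (by linarith)]

/-- Rational points are dense in cells. -/
theorem IsCell.mem_closure_rational (hC : IsCell C) {b : Fin n → ℝ} (hb : b ∈ C) :
    b ∈ closure {x | x ∈ C ∧ ∃ q : Fin n → ℚ, x = fun i => (q i : ℝ)} := by
  -- The coordinates of `b` are expanded in a ℚ-basis β of their span. Wall forms vanishing at `b`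
  -- vanish identically in β by linear independence, so moving β to nearby rational values preserves
  -- all signs.
  let U : Submodule ℚ ℝ := Submodule.span ℚ (Set.range b)
  have : FiniteDimensional ℚ U := FiniteDimensional.span_of_finite ℚ (Set.finite_range b)
  let β := Module.finBasis ℚ U
  have hbU : ∀ i, b i ∈ U := fun i => Submodule.subset_span ⟨i, rfl⟩
  let u : Fin n → Fin (Module.finrank ℚ U) → ℚ := fun i j => β.repr ⟨b i, hbU i⟩ j
  have hu : ∀ i, b i = ∑ j, (u i j : ℝ) * β j := fun i => by
    have := congrArg U.subtype (β.sum_repr ⟨b i, hbU i⟩)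
    rw [map_sum] at this
    simp only [map_smul, Submodule.subtype_apply, Rat.smul_def] at this
    exact this.symm
  let Φ : (Fin (Module.finrank ℚ U) → ℝ) → Fin n → ℝ := fun y i => ∑ j, (u i j : ℝ) * y j
  have hΦ : Continuous Φ := by fun_prop
  have hΦb : Φ (fun j => β j) = b := funext fun i => (hu i).symm
  have hwall : ∀ I J, wallForm I J b = 0 → ∀ y, wallForm I J (Φ y) = 0 := by
    intro I J h y
    have hform : ∀ y, wallForm I J (Φ y) =
        ∑ j, ((∑ i ∈ I, u i j - ∑ i ∈ J, u i j : ℚ) : ℝ) * y j := fun y => by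
      simp only [wallForm, Φ]
      rw [Finset.sum_comm, Finset.sum_comm (s := J), ← Finset.sum_sub_distrib]
      refine Finset.sum_congr rfl fun j _ => ?_
      push_cast
      rw [sub_mul, Finset.sum_mul, Finset.sum_mul]
    rw [← hΦb, hform] at h
    have h0 : ∑ j, (∑ i ∈ I, u i j - ∑ i ∈ J, u i j) • β j = 0 := by
      refine Subtype.ext ?_
      simpa [Rat.smul_def] using h
    have := Fintype.linearIndependent_iff.mp β.linearIndependent _ h0
    rw [hform]
    exact Finset.sum_eq_zero fun j _ => by rw [this j, Rat.cast_zero, zero_mul]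
  have hev : ∀ᶠ y in 𝓝 (fun j => (β j : ℝ)), Φ y ∈ C := by
    have : ∀ᶠ y in 𝓝 (fun j => (β j : ℝ)), ∀ I J, wallForm I J b ≠ 0 →
        SignType.sign (wallForm I J (Φ y)) = SignType.sign (wallForm I J b) := by
      simp only [eventually_all]
      intro I J h
      have hc : Tendsto (fun y => wallForm I J (Φ y)) (𝓝 (fun j => (β j : ℝ)))
          (𝓝 (wallForm I J b)) := by
        have : Continuous fun y => wallForm I J (Φ y) := by
          unfold wallForm
          fun_prop
        simpa only [hΦb] using this.tendsto (fun j => (β j : ℝ))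
      rcases lt_or_gt_of_ne h with h | h
      · filter_upwards [hc.eventually_lt_const h] with y hy
        rw [sign_neg hy, sign_neg h]
      · filter_upwards [hc.eventually_const_lt h] with y hy
        rw [sign_pos hy, sign_pos h]
    filter_upwards [this] with y hy
    refine hC.mem_of_sign_eq hb fun I J _ => ?_
    by_cases h : wallForm I J b = 0
    · rw [h, hwall I J h]
    · exact hy I J h
  have hdense : DenseRange fun (q : Fin (Module.finrank ℚ U) → ℚ) j => (q j : ℝ) :=
    DenseRange.piMap fun _ => Rat.denseRange_cast
  rw [mem_closure_iff_nhds]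
  intro t ht
  rw [← hΦb] at ht
  obtain ⟨V, hV, hVo, hβV⟩ := mem_nhds_iff.mp (hev.and (hΦ.continuousAt.preimage_mem_nhds ht))
  obtain ⟨q, hq⟩ := hdense.exists_mem_open hVo ⟨_, hβV⟩
  refine ⟨_, (hV hq).2, (hV hq).1, fun i => ∑ j, u i j * q j, funext fun i => ?_⟩
  simp [Φ]

theorem exists_pos_smul_eq_castVec (q : Fin n → ℚ) :
    ∃ M : ℕ, 0 < M ∧ ∃ c : Fin n → ℤ, (M : ℝ) • (fun i => (q i : ℝ)) = castVec c := by
  refine ⟨∏ i, (q i).den, Finset.prod_pos fun i _ => (q i).den_pos,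
    fun i => (∏ j ∈ Finset.univ.erase i, ((q j).den : ℤ)) * (q i).num, funext fun i => ?_⟩
  have h : ((q i).den : ℝ) * (q i : ℝ) = (q i).num := by
    exact_mod_cast Rat.den_mul_eq_num (q i)
  rw [← Finset.mul_prod_erase _ _ (Finset.mem_univ i)]
  simp only [Pi.smul_apply, smul_eq_mul, castVec_apply]
  push_cast
  rw [← h]
  ring

theorem IsCell.exists_castVec_mem (hC : IsCell C) : ∃ c : Fin n → ℤ, castVec c ∈ C := by
  obtain ⟨b, rfl⟩ := id hC
  obtain ⟨x, hx, q, rfl⟩ := closure_nonempty_iff.mp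
    ⟨_, hC.mem_closure_rational (b := b) fun _ _ _ => rfl⟩
  obtain ⟨M, hM, c, hc⟩ := exists_pos_smul_eq_castVec q
  exact ⟨c, hc ▸ hC.smul_mem hx (Nat.cast_pos.mpr hM)⟩

theorem IsCell.nsmul_mem_cosetPoints (hC : IsCell C) {r c : Fin n → ℤ} (hc : c ∈ cosetPoints C r)
    {t : ℕ} (ht : Odd t) : t • c ∈ cosetPoints C r := by
  refine ⟨?_, fun i => ?_⟩
  · have := hC.smul_mem hc.1 (t := t) (Nat.cast_pos.mpr ht.pos)
    convert this using 1
    ext i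
    simp
  · obtain ⟨s, rfl⟩ := ht
    refine Int.ModEq.trans ?_ (hc.2 i)
    refine (Int.modEq_iff_dvd.mpr ⟨-(s * c i), ?_⟩)
    simp only [Pi.smul_apply, nsmul_eq_mul]
    push_cast
    ring

theorem IsCell.cosetPoints_zero_nonempty (hC : IsCell C) : (cosetPoints C 0).Nonempty := by
  obtain ⟨c, hc⟩ := hC.exists_castVec_mem
  refine ⟨(2 : ℕ) • c, ?_, fun i => ?_⟩
  · convert hC.smul_mem hc two_pos using 1
    ext i
    simp
  · exact Int.modEq_zero_iff_dvd.mpr ⟨c i, by simp⟩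

/-- Adding a large even multiple of an integral point c of the ray of q to a point of the coset
keeps the coset and the cell, and after rescaling converges to q. -/
theorem IsCell.subset_closure_cosetPoints (hC : IsCell C) {r : Fin n → ℤ}
    (hr : (cosetPoints C r).Nonempty) :
    C ⊆ closure {x | ∃ τ : ℝ, 0 < τ ∧ ∃ c ∈ cosetPoints C r, x = τ • castVec c} := by
  intro b hb
  refine closure_minimal ?_ isClosed_closure (hC.mem_closure_rational hb)
  rintro x ⟨hx, q, rfl⟩
  obtain ⟨M, hM, c, hc⟩ := exists_pos_smul_eq_castVec q
  obtain ⟨x₀, hx₀⟩ := hr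
  have hM' : (0 : ℝ) < M := Nat.cast_pos.mpr hM
  have hcC : castVec c ∈ C := hc ▸ hC.smul_mem hx hM'
  have hlim : Tendsto (fun t : ℕ => (2 * (M : ℝ) * ((t : ℝ) + 1))⁻¹ • castVec x₀ +
      fun i => (q i : ℝ)) atTop (𝓝 ((0 : ℝ) • castVec x₀ + fun i => (q i : ℝ))) := by
    refine (Tendsto.smul_const ?_ _).add_const _
    refine Tendsto.inv_tendsto_atTop ?_
    exact (tendsto_natCast_atTop_atTop.atTop_add tendsto_const_nhds).const_mul_atTop (by positivity)
  rw [zero_smul, zero_add] at hlim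
  refine mem_closure_of_tendsto hlim (Eventually.of_forall fun t => ?_)
  refine ⟨(2 * (M : ℝ) * ((t : ℝ) + 1))⁻¹, by positivity, x₀ + (2 * (t + 1)) • c,
    ⟨?_, fun i => ?_⟩, ?_⟩
  · have := hC.add_mem hx₀.1 (hC.smul_mem hcC (t := 2 * (t + 1)) (by positivity))
    convert this using 1
    ext i
    simp
  · refine Int.ModEq.trans ?_ (hx₀.2 i)
    refine (Int.modEq_iff_dvd.mpr ⟨-((t + 1) * c i), ?_⟩)
    have : ((2 * (t + 1)) • c) i = 2 * (t + 1) * c i := by simp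
    rw [Pi.add_apply, this]
    ring
  · have h1 : castVec ((2 * (t + 1)) • c) = (2 * ((t : ℝ) + 1)) • castVec c := by
      ext i
      simp
    rw [map_add, smul_add, h1, ← hc, smul_smul, smul_smul]
    congr 1
    rw [show (2 * (M : ℝ) * (t + 1))⁻¹ * (2 * (t + 1)) * M = 1 by field_simp, one_smul]

/-- Homogeneity of the same degree carries the equality to positive multiples of the coset points,
which are dense in the cell. -/
theorem IsCell.eqOn_closure (hC : IsCell C) {r : Fin n → ℤ} (hr : (cosetPoints C r).Nonempty)
    {f g : (Fin n → ℝ) → ℝ} (hf : Continuous f) (hg : Continuous g) {d : ℕ}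
    (hf' : ∀ τ : ℝ, 0 < τ → ∀ x, f (τ • x) = τ ^ d * f x)
    (hg' : ∀ τ : ℝ, 0 < τ → ∀ x, g (τ • x) = τ ^ d * g x)
    (h : ∀ c ∈ cosetPoints C r, f (castVec c) = g (castVec c)) : Set.EqOn f g (closure C) := by
  have hcl : IsClosed {x | f x = g x} := isClosed_eq hf hg
  refine closure_minimal ((hC.subset_closure_cosetPoints hr).trans (closure_minimal ?_ hcl)) hcl
  rintro x ⟨τ, hτ, c, hc, rfl⟩
  change f _ = g _
  rw [hf' τ hτ, hg' τ hτ, h c hc]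

end Density

/-! ### Polynomiality of the volume -/

namespace LabelledRibbonGraph

variable {n : ℕ} {H : Type*} [Fintype H] {G : LabelledRibbonGraph n H} {C : Set (Fin n → ℝ)}

/-- The polynomial is half the degree |E| - n component of the counting polynomial for the coset
2ℤ^n, which is available for every cell and consists of vectors with even sum. -/
theorem polytopeVolume_isPolynomial (hc : G.Connected) (hv : G.VertexLabelled)
    (hb : ¬ G.Bipartite) (hC : IsCell C) :
    ∃ p : MvPolynomial (Fin n) ℝ, (∀ b ∈ closure C, G.polytopeVolume b = p.eval b) ∧
      ((∀ b ∈ closure C, G.polytopeVolume b = 0) ∨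
        (p.totalDegree + n = Fintype.card G.Edge ∧
          ∀ q : MvPolynomial (Fin n) ℝ, (∀ b ∈ closure C, G.polytopeVolume b = q.eval b) →
            p.totalDegree ≤ q.totalDegree)) := by
  obtain ⟨hn, f, ⟨p, -, hp⟩, hf⟩ := G.interiorCount_isPolyFun hc hv hb hC 0
  set d := Fintype.card G.Edge - n
  have hodd : Tendsto (fun s : ℕ => 2 * s + 1) atTop atTop :=
    tendsto_atTop_mono (fun s => show s ≤ 2 * s + 1 by omega) tendsto_id
  have hcomp : ∀ c ∈ cosetPoints C 0, (p.homogeneousComponent d).eval (castVec c) =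
      2 * G.polytopeVolume (castVec c) := by
    intro c hcC
    have hev : Even (∑ i, c i) := Finset.even_sum _ fun i _ =>
      even_iff_two_dvd.mpr (Int.modEq_zero_iff_dvd.mp (hcC.2 i))
    refine MvPolynomial.eval_homogeneousComponent_of_tendsto
      (tendsto_natCast_atTop_atTop.comp hodd) ?_
    refine ((tendsto_interiorCount hc hv hb hev).comp hodd).congr fun s => ?_
    simp only [Function.comp_apply]
    rw [hf _ (hC.nsmul_mem_cosetPoints hcC ⟨s, rfl⟩), hp]
    congr 3
    ext i
    simp
  have hhom : ((1 / 2 : ℝ) • p.homogeneousComponent d).IsHomogeneous d :=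
    Submodule.smul_mem (MvPolynomial.homogeneousSubmodule (Fin n) ℝ d) _
      (MvPolynomial.homogeneousComponent_isHomogeneous d p)
  have heq : ∀ b ∈ closure C, G.polytopeVolume b =
      ((1 / 2 : ℝ) • p.homogeneousComponent d).eval b := by
    refine hC.eqOn_closure (d := d) hC.cosetPoints_zero_nonempty
      (continuous_polytopeVolume hc hv hb)
      (MvPolynomial.continuous_eval _) (fun τ hτ x => polytopeVolume_smul hc hv hb hτ x)
      (fun τ _ x => hhom.eval_smul τ x) fun c hcC => ?_
    rw [MvPolynomial.smul_eval, hcomp c hcC]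
    ring
  refine ⟨_, heq, or_iff_not_imp_left.mpr fun h0 => ?_⟩
  push Not at h0
  obtain ⟨b, hbC, hb0⟩ := h0
  have hne : (1 / 2 : ℝ) • p.homogeneousComponent d ≠ 0 := fun h =>
    hb0 (by rw [heq b hbC, h, map_zero])
  rw [hhom.totalDegree hne]
  refine ⟨by omega, fun q hq => ?_⟩
  -- The volume is homogeneous along the ray through b, so every polynomial giving it has a degree d
  -- component that is non-zero at b.
  have hq' : (q.homogeneousComponent d).eval b = G.polytopeVolume b := by
    have ht : Tendsto (fun s : ℕ => (s : ℝ) + 1) atTop atTop :=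
      tendsto_natCast_atTop_atTop.atTop_add tendsto_const_nhds
    refine MvPolynomial.eval_homogeneousComponent_of_tendsto ht
      (tendsto_const_nhds.congr fun s => ?_)
    have hs : (0 : ℝ) < (s : ℝ) + 1 := by positivity
    have hmem : ((s : ℝ) + 1) • b ∈ closure C :=
      map_mem_closure (continuous_const_smul _) hbC fun x hx => hC.smul_mem hx hs
    rw [← hq _ hmem, polytopeVolume_smul hc hv hb hs, mul_div_cancel_left₀ _ (pow_pos hs _).ne']
  by_contra hlt
  rw [MvPolynomial.homogeneousComponent_eq_zero _ _ (not_le.mp hlt), map_zero] at hq'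
  exact hb0 hq'.symm

end LabelledRibbonGraph

/-! ### Isomorphisms and duality -/

theorem Equiv.Perm.sameCycle_iff_of_semiconj {α : Type*} {f f' p : Equiv.Perm α}
    (h : ∀ x, p (f x) = f' (p x)) {x y : α} : f'.SameCycle (p x) (p y) ↔ f.SameCycle x y := by
  have : f' = p * f * p⁻¹ := by
    ext x
    simp [h]
  rw [this, Equiv.Perm.sameCycle_conj]
  simp

namespace RibbonGraph

variable {H : Type*} {G : RibbonGraph H}

theorem connected_of_induction [Nonempty H]
    (h : ∀ P : H → Prop, (∀ x, P x ↔ P (G.next x)) → (∀ x, P x ↔ P (G.opp x)) →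
      ∀ x y, P x → P y) : G.Connected := by
  set S := Subgroup.closure {G.next, G.opp} with hS
  refine ⟨inferInstance, ⟨fun x y => ?_⟩⟩
  have key : ∀ g ∈ S, ∀ z, (∃ s : S, s • x = z) ↔ ∃ s : S, s • x = g z := by
    intro g hg z
    constructor
    · rintro ⟨s, rfl⟩
      exact ⟨⟨g, hg⟩ * s, mul_smul _ _ _⟩
    · rintro ⟨s, hs⟩
      refine ⟨⟨g, hg⟩⁻¹ * s, ?_⟩
      rw [mul_smul, hs, inv_smul_eq_iff]
      rfl
  exact h (fun z => ∃ s : S, s • x = z) (key _ (Subgroup.subset_closure (by simp)))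
    (key _ (Subgroup.subset_closure (by simp))) x y ⟨1, one_smul _ _⟩

theorem next_faceNext (G : RibbonGraph H) (h : H) : G.next (G.faceNext h) = G.opp h := by
  simp [faceNext]

theorem card_vertexDegrees [Finite H] (G : RibbonGraph H) :
    G.vertexDegrees.card = Fintype.card G.Vertex := by
  simp [vertexDegrees]

/-- A two-colouring of the half-edges that alternates around every vertex forces even degrees. -/
theorem even_degree_of_alternating [Finite H] {χ : H → Bool} (hχ : ∀ h, χ (G.next h) = !χ h)
    (v : G.Vertex) : Even (Nat.card {h : H // G.vertexOf h = v}) := by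
  classical
  have hv : ∀ h, G.vertexOf (G.next h) = G.vertexOf h := fun h =>
    Quotient.sound (s := Equiv.Perm.SameCycle.setoid G.next)
      (Equiv.Perm.sameCycle_apply_left.mpr (Equiv.Perm.SameCycle.refl _ _))
  have e : {h : {h : H // G.vertexOf h = v} // χ h = true} ≃
      {h : {h : H // G.vertexOf h = v} // ¬ χ h = true} :=
    (G.next.subtypeEquiv (q := fun h => G.vertexOf h = v) fun h => by rw [hv]).subtypeEquiv
      fun h => by simp [hχ]
  have h1 := Nat.card_congr (Equiv.sumCompl fun h : {h : H // G.vertexOf h = v} => χ h = true)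
  rw [Nat.card_sum, ← Nat.card_congr e] at h1
  exact ⟨_, h1.symm⟩

end RibbonGraph

namespace LabelledRibbonGraph

variable {n : ℕ} {H : Type*}

section Isomorphism

variable {G G' : LabelledRibbonGraph n H}

namespace Iso

variable (e : Iso G G')

/-- The bijection between edges induced by an isomorphism. -/
def edgeEquiv : G.Edge ≃ G'.Edge :=
  Quotient.congr e.1 fun _ _ => (Equiv.Perm.sameCycle_iff_of_semiconj e.2.2.1).symm

theorem edgeEquiv_edgeOf (h : H) : e.edgeEquiv (G.edgeOf h) = G'.edgeOf (e.1 h) := rfl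

include e

theorem connected (hG : G.Connected) : G'.Connected := by
  have := hG.1
  refine RibbonGraph.connected_of_induction fun P h1 h2 x y hx => ?_
  have := hG.induction (P := fun h => P (e.1 h)) (fun h => by rw [e.2.1]; exact h1 _)
    (fun h => by rw [e.2.2.1]; exact h2 _) (h₀ := e.1.symm x) (by simpa using hx) (e.1.symm y)
  simpa using this

theorem vertexLabelled (hG : G.VertexLabelled) : G'.VertexLabelled := by
  refine ⟨fun i => ?_, fun x y => ?_⟩
  · obtain ⟨h, rfl⟩ := hG.1 i
    exact ⟨e.1 h, e.2.2.2 h⟩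
  · obtain ⟨x, rfl⟩ := e.1.surjective x
    obtain ⟨y, rfl⟩ := e.1.surjective y
    rw [Equiv.Perm.sameCycle_iff_of_semiconj e.2.1, ← hG.2, e.2.2.2, e.2.2.2]

theorem bipartite (hG : G'.Bipartite) : G.Bipartite := by
  obtain ⟨c, hc⟩ := hG
  refine ⟨c, fun h => ?_⟩
  rw [← e.2.2.2, ← e.2.2.2, e.2.2.1]
  exact hc _

theorem perimeters [Fintype H] (w : G'.Edge → ℝ) :
    G'.perimeters w = G.perimeters (w ∘ e.edgeEquiv) := by
  classical
  ext i
  simp only [LabelledRibbonGraph.perimeters, LinearMap.coe_mk, AddHom.coe_mk, Finset.sum_filter]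
  rw [← Equiv.sum_comp e.1]
  simp only [e.2.2.2, Function.comp_apply, edgeEquiv_edgeOf]

theorem metricCount [Fintype H] (b : Fin n → ℤ) : G.metricCount b = G'.metricCount b := by
  rw [LabelledRibbonGraph.metricCount, LabelledRibbonGraph.metricCount,
    ← Set.ncard_image_of_injective _ (e.edgeEquiv.arrowCongr (Equiv.refl ℤ)).symm.injective]
  congr 1
  ext l
  simp only [Equiv.image_eq_preimage_symm, Equiv.symm_symm, Set.mem_preimage, Set.mem_ofPred_eq]
  rw [e.perimeters, ← e.edgeEquiv.forall_congr_right]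
  simp [Function.comp_def, Equiv.arrowCongr]

theorem cardAut : G.cardAut = G'.cardAut := by
  refine Nat.card_congr (e.1.permCongr.subtypeEquiv fun p => ?_)
  refine and_congr ?_ (and_congr ?_ ?_) <;> refine Iff.trans ?_ e.1.forall_congr_right <;>
    simp [← e.2.1, ← e.2.2.1, e.2.2.2]

end Iso

/-- Isomorphisms between graphs and between their duals are the same. -/
def isoDual (G G' : LabelledRibbonGraph n H) : Iso G G' ≃ Iso G.dual G'.dual :=
  Equiv.subtypeEquivRight fun e => by
    refine and_congr_left fun h => ?_
    change _ ↔ ∀ x, e (G.faceNext x) = G'.faceNext (e x)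
    rw [← G.faceNext.forall_congr_right]
    refine forall_congr' fun x => ?_
    rw [G.next_faceNext, h.1, ← G'.next_faceNext, G'.next.apply_eq_iff_eq, eq_comm]

theorem cardAut_dual (G : LabelledRibbonGraph n H) : G.dual.cardAut = G.cardAut :=
  (Nat.card_congr (isoDual G G)).symm

/-- Since next ∘ faceNext = opp, a set of half-edges stable under two of these permutations is
stable under the third. -/
theorem connected_dual (hG : G.Connected) : G.dual.Connected := by
  have := hG.1
  refine RibbonGraph.connected_of_induction fun P h1 h2 x y hx => ?_
  refine hG.induction (P := P) (fun h => ?_) h2 hx y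
  obtain ⟨k, rfl⟩ := G.faceNext.surjective h
  rw [G.next_faceNext]
  exact (h1 k).symm.trans (h2 k)

/-- A proper two-colouring of the faces would alternate on the half-edges around every vertex,
forcing even degrees. -/
theorem not_bipartite_dual [Finite H] (hG : G.Connected) (hf : G.FaceLabelled)
    (hodd : ∀ k ∈ G.vertexDegrees, Odd k) : ¬ G.dual.Bipartite := by
  rintro ⟨c, hc⟩
  obtain ⟨h₀⟩ := hG.1
  have hχ : ∀ h, c (G.label (G.next h)) = !c (G.label h) := by
    intro h
    obtain ⟨k, rfl⟩ := G.faceNext.surjective h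
    have h1 : G.label (G.faceNext k) = G.label k := (hf.2 _ _).mpr
      (Equiv.Perm.sameCycle_apply_left.mpr (Equiv.Perm.SameCycle.refl _ _))
    rw [G.next_faceNext, h1]
    exact Bool.eq_not.mpr (hc k).symm
  have h1 := RibbonGraph.even_degree_of_alternating (χ := fun h => c (G.label h)) hχ
    (G.vertexOf h₀)
  refine Nat.not_even_iff_odd.mpr (hodd _ ?_) h1
  exact Multiset.mem_map_of_mem _ (Finset.mem_univ (G.vertexOf h₀))

theorem card_face [Finite H] (hf : G.FaceLabelled) : Fintype.card G.Face = n := by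
  let φ : G.Face → Fin n := Quotient.lift G.label fun x y h => (hf.2 x y).mpr h
  have hφ : Function.Bijective φ := by
    constructor
    · intro x y
      refine Quotient.inductionOn₂ x y fun x y h => Quotient.sound ?_
      exact (hf.2 x y).mp h
    · intro i
      obtain ⟨h, hh⟩ := hf.1 i
      exact ⟨Quotient.mk _ h, hh⟩
  rw [Fintype.card_of_bijective hφ, Fintype.card_fin]

end Isomorphism

section Classes

instance (n : ℕ) (H : Type*) [Finite H] : Finite (LabelledRibbonGraph n H) :=
  Finite.of_injective (fun G => (G.next, G.opp, G.label)) fun G G' h => by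
    rcases G with ⟨⟨_, _, _, _⟩, _⟩
    rcases G' with ⟨⟨_, _, _, _⟩, _⟩
    simp only [Prod.mk.injEq] at h
    obtain ⟨rfl, rfl, rfl⟩ := h
    rfl

/-- Duality on isomorphism classes. -/
def dualClass {n m : ℕ} : IsoClass n m → IsoClass n m :=
  Quotient.map dual fun G G' ⟨e⟩ => ⟨isoDual G G' e⟩

theorem dualClass_injective {n m : ℕ} : Function.Injective (dualClass (n := n) (m := m)) := by
  intro c c'
  refine Quotient.inductionOn₂ c c' fun G G' h => ?_
  obtain ⟨e⟩ := Quotient.exact h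
  exact Quotient.sound ⟨(isoDual G G').symm e⟩

theorem dualClasses_eq_image (g n : ℕ) {m : ℕ} (κ : m.Partition) :
    dualClasses g n κ = dualClass '' classes g n κ := by
  ext c
  constructor
  · rintro ⟨G, rfl, hG⟩
    exact ⟨_, ⟨G, rfl, hG⟩, rfl⟩
  · rintro ⟨_, ⟨G, rfl, hG⟩, rfl⟩
    exact ⟨G, rfl, hG⟩

/-- Duality changes neither edges nor labels, so perimeters and metrics are literally the same. -/
theorem metricCount_out_dualClass {n m : ℕ} (c : IsoClass n m) (b : Fin n → ℤ) :
    (dualClass c).out.metricCount b = c.out.metricCount b := by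
  obtain ⟨e⟩ := Quotient.exact (show Quotient.mk (isoSetoid n (Fin m)) (dualClass c).out =
    Quotient.mk (isoSetoid n (Fin m)) c.out.dual by
      conv_lhs => rw [Quotient.out_eq, ← Quotient.out_eq c]
      rfl)
  exact e.metricCount b

theorem cardAut_out_dualClass {n m : ℕ} (c : IsoClass n m) :
    (dualClass c).out.cardAut = c.out.cardAut := by
  obtain ⟨e⟩ := Quotient.exact (show Quotient.mk (isoSetoid n (Fin m)) (dualClass c).out =
    Quotient.mk (isoSetoid n (Fin m)) c.out.dual by
      conv_lhs => rw [Quotient.out_eq, ← Quotient.out_eq c]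
      rfl)
  rw [e.cardAut, cardAut_dual]

/-- The edge count is Euler's formula with n faces, written without subtraction. -/
theorem out_dualClass_spec {g n m : ℕ} {κ : m.Partition} (hκ : ∀ k ∈ κ.parts, Odd k)
    {c : IsoClass n m} (hc : c ∈ classes g n κ) :
    (dualClass c).out.Connected ∧ (dualClass c).out.VertexLabelled ∧
      ¬ (dualClass c).out.Bipartite ∧
      Fintype.card (dualClass c).out.Edge + 2 = 2 * g + κ.parts.card + n := by
  obtain ⟨G, rfl, h1, h2, h3, h4⟩ := hc
  obtain ⟨e⟩ := Quotient.exact (Quotient.out_eq (dualClass (Quotient.mk _ G))).symm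
  change Iso G.dual _ at e
  refine ⟨e.connected (connected_dual h1), e.vertexLabelled h2, fun h =>
    not_bipartite_dual h1 h2 (h4 ▸ hκ) (e.bipartite h), ?_⟩
  have h5 : Fintype.card G.Edge = Fintype.card (dualClass (Quotient.mk _ G)).out.Edge :=
    Fintype.card_congr e.edgeEquiv
  rw [← h5, ← h4, G.card_vertexDegrees]
  rw [RibbonGraph.HasGenus, card_face h2] at h3
  omega

theorem metricCountingFunction_eq (g n : ℕ) {m : ℕ} (κ : m.Partition) (b : Fin n → ℤ) :
    metricCountingFunction g n κ b = ∑ c ∈ (Set.toFinite (classes g n κ)).toFinset,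
      ((dualClass c).out.metricCount b : ℝ) / (dualClass c).out.cardAut := by
  rw [metricCountingFunction, finsum_mem_eq_finite_toFinset_sum _ (Set.toFinite _)]
  simp only [metricCount_out_dualClass, cardAut_out_dualClass]

theorem volumeFunction_eq (g n : ℕ) {m : ℕ} (κ : m.Partition) (b : Fin n → ℝ) :
    volumeFunction g n κ b = ∑ c ∈ (Set.toFinite (classes g n κ)).toFinset,
      (dualClass c).out.dualVolume b / (dualClass c).out.cardAut := by
  rw [volumeFunction, dualClasses_eq_image, finsum_mem_image dualClass_injective.injOn,
    finsum_mem_eq_finite_toFinset_sum _ (Set.toFinite _)]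

end Classes

/-! ### Positivity of static weights on a cell -/

section Cells

variable [Fintype H] {G : LabelledRibbonGraph n H} {C : Set (Fin n → ℝ)}

theorem staticWeight_pos_iff (hC : IsCell C) {b b' : Fin n → ℝ} (hb : b ∈ C) (hb' : b' ∈ C)
    {e : G.Edge} (he : G.IsStatic e) : 0 < G.staticWeight he b ↔ 0 < G.staticWeight he b' := by
  obtain ⟨I, J, κ, hIJ, h⟩ := G.staticWeight_eq_wallForm he
  rw [h, h, ← sign_eq_one_iff, ← sign_eq_one_iff, div_eq_mul_inv, div_eq_mul_inv, sign_mul,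
    sign_mul, hC.sign_eq hb hb' hIJ]

theorem metricCount_of_pos (hc : G.Connected) (hv : G.VertexLabelled) (hb : ¬ G.Bipartite)
    {b : Fin n → ℤ} (h : ∀ (e : G.Edge) (he : G.IsStatic e), 0 < G.staticWeight he (castVec b)) :
    G.metricCount b = G.interiorCount (castVec b) := by
  rw [metricCount, interiorCount]
  congr 1
  ext l
  rw [Set.mem_ofPred_eq, Set.mem_ofPred_eq, mem_relInterior_iff]
  refine ⟨fun ⟨h1, h2⟩ => ⟨h2, fun e _ => Int.cast_pos.mpr (h1 e)⟩,
    fun ⟨h1, h2⟩ => ⟨fun e => ?_, h1⟩⟩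
  by_cases he : G.IsStatic e
  · have := h e he
    rw [← h1, G.staticWeight_perimeters hc hv hb he] at this
    exact_mod_cast this
  · exact_mod_cast h2 e he

theorem metricCount_of_not_pos (hc : G.Connected) (hv : G.VertexLabelled) (hb : ¬ G.Bipartite)
    {b : Fin n → ℤ}
    (h : ¬ ∀ (e : G.Edge) (he : G.IsStatic e), 0 < G.staticWeight he (castVec b)) :
    G.metricCount b = 0 := by
  rw [metricCount]
  convert Set.ncard_empty (G.Edge → ℤ)
  refine Set.eq_empty_iff_forall_notMem.mpr fun l ⟨h1, h2⟩ => h fun e he => ?_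
  change _ = castVec b at h2
  rw [← h2, G.staticWeight_perimeters hc hv hb he]
  exact Int.cast_pos.mpr (h1 e)

/-- On a cell, all static edges have positive weights, or no point has this property. -/
theorem exists_indicator (hc : G.Connected) (hv : G.VertexLabelled) (hb : ¬ G.Bipartite)
    (hC : IsCell C) : ∃ ε : ℝ,
      (∀ b : Fin n → ℤ, castVec b ∈ C → (G.metricCount b : ℝ) = ε * G.interiorCount (castVec b)) ∧
      ∀ b ∈ C, G.dualVolume b = ε * G.polytopeVolume b := by
  classical
  by_cases h : ∀ b ∈ C, ∀ (e : G.Edge) (he : G.IsStatic e), 0 < G.staticWeight he b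
  · refine ⟨1, fun b hbC => ?_, fun b hbC => ?_⟩
    · rw [metricCount_of_pos hc hv hb (h _ hbC), one_mul]
    · rw [dualVolume, if_pos (h b hbC)]
  · push Not at h
    obtain ⟨b₀, hb₀, e, he, h0⟩ := h
    have hneg : ∀ b ∈ C, ¬ ∀ (e : G.Edge) (he : G.IsStatic e), 0 < G.staticWeight he b :=
      fun b hbC h => h0.not_gt ((staticWeight_pos_iff hC hbC hb₀ he).mp (h e he))
    refine ⟨0, fun b hbC => ?_, fun b hbC => ?_⟩
    · rw [metricCount_of_not_pos hc hv hb (hneg _ hbC), Nat.cast_zero, zero_mul]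
    · rw [dualVolume, if_neg (hneg b hbC)]

end Cells

end LabelledRibbonGraph

open LabelledRibbonGraph VectorPartition

/-! ### Summation over isomorphism classes -/

section CountingFunctions

variable {g n m : ℕ} {κ : m.Partition} {C : Set (Fin n → ℝ)}

theorem metricCountingFunction_isPolyFun (hκ : ∀ k ∈ κ.parts, Odd k) (hC : IsCell C)
    (r : Fin n → ℤ) : ∃ f, IsPolyFun (2 * g + κ.parts.card - 2) f ∧
      ∀ b ∈ cosetPoints C r, metricCountingFunction g n κ b = f (castVec b) := by
  have key : ∀ c : IsoClass n m, ∃ f, IsPolyFun (2 * g + κ.parts.card - 2) f ∧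
      (c ∈ classes g n κ → ∀ b ∈ cosetPoints C r,
        ((dualClass c).out.metricCount b : ℝ) / (dualClass c).out.cardAut = f (castVec b)) := by
    intro c
    by_cases hcl : c ∈ classes g n κ
    swap
    · exact ⟨_, .const 0, fun h => absurd h hcl⟩
    obtain ⟨hc, hv, hb, hcard⟩ := out_dualClass_spec hκ hcl
    obtain ⟨ε, hε, -⟩ := exists_indicator hc hv hb hC
    obtain ⟨-, f, hf, hfb⟩ := interiorCount_isPolyFun hc hv hb hC r
    -- Euler's formula also makes the truncated differences agree. If there are no classes at all,
    -- the sum is empty and the counting function is zero.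
    rw [show Fintype.card (dualClass c).out.Edge - n = 2 * g + κ.parts.card - 2 by omega] at hf
    refine ⟨_, hf.const_mul (ε / (dualClass c).out.cardAut), fun _ b hbC => ?_⟩
    rw [hε b hbC.1, hfb b hbC]
    ring
  choose f hf hfb using key
  refine ⟨_, .sum (Set.toFinite (classes g n κ)).toFinset fun c _ => hf c,
    fun b hbC => ?_⟩
  rw [metricCountingFunction_eq]
  exact Finset.sum_congr rfl fun c hcl => hfb c ((Set.Finite.mem_toFinset _).mp hcl) b hbC

theorem volumeFunction_isPolynomial (hκ : ∀ k ∈ κ.parts, Odd k) (hC : IsCell C) :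
    ∃ p : MvPolynomial (Fin n) ℝ, ∀ b ∈ C, volumeFunction g n κ b = p.eval b := by
  have key : ∀ c : IsoClass n m, ∃ p : MvPolynomial (Fin n) ℝ, c ∈ classes g n κ → ∀ b ∈ C,
      (dualClass c).out.dualVolume b / (dualClass c).out.cardAut = p.eval b := by
    intro c
    by_cases hcl : c ∈ classes g n κ
    swap
    · exact ⟨0, fun h => absurd h hcl⟩
    obtain ⟨hc, hv, hb, -⟩ := out_dualClass_spec hκ hcl
    obtain ⟨ε, -, hε⟩ := exists_indicator hc hv hb hC
    obtain ⟨p, hp, -⟩ := polytopeVolume_isPolynomial hc hv hb hC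
    refine ⟨(ε / (dualClass c).out.cardAut) • p, fun _ b hbC => ?_⟩
    rw [hε b hbC, hp b (subset_closure hbC), MvPolynomial.smul_eval]
    ring
  choose p hp using key
  refine ⟨∑ c ∈ (Set.toFinite (classes g n κ)).toFinset, p c, fun b hbC => ?_⟩
  rw [volumeFunction_eq, map_sum]
  exact Finset.sum_congr rfl fun c hcl => hp c ((Set.Finite.mem_toFinset _).mp hcl) b hbC

theorem homogeneousComponent_metricCountingFunction (hκ : ∀ k ∈ κ.parts, Odd k) (hC : IsCell C)
    {r : Fin n → ℤ} (hr : Even (∑ i, r i)) (hne : (cosetPoints C r).Nonempty)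
    {p : MvPolynomial (Fin n) ℝ}
    (hp : ∀ b ∈ cosetPoints C r, metricCountingFunction g n κ b = p.eval (castVec b))
    {b : Fin n → ℝ} (hbC : b ∈ C) :
    (p.homogeneousComponent (2 * g + κ.parts.card - 2)).eval b = 2 * volumeFunction g n κ b := by
  set D := 2 * g + κ.parts.card - 2
  -- `dualVolume` may jump across walls, so on the cell it is replaced by `v`, a multiple of the
  -- polytope volume that is continuous and homogeneous everywhere. Limits are taken along odd
  -- multiples, which preserve the coset.
  have key : ∀ c : IsoClass n m, ∃ v : (Fin n → ℝ) → ℝ, Continuous v ∧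
      (∀ τ : ℝ, 0 < τ → ∀ x, v (τ • x) = τ ^ D * v x) ∧ (c ∈ classes g n κ →
        (∀ b ∈ C, (dualClass c).out.dualVolume b / (dualClass c).out.cardAut = v b) ∧
        ∀ b ∈ cosetPoints C r, Tendsto (fun s : ℕ =>
          (((dualClass c).out.metricCount ((2 * s + 1) • b) : ℝ) / (dualClass c).out.cardAut) /
            ((2 * s + 1 : ℕ) : ℝ) ^ D) atTop (𝓝 (2 * v (castVec b)))) := by
    intro c
    by_cases hcl : c ∈ classes g n κ
    swap
    · exact ⟨fun _ => 0, continuous_const, by simp, fun h => absurd h hcl⟩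
    obtain ⟨hc, hv, hb, hcard⟩ := out_dualClass_spec hκ hcl
    obtain ⟨ε, hε, hε'⟩ := exists_indicator hc hv hb hC
    set X := (dualClass c).out
    have hD : Fintype.card X.Edge - n = D := by omega
    refine ⟨fun b => ε / X.cardAut * X.polytopeVolume b,
      continuous_const.mul (continuous_polytopeVolume hc hv hb), fun τ hτ x => ?_,
      fun _ => ⟨fun b hbC => ?_, fun b hbC => ?_⟩⟩
    · simp only [polytopeVolume_smul hc hv hb hτ, hD]
      ring
    · rw [hε' b hbC]
      ring
    · have hev : Even (∑ i, b i) := by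
        have : (∑ i, b i) ≡ ∑ i, r i [ZMOD 2] := Int.ModEq.sum fun i _ => hbC.2 i
        rw [Int.even_iff] at hr ⊢
        exact Eq.trans this hr
      have hodd : Tendsto (fun s : ℕ => 2 * s + 1) atTop atTop :=
        tendsto_atTop_mono (fun s => show s ≤ 2 * s + 1 by omega) tendsto_id
      have h1 := ((tendsto_interiorCount hc hv hb hev).comp hodd).const_mul (ε / X.cardAut)
      rw [hD] at h1
      rw [← mul_assoc, mul_comm (2 : ℝ), mul_assoc]
      refine h1.congr fun s => ?_
      rw [hε _ (hC.nsmul_mem_cosetPoints hbC ⟨s, rfl⟩).1]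
      simp only [Function.comp_apply]
      ring
  choose v hvc hvs hv using key
  set S := (Set.toFinite (classes g n κ)).toFinset
  have hS : ∀ c ∈ S, c ∈ classes g n κ := fun c => (Set.Finite.mem_toFinset _).mp
  have hV : ∀ b ∈ C, volumeFunction g n κ b = ∑ c ∈ S, v c b := fun b hb => by
    rw [volumeFunction_eq]
    exact Finset.sum_congr rfl fun c hc => (hv c (hS c hc)).1 b hb
  rw [hV b hbC]
  refine hC.eqOn_closure (f := fun b => (p.homogeneousComponent D).eval b)
    (g := fun b => 2 * ∑ c ∈ S, v c b) (d := D) hne (MvPolynomial.continuous_eval _)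
    (continuous_const.mul (continuous_finsetSum _ fun c _ => hvc c))
    (fun τ _ x => (MvPolynomial.homogeneousComponent_isHomogeneous D p).eval_smul τ x)
    (fun τ hτ x => ?_) (fun b hb => ?_) (subset_closure hbC)
  · simp only [hvs _ τ hτ, ← Finset.mul_sum]
    ring
  · refine MvPolynomial.eval_homogeneousComponent_of_tendsto (l := fun s => ((2 * s + 1 : ℕ) : ℝ))
      (tendsto_natCast_atTop_atTop.comp
        (tendsto_atTop_mono (fun s => show s ≤ 2 * s + 1 by omega) tendsto_id)) ?_
    rw [Finset.mul_sum]
    refine (tendsto_finsetSum S fun c hc => (hv c (hS c hc)).2 b hb).congr fun s => ?_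
    have h1 : castVec ((2 * s + 1) • b) = ((2 * s + 1 : ℕ) : ℝ) • castVec b := by
      ext i
      simp
    rw [← h1, ← hp _ (hC.nsmul_mem_cosetPoints hb ⟨s, rfl⟩), metricCountingFunction_eq,
      Finset.sum_div]

end CountingFunctions

theorem proposition3p1 :
    -- polytopes of a single graph
    (∀ (n : ℕ) (H : Type*) [Fintype H] (G : LabelledRibbonGraph n H),
      G.Connected → G.VertexLabelled → ¬ G.Bipartite →
      ∀ C : Set (Fin n → ℝ), IsCell C →
        (∀ r : Fin n → ℤ, ∃ p : MvPolynomial (Fin n) ℝ,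
          p.totalDegree + n ≤ Fintype.card G.Edge ∧
          ∀ b ∈ cosetPoints C r,
            (G.interiorCount (fun i => (b i : ℝ)) : ℝ) = p.eval (fun i => (b i : ℝ))) ∧
        (∃ p : MvPolynomial (Fin n) ℝ,
          (∀ b ∈ closure C, G.polytopeVolume b = p.eval b) ∧
          -- identically zero, or of degree exactly `|E| - |V|` as a polynomial on the closed cell
          ((∀ b ∈ closure C, G.polytopeVolume b = 0) ∨
            (p.totalDegree + n = Fintype.card G.Edge ∧
              ∀ q : MvPolynomial (Fin n) ℝ, (∀ b ∈ closure C, G.polytopeVolume b = q.eval b) →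
                p.totalDegree ≤ q.totalDegree)))) ∧
    -- counting functions
    (∀ (g n m : ℕ) (κ : m.Partition), (∀ k ∈ κ.parts, Odd k) →
      ∀ C : Set (Fin n → ℝ), IsCell C →
        (∀ r : Fin n → ℤ, ∃ p : MvPolynomial (Fin n) ℝ,
          p.totalDegree ≤ 2 * g + κ.parts.card - 2 ∧
          ∀ b ∈ cosetPoints C r,
            metricCountingFunction g n κ b = p.eval (fun i => (b i : ℝ))) ∧
        (∃ p : MvPolynomial (Fin n) ℝ, ∀ b ∈ C, volumeFunction g n κ b = p.eval b) ∧
        (∀ r : Fin n → ℤ, Even (∑ i, r i) → (cosetPoints C r).Nonempty →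
          ∀ p : MvPolynomial (Fin n) ℝ,
            (∀ b ∈ cosetPoints C r,
              metricCountingFunction g n κ b = p.eval (fun i => (b i : ℝ))) →
            ∀ b ∈ C,
              (p.homogeneousComponent (2 * g + κ.parts.card - 2)).eval b =
                2 * volumeFunction g n κ b)) := by
  refine ⟨fun n H _ G hc hv hb C hC => ⟨fun r => ?_, polytopeVolume_isPolynomial hc hv hb hC⟩,
    fun g n m κ hκ C hC => ⟨fun r => ?_, volumeFunction_isPolynomial hκ hC,
      fun r hr hne p hp b hbC =>
        homogeneousComponent_metricCountingFunction hκ hC hr hne hp hbC⟩⟩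
  · obtain ⟨hn, f, ⟨p, hpd, hp⟩, hf⟩ := G.interiorCount_isPolyFun hc hv hb hC r
    exact ⟨p, by omega, fun b hbC => (hf b hbC).trans (hp _)⟩
  · obtain ⟨f, ⟨p, hpd, hp⟩, hf⟩ := metricCountingFunction_isPolyFun (g := g) hκ hC r
    exact ⟨p, hpd, fun b hbC => (hf b hbC).trans (hp _)⟩
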